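/- **Setting.** Let $\ell\ge 1$ be an integer, $\rho>0$ and $m_\mu,M_\mu>0$. Let $\Omega\subset\mathbb R^2$ be a polygonal domain (bounded, open, connected, $\operatorname{int}\overline\Omega=\Omega$, $\partial\Omega$ a finite union of segments), $f\in L^2(\Omega)$, and let $\mu\in C^0(\overline\Omega\times[0,\infty))$ satisfy $$m_\mu(t-s)\le \mu(x,t)t-\mu(x,s)s\le M_\mu(t-s)\qquad (t\ge s\ge 0,\ x\in\overline\Omega).$$ Write $\mu(|G|)G$ for the vector field $x\mapsto\mu(x,|G(x)|)\,G(x)$. Let $u\in H^1_0(\Omega)$ be the weak solution of $-\nabla\cdot(\mu(|\nabla u|)\nabla u)=f$, i.e. $\int_\Omega\mu(|\nabla u|)\nabla u\cdot\nabla v=\int_\Omega fv$ for all $v\in H^1_0(\Omega)$. *Mesh.* Let $\mathcal T_h$ be a finite tessellation of $\Omega$ into nonoverlapping simple polygons $E$ (with diameters $h_E$, and $h=\max_E h_E$; consecutive edges of a polygon may be collinear) such that every $E$ is star-shaped with respect to a ball of radius $\rho h_E$ and $h_e\ge\rho h_E$ for the length $h_e$ of every edge $e\subset\partial E$. $\mathbb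 P_k$ denotes polynomials of degree at most $k$ ($\mathbb P_{-1}=\{0\}$), and $\mathcal P^E_k$ the $L^2(E)$-orthogonal projection onto $\mathbb P_k(E)$, applied componentwise to vector fields. *Local spaces.* Let $$\widetilde V^E=\{v\in H^1(E):\ \Delta v\in\mathbb P_\ell(E),\ v|_{\partial E}\in C^0(\partial E),\ v|_e\in\mathbb P_\ell(e)\ \text{for every edge } e\subset\partial E\}.$$ Let $\Lambda^E$ be the set of degrees of freedom: the values at the vertices of $E$; for each edge $e$ with midpoint $s_e$ the moments $\frac1{|e|}\int_e v\,\big(\tfrac{s-s_e}{h_e}\big)^j ds$, $0\le j\le \ell-2$; and the moments $\frac1{|E|}\int_E v\,\big(\tfrac{x-x_E}{h_E}\big)^\alpha dx$, $|\alpha|\le\ell-2$, where $x_E$ is the barycentre of $E$. For each $E\in\mathcal T_h$ let $\Pi^E_0:\widetilde V^E\to\mathbb P_\ell(E)$ and $\Pi^e_0:\widetilde V^E\to\mathbb P_\ell(e)$ ($e\subset\partial E$) be any linear combinations of the degrees of freedom in $\Lambda^E$ such that * $\int_E \Pi^E_0v\,p=\int_E v\,p$ for all $p\in\mathbb P_{\ell-2}(E)$,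 and $\Pi^E_0q=q$ for all $q\in\mathbb P_\ell(E)$; * $\Pi^e_0v=v$ at the end points of $e$, $\int_e\Pi^e_0v\,p\,ds=\int_e v\,p\,ds$ for all $p\in\mathbb P_{\ell-2}(e)$, and $\Pi^e_0q=q|_e$ for all $q\in\mathbb P_\ell(E)$. Let $\Pi^E_1v\in[\mathbb P_{\ell-1}(E)]^2$ be defined by $\int_E\Pi^E_1v\cdot p=-\int_E\Pi^E_0v\,\nabla\cdot p+\sum_{e\subset\partial E}\int_e\Pi^e_0v\;p\cdot n\,ds$ for all $p\in[\mathbb P_{\ell-1}(E)]^2$, where $n$ is the unit outward normal. Put $$V^E_h=\{v\in\widetilde V^E:\ \textstyle\int_E(v-\Pi^E_0v)p=0\ \ \forall p\in\mathbb P_\ell(E)\setminus\mathbb P_{\ell-2}(E)\},\qquad V_h=\{v\in H^1_0(\Omega):\ v|_E\in V^E_h\ \ \forall E\in\mathcal T_h\}.$$ *Discrete problem.* Let $S^E(v,w)=M_\mu m_\mu\sum_{\lambda\in\Lambda^E}\lambda(v)\lambda(w)$ and let $u_h\in V_h$ be the virtual element solution: for all $v_h\in V_h$, $$\sum_{E\in\mathcal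 T_h}\Big[\int_E\mu(|\Pi^E_1u_h|)\,\Pi^E_1u_h\cdot\Pi^E_1v_h+S^E\big(u_h-\Pi^E_0u_h,\;v_h-\Pi^E_0v_h\big)\Big]=\sum_{E\in\mathcal T_h}\int_E\mathcal P^E_\ell f\;v_h .$$ For $E\in\mathcal T_h$ define $$\mathcal S_E^2=S^E\big((I-\mathcal P^E_\ell)u_h,(I-\mathcal P^E_\ell)u_h\big),\qquad \Psi_E^2=\big\|(\mathcal P^E_{\ell-1}-I)\big(\mu(|\mathcal P^E_{\ell-1}\nabla u_h|)\,\mathcal P^E_{\ell-1}\nabla u_h\big)\big\|_{0,E}^2 .$$ **Theorem (lower bound for the inconsistency term).** There is a constant $C>0$, depending only on $\ell,\rho,m_\mu,M_\mu$ (in particular independent of $h$, $u$ and $u_h$), such that for every $E\in\mathcal T_h$ $$\Psi_E^2\le C\Big(\|\nabla(u-u_h)\|_{0,E}^2+\mathcal S_E^2+\|(\mathcal P^E_{\ell-1}-I)\,\mu(|\nabla u|)\nabla u\|_{0,E}^2\Big).$$ -/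

import Mathlib

open MeasureTheory Set Filter Topology
open scoped ContDiff

noncomputable section

namespace VEM

/-- The Euclidean plane. -/
abbrev Plane : Type := EuclideanSpace ℝ (Fin 2)

/-! ### Sobolev spaces `H¹(U)` and `H¹₀(U)`

Elements are represented by functions `Plane → ℝ`; only their values a.e. on `U` matter. -/

/-- Test functions: `C_c^∞(U)`. -/
def IsTest (U : Set Plane) (φ : Plane → ℝ) : Prop :=
  ContDiff ℝ ∞ φ ∧ HasCompactSupport φ ∧ tsupport φ ⊆ U

/-- `G ∈ L²(U)²` is the weak gradient of `v` on `U`. -/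
def IsWeakGradient (U : Set Plane) (v : Plane → ℝ) (G : Plane → Plane) : Prop :=
  MemLp G 2 (volume.restrict U) ∧
    ∀ φ : Plane → ℝ, IsTest U φ → ∀ e : Plane,
      ∫ x in U, v x * fderiv ℝ φ x e = -∫ x in U, inner ℝ (G x) e * φ x

/-- `v ∈ H¹(U)`. -/
def MemH1 (U : Set Plane) (v : Plane → ℝ) : Prop :=
  MemLp v 2 (volume.restrict U) ∧ ∃ G, IsWeakGradient U v G

open Classical in
/-- The weak gradient `∇v` on `U` of `v ∈ H¹(U)` (a representative of it). -/
def weakGrad (U : Set Plane) (v : Plane → ℝ) : Plane → Plane :=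
  if h : ∃ G, IsWeakGradient U v G then h.choose else 0

/-- `φ n → v` in `H¹(U)`, for smooth functions `φ n` and `v ∈ H¹(U)`. -/
def TendstoH1 (U : Set Plane) (φ : ℕ → Plane → ℝ) (v : Plane → ℝ) : Prop :=
  Tendsto (fun n => eLpNorm (fun x => φ n x - v x) 2 (volume.restrict U)) atTop (𝓝 0) ∧
    Tendsto (fun n => eLpNorm (fun x => gradient (φ n) x - weakGrad U v x) 2
      (volume.restrict U)) atTop (𝓝 0)

/-- `v ∈ H¹₀(U)`, the closure of `C_c^∞(U)` in `H¹(U)`. -/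
def MemH10 (U : Set Plane) (v : Plane → ℝ) : Prop :=
  MemH1 U v ∧ ∃ φ : ℕ → Plane → ℝ, (∀ n, IsTest U (φ n)) ∧ TendstoH1 U φ v

/-- The squared norm `‖F‖²_{0,U}`, for scalar or vector valued `F ∈ L²(U)`. -/
def normSq {V : Type*} [NormedAddCommGroup V] (U : Set Plane) (F : Plane → V) : ℝ :=
  ∫ x in U, ‖F x‖ ^ 2

/-! ### Polynomials -/

/-- The polynomials in two variables of total degree at most `k`, that is `ℙ_k`. -/
abbrev polyLE (k : ℕ) : Submodule ℝ (MvPolynomial (Fin 2) ℝ) :=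
  MvPolynomial.restrictTotalDegree (Fin 2) ℝ k

/-- The function on the plane defined by a polynomial. -/
def polyFun (p : MvPolynomial (Fin 2) ℝ) (x : Plane) : ℝ :=
  MvPolynomial.eval (fun i => x i) p

/-- The vector field defined by a pair of polynomials. -/
def vpolyFun (q : Fin 2 → MvPolynomial (Fin 2) ℝ) (x : Plane) : Plane :=
  WithLp.toLp 2 fun i => polyFun (q i) x

/-- The divergence of a polynomial vector field. -/
def divPoly (q : Fin 2 → MvPolynomial (Fin 2) ℝ) : MvPolynomial (Fin 2) ℝ :=
  ∑ i, MvPolynomial.pderiv i (q i)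

/-! ### Polygons -/

/-- Rotation of a vector by a right angle, counterclockwise. -/
def rotL (τ : Plane) : Plane := !₂[-τ 1, τ 0]

/-- A simple polygon with `extra + 3` vertices, listed counterclockwise (consecutive edges may be
collinear, so that hanging nodes count as vertices). The polygon itself is the open region
`carrier`. -/
structure Polygon where
  extra : ℕ
  vertex : Fin (extra + 3) → Plane
  vertex_injective : Function.Injective vertex
  /-- Consecutive edges meet only in their common vertex. -/
  adjacent_edges : ∀ i, segment ℝ (vertex i) (vertex (i + 1)) ∩
    segment ℝ (vertex (i + 1)) (vertex (i + 1 + 1)) = {vertex (i + 1)}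
  /-- Edges which are not consecutive do not meet. -/
  other_edges : ∀ i j, j ≠ i → j ≠ i + 1 → i ≠ j + 1 →
    Disjoint (segment ℝ (vertex i) (vertex (i + 1))) (segment ℝ (vertex j) (vertex (j + 1)))
  carrier : Set Plane
  isOpen : IsOpen carrier
  isConnected : IsConnected carrier
  isBounded : Bornology.IsBounded carrier
  frontier_eq : frontier carrier = ⋃ i, segment ℝ (vertex i) (vertex (i + 1))
  /-- The region lies to the left of each of its oriented edges. -/
  interior_left : ∀ i, ∀ x ∈ openSegment ℝ (vertex i) (vertex (i + 1)),
    ∀ᶠ ε : ℝ in 𝓝[>] 0, x + ε • rotL (vertex (i + 1) - vertex i) ∈ carrier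

namespace Polygon

variable (E : Polygon)

/-- The index type of the vertices, and of the edges, of a polygon. -/
abbrev Idx : Type := Fin (E.extra + 3)

/-- The diameter `h_E`. -/
def diam : ℝ := Metric.diam E.carrier

/-- The area `|E|`. -/
def area : ℝ := volume.real E.carrier

/-- The barycentre of `E`. -/
def center : Plane := (E.area)⁻¹ • ∫ x in E.carrier, x

/-- The length `h_e` of the edge `i`. -/
def edgeLength (i : E.Idx) : ℝ := dist (E.vertex i) (E.vertex (i + 1))

/-- The parametrisation of the edge `i` over `[0,1]`. -/
def edgePt (i : E.Idx) (t : ℝ) : Plane :=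
  AffineMap.lineMap (E.vertex i) (E.vertex (i + 1)) t

/-- The unit outward normal on the edge `i`. -/
def normal (i : E.Idx) : Plane :=
  -((E.edgeLength i)⁻¹ • rotL (E.vertex (i + 1) - E.vertex i))

end Polygon

/-! ### The `L²` projections onto polynomials -/

theorem continuous_polyFun (p : MvPolynomial (Fin 2) ℝ) : Continuous (polyFun p) := by
  have h : Continuous fun x : Plane => (fun i => x i : Fin 2 → ℝ) := by fun_prop
  exact (MvPolynomial.continuous_eval p).comp h

theorem memLp_polyFun (E : Polygon) (p : MvPolynomial (Fin 2) ℝ) :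
    MemLp (polyFun p) 2 (volume.restrict E.carrier) := by
  have hK : IsCompact (closure E.carrier) := E.isBounded.isCompact_closure
  obtain ⟨C, hC⟩ := hK.exists_bound_of_continuousOn (continuous_polyFun p).continuousOn
  have : IsFiniteMeasure (volume.restrict E.carrier) :=
    ⟨by simpa using E.isBounded.measure_lt_top⟩
  refine MemLp.of_bound (continuous_polyFun p).aestronglyMeasurable C ?_
  filter_upwards [ae_restrict_mem E.isOpen.measurableSet] with x hx
  exact hC x (subset_closure hx)

theorem integrable_polyFun_mul (E : Polygon) (p q : MvPolynomial (Fin 2) ℝ) :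
    Integrable (fun x => polyFun p x * polyFun q x) (volume.restrict E.carrier) :=
  (memLp_polyFun E p).integrable_mul (memLp_polyFun E q)

theorem eq_zero_of_polyFun_eq_zero (E : Polygon) (p : MvPolynomial (Fin 2) ℝ)
    (h : ∀ x ∈ E.carrier, polyFun p x = 0) : p = 0 := by
  obtain ⟨c, hc⟩ := E.isConnected.nonempty
  have hopen : IsOpen ((fun y : Fin 2 → ℝ => (WithLp.toLp 2 y : Plane)) ⁻¹' E.carrier) :=
    E.isOpen.preimage (PiLp.continuous_toLp 2 _)
  obtain ⟨ε, hε, hball⟩ := Metric.isOpen_iff.1 hopen (fun i => c i) (by simpa using hc)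
  refine MvPolynomial.funext_set (fun i => Metric.ball (c i) ε) (fun i => ?_) fun y hy => ?_
  · rw [Real.ball_eq_Ioo]
    exact Set.Ioo_infinite (by linarith)
  · have hy' : y ∈ Metric.ball (fun i => c i) ε := by
      rw [ball_pi _ hε]; exact hy
    simpa [polyFun] using h _ (hball hy')

/-- A linear functional on `ℙ_k` is represented by a unique polynomial with respect to the `L²(E)`
inner product. -/
theorem existsUnique_riesz (E : Polygon) (k : ℕ) (L : polyLE k →ₗ[ℝ] ℝ) :
    ∃! p : MvPolynomial (Fin 2) ℝ, p ∈ polyLE k ∧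
      ∀ q : polyLE k, ∫ x in E.carrier, polyFun p x * polyFun q.1 x = L q := by
  let B : polyLE k →ₗ[ℝ] (polyLE k →ₗ[ℝ] ℝ) :=
    LinearMap.mk₂ ℝ (fun p q => ∫ x in E.carrier, polyFun p.1 x * polyFun q.1 x)
      (fun p p' q => by
        rw [← integral_add (integrable_polyFun_mul E _ _) (integrable_polyFun_mul E _ _)]
        simp [polyFun, add_mul])
      (fun c p q => by
        rw [smul_eq_mul, ← integral_const_mul]
        simp [polyFun, mul_assoc])
      (fun p q q' => by
        rw [← integral_add (integrable_polyFun_mul E _ _) (integrable_polyFun_mul E _ _)]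
        simp [polyFun, mul_add])
      (fun c p q => by
        rw [smul_eq_mul, ← integral_const_mul]
        simp [polyFun, mul_left_comm])
  have hB : ∀ p q : polyLE k, B p q = ∫ x in E.carrier, polyFun p.1 x * polyFun q.1 x :=
    fun p q => rfl
  have hinj : Function.Injective B := by
    rw [← LinearMap.ker_eq_bot, LinearMap.ker_eq_bot']
    intro p hp
    have h0 : ∫ x in E.carrier, polyFun p.1 x * polyFun p.1 x = 0 := by
      rw [← hB, hp]; rfl
    rw [integral_eq_zero_iff_of_nonneg (fun x => mul_self_nonneg _)
      (integrable_polyFun_mul E _ _)] at h0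
    have h1 := Measure.eqOn_open_of_ae_eq h0 E.isOpen
      ((continuous_polyFun p.1).mul (continuous_polyFun p.1)).continuousOn continuousOn_const
    exact Subtype.ext (eq_zero_of_polyFun_eq_zero E p.1 fun x hx => mul_self_eq_zero.1 (h1 hx))
  have hsurj : Function.Surjective B :=
    (LinearMap.injective_iff_surjective_of_finrank_eq_finrank
      (Subspace.dual_finrank_eq (K := ℝ) (V := polyLE k)).symm).1 hinj
  obtain ⟨p, hp⟩ := hsurj L
  refine ⟨p.1, ⟨p.2, fun q => by rw [← hp, hB]⟩, ?_⟩
  rintro r ⟨hr, hr'⟩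
  have : B ⟨r, hr⟩ = B p := by
    rw [hp]; ext q; rw [← hr' q, hB]
  exact congrArg Subtype.val (hinj this)

/-- `p` is the `L²(E)`-orthogonal projection of `w` onto `ℙ_k(E)`. -/
def IsL2Proj (E : Polygon) (k : ℕ) (w : Plane → ℝ) (p : MvPolynomial (Fin 2) ℝ) : Prop :=
  p ∈ polyLE k ∧ ∀ q ∈ polyLE k,
    ∫ x in E.carrier, polyFun p x * polyFun q x = ∫ x in E.carrier, w x * polyFun q x

theorem existsUnique_isL2Proj (E : Polygon) (k : ℕ) {w : Plane → ℝ}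
    (hw : MemLp w 2 (volume.restrict E.carrier)) : ∃! p, IsL2Proj E k w p := by
  have hint : ∀ q, Integrable (fun x => w x * polyFun q x) (volume.restrict E.carrier) :=
    fun q => hw.integrable_mul (memLp_polyFun E q)
  let L : polyLE k →ₗ[ℝ] ℝ :=
    { toFun := fun q => ∫ x in E.carrier, w x * polyFun q.1 x
      map_add' := fun q q' => by
        rw [← integral_add (hint _) (hint _)]
        simp [polyFun, mul_add]
      map_smul' := fun c q => by
        simp only [RingHom.id_apply, smul_eq_mul]
        rw [← integral_const_mul]
        simp [polyFun, mul_left_comm] }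
  obtain ⟨p, ⟨hp, hp'⟩, huniq⟩ := existsUnique_riesz E k L
  refine ⟨p, ⟨hp, fun q hq => hp' ⟨q, hq⟩⟩, ?_⟩
  rintro r ⟨hr, hr'⟩
  exact huniq r ⟨hr, fun q => hr' q.1 q.2⟩

open Classical in
/-- The `L²`-orthogonal projection `𝒫_k^E : L²(E) → ℙ_k(E)`. -/
def l2Proj (E : Polygon) (k : ℕ) (w : Plane → ℝ) : MvPolynomial (Fin 2) ℝ :=
  if h : ∃ p, IsL2Proj E k w p then h.choose else 0

/-- The projection `𝒫_k^E` of a vector field, componentwise. -/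
def l2ProjV (E : Polygon) (k : ℕ) (F : Plane → Plane) : Fin 2 → MvPolynomial (Fin 2) ℝ :=
  fun i => l2Proj E k fun x => F x i

/-! ### Traces and degrees of freedom -/

/-- `γ` is the trace on `∂E` of `v ∈ H¹(E)`: the `L²(∂E)`-limit of the boundary values of smooth
functions converging to `v` in `H¹(E)`. -/
def HasTrace (E : Polygon) (v γ : Plane → ℝ) : Prop :=
  ∃ φ : ℕ → Plane → ℝ, (∀ n, ContDiff ℝ ∞ (φ n)) ∧ TendstoH1 E.carrier φ v ∧
    ∀ i, Tendsto (fun n => eLpNorm (fun t => φ n (E.edgePt i t) - γ (E.edgePt i t)) 2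
      (volume.restrict (Icc (0 : ℝ) 1))) atTop (𝓝 0)

open Classical in
/-- The trace of `v` on `∂E`, for a function whose trace is continuous: its continuous
representative. -/
def trace (E : Polygon) (v : Plane → ℝ) : Plane → ℝ :=
  if h : ∃ γ, ContinuousOn γ (frontier E.carrier) ∧ HasTrace E v γ then h.choose else 0

/-- The index set of the degrees of freedom `Λ^E` of order `ℓ`: vertices, edge moments of order
at most `ℓ - 2`, interior moments of order at most `ℓ - 2`. -/
abbrev DofIdx (E : Polygon) (ℓ : ℕ) : Type :=
  E.Idx ⊕ (E.Idx × Fin (ℓ - 1)) ⊕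
    {α : Fin (ℓ - 1) × Fin (ℓ - 1) // (α.1 : ℕ) + (α.2 : ℕ) + 2 ≤ ℓ}

/-- The degrees of freedom `λ(v)`, `λ ∈ Λ^E`: the values at the vertices, and the moments
`|e|⁻¹ ∫_e v m ds` and `|E|⁻¹ ∫_E v m dx` against the scaled monomials
`m = ((s - s_e) / h_e) ^ j` and `m = ((x - x_E) / h_E) ^ α`, where `s_e` is the midpoint of `e` and
`x_E` the barycentre of `E`. -/
def dof (E : Polygon) (ℓ : ℕ) (v : Plane → ℝ) : DofIdx E ℓ → ℝ
  | .inl i => trace E v (E.vertex i)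
  | .inr (.inl (i, j)) => ∫ t in (0 : ℝ)..1, trace E v (E.edgePt i t) * (t - 1 / 2) ^ (j : ℕ)
  | .inr (.inr α) => (E.area)⁻¹ * ∫ x in E.carrier, v x *
      (((x 0 - E.center 0) / E.diam) ^ (α.1.1 : ℕ) * ((x 1 - E.center 1) / E.diam) ^ (α.1.2 : ℕ))

/-! ### Virtual element spaces and projections -/

/-- Membership in the enlarged virtual element space on `E`: `v ∈ H¹(E)`, `v|_e ∈ ℙ_ℓ(e)` for every
edge (with `v` continuous on `∂E`), and `Δv ∈ ℙ_ℓ(E)` in the sense of distributions. -/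
def MemEnlarged (E : Polygon) (ℓ : ℕ) (v : Plane → ℝ) : Prop :=
  MemH1 E.carrier v ∧
  (∃ γ, ContinuousOn γ (frontier E.carrier) ∧ HasTrace E v γ ∧
    ∀ i, ∃ p : Polynomial ℝ, p.natDegree ≤ ℓ ∧ ∀ t ∈ Icc (0 : ℝ) 1, γ (E.edgePt i t) = p.eval t) ∧
  ∃ q ∈ polyLE ℓ, ∀ φ, IsTest E.carrier φ →
    ∫ x in E.carrier, v x * Laplacian.laplacian φ x = ∫ x in E.carrier, polyFun q x * φ x

/-- Two operators given as linear combinations of the degrees of freedom, with polynomial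
coefficients: a value projection `Π₀^E` and, for each edge `e`, an edge projection `Π₀^e`, whose
values are polynomials in the parameter `t ∈ [0,1]` of the edge. -/
structure Projections (E : Polygon) (ℓ : ℕ) where
  valueCoeff : DofIdx E ℓ → MvPolynomial (Fin 2) ℝ
  edgeCoeff : E.Idx → DofIdx E ℓ → Polynomial ℝ

namespace Projections

variable {E : Polygon} {ℓ : ℕ} (P : Projections E ℓ)

/-- The value projection `Π₀^E v`. -/
def value (v : Plane → ℝ) : MvPolynomial (Fin 2) ℝ :=
  ∑ a, dof E ℓ v a • P.valueCoeff a

/-- The edge projection `Π₀^e v`. -/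
def edge (i : E.Idx) (v : Plane → ℝ) : Polynomial ℝ :=
  ∑ a, dof E ℓ v a • P.edgeCoeff i a

/-- The properties required of the value and edge projections. Polynomials of degree at most
`ℓ - 2` are those with `degree + 2 ≤ ℓ`, so that there are none to test with if `ℓ = 1`. -/
structure Admissible : Prop where
  valueCoeff_mem : ∀ a, P.valueCoeff a ∈ polyLE ℓ
  edgeCoeff_degree : ∀ i a, (P.edgeCoeff i a).natDegree ≤ ℓ
  value_moments : ∀ v, MemEnlarged E ℓ v → ∀ p : MvPolynomial (Fin 2) ℝ, p.totalDegree + 2 ≤ ℓ →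
    ∫ x in E.carrier, polyFun (P.value v) x * polyFun p x = ∫ x in E.carrier, v x * polyFun p x
  value_poly : ∀ q ∈ polyLE ℓ, P.value (polyFun q) = q
  edge_left : ∀ v, MemEnlarged E ℓ v → ∀ i, (P.edge i v).eval 0 = trace E v (E.vertex i)
  edge_right : ∀ v, MemEnlarged E ℓ v → ∀ i, (P.edge i v).eval 1 = trace E v (E.vertex (i + 1))
  edge_moments : ∀ v, MemEnlarged E ℓ v → ∀ i, ∀ p : Polynomial ℝ, p.natDegree + 2 ≤ ℓ →
    ∫ t in (0 : ℝ)..1, (P.edge i v).eval t * p.eval t =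
      ∫ t in (0 : ℝ)..1, trace E v (E.edgePt i t) * p.eval t
  edge_poly : ∀ q ∈ polyLE ℓ, ∀ i, ∀ t ∈ Icc (0 : ℝ) 1,
    (P.edge i (polyFun q)).eval t = polyFun q (E.edgePt i t)

/-- `q ∈ [ℙ_{ℓ-1}(E)]²` is the gradient projection of `v`. -/
def IsGrad (v : Plane → ℝ) (q : Fin 2 → MvPolynomial (Fin 2) ℝ) : Prop :=
  (∀ i, q i ∈ polyLE (ℓ - 1)) ∧
    ∀ p : Fin 2 → MvPolynomial (Fin 2) ℝ, (∀ i, p i ∈ polyLE (ℓ - 1)) →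
      ∫ x in E.carrier, inner ℝ (vpolyFun q x) (vpolyFun p x) =
        -(∫ x in E.carrier, polyFun (P.value v) x * polyFun (divPoly p) x) +
          ∑ i, E.edgeLength i * ∫ t in (0 : ℝ)..1,
            (P.edge i v).eval t * inner ℝ (vpolyFun p (E.edgePt i t)) (E.normal i)

open Classical in
/-- The gradient projection `Π₁^E v`. -/
def grad (v : Plane → ℝ) : Fin 2 → MvPolynomial (Fin 2) ℝ :=
  if h : ∃ q, P.IsGrad v q then h.choose else 0

/-- Membership in the local virtual element space `V_{h,ℓ}^E`. -/
def MemLocal (v : Plane → ℝ) : Prop :=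
  MemEnlarged E ℓ v ∧ ∀ p ∈ polyLE ℓ, ¬ p.totalDegree + 2 ≤ ℓ →
    ∫ x in E.carrier, (v x - polyFun (P.value v) x) * polyFun p x = 0

end Projections

/-- The dofi-dofi stabilisation `S^E(z; v, w) = M_μ m_μ ∑_{λ ∈ Λ^E} λ(v) λ(w)` (which does not
depend on `z`). -/
def stab (E : Polygon) (ℓ : ℕ) (m M : ℝ) (v w : Plane → ℝ) : ℝ :=
  M * m * ∑ a, dof E ℓ v a * dof E ℓ w a

/-! ### Domain, mesh, nonlinearity -/

/-- A polygonal domain: a bounded domain, whose boundary consists of finitely many segments, and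
which lies on one side of its boundary (no cracks or punctures). -/
structure IsPolygonalDomain (Ω : Set Plane) : Prop where
  isOpen : IsOpen Ω
  isConnected : IsConnected Ω
  isBounded : Bornology.IsBounded Ω
  interior_closure : interior (closure Ω) = Ω
  frontier_eq : ∃ S : Finset (Plane × Plane), frontier Ω = ⋃ s ∈ S, segment ℝ s.1 s.2

/-- A tessellation of `Ω` into finitely many nonoverlapping simple polygons. -/
structure Mesh (Ω : Set Plane) where
  elements : Finset Polygon
  disjoint : ∀ E ∈ elements, ∀ E' ∈ elements, E ≠ E' → Disjoint E.carrier E'.carrier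
  closure_eq : closure Ω = ⋃ E ∈ elements, closure E.carrier

/-- Mesh regularity with constant `ρ`: elements are star-shaped with respect to every point of
a ball of radius `ρ h_E`, and `h_e ≥ ρ h_E` for every edge `e` of `E`. -/
def Mesh.Regular {Ω : Set Plane} (T : Mesh Ω) (ρ : ℝ) : Prop :=
  ∀ E ∈ T.elements,
    (∃ c, ∀ y ∈ Metric.ball c (ρ * E.diam), StarConvex ℝ y E.carrier) ∧
      ∀ i, ρ * E.diam ≤ E.edgeLength i

/-- The assumptions on the nonlinearity `μ(x,t)`, with constants `m = m_μ` and `M = M_μ`. -/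
structure IsNonlinearity (Ω : Set Plane) (m M : ℝ) (μ : Plane → ℝ → ℝ) : Prop where
  continuousOn : ContinuousOn (fun z : Plane × ℝ => μ z.1 z.2) (closure Ω ×ˢ Ici 0)
  bounds : ∀ x ∈ closure Ω, ∀ s t : ℝ, 0 ≤ s → s ≤ t →
    m * (t - s) ≤ μ x t * t - μ x s * s ∧ μ x t * t - μ x s * s ≤ M * (t - s)

/-- The flux `μ(x,|G|) G` of a vector field `G`. -/
def flux (μ : Plane → ℝ → ℝ) (G : Plane → Plane) (x : Plane) : Plane :=
  μ x ‖G x‖ • G x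

/-! ### The continuous and the discrete problem -/

/-- `u ∈ H¹₀(Ω)` is the weak solution of `-∇·(μ(x,|∇u|)∇u) = f`. -/
def IsWeakSolution (Ω : Set Plane) (μ : Plane → ℝ → ℝ) (f u : Plane → ℝ) : Prop :=
  MemH10 Ω u ∧ ∀ v, MemH10 Ω v →
    ∫ x in Ω, inner ℝ (flux μ (weakGrad Ω u) x) (weakGrad Ω v x) = ∫ x in Ω, f x * v x

/-- Membership in the global virtual element space `V_{h,ℓ} ⊆ H¹₀(Ω)`. -/
def MemVEM {Ω : Set Plane} (T : Mesh Ω) {ℓ : ℕ} (P : ∀ E, Projections E ℓ) (v : Plane → ℝ) :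
    Prop :=
  MemH10 Ω v ∧ ∀ E ∈ T.elements, (P E).MemLocal v

/-- The local discrete form `a_h^E(z; v, w)`. -/
def localForm (m M : ℝ) (μ : Plane → ℝ → ℝ) {E : Polygon} {ℓ : ℕ} (P : Projections E ℓ)
    (z v w : Plane → ℝ) : ℝ :=
  (∫ x in E.carrier, μ x ‖vpolyFun (P.grad z) x‖ *
      inner ℝ (vpolyFun (P.grad v) x) (vpolyFun (P.grad w) x)) +
    stab E ℓ m M (fun x => v x - polyFun (P.value v) x) (fun x => w x - polyFun (P.value w) x)

/-- `u_h ∈ V_{h,ℓ}` solves the virtual element discretisation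
`a_h(u_h; u_h, v_h) = ∑_E (𝒫_ℓ^E f, v_h)_E` for all `v_h ∈ V_{h,ℓ}`. -/
def IsVEMSolution {Ω : Set Plane} (m M : ℝ) (μ : Plane → ℝ → ℝ) (f : Plane → ℝ) (T : Mesh Ω)
    {ℓ : ℕ} (P : ∀ E, Projections E ℓ) (uh : Plane → ℝ) : Prop :=
  MemVEM T P uh ∧ ∀ vh, MemVEM T P vh →
    ∑ E ∈ T.elements, localForm m M μ (P E) uh uh vh =
      ∑ E ∈ T.elements, ∫ x in E.carrier, polyFun (l2Proj E ℓ f) x * vh x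

/-! ### The local terms of the estimator -/

/-- The stabilisation term `𝒮_E² = S^E(u_h; (I - 𝒫_ℓ^E) u_h, (I - 𝒫_ℓ^E) u_h)`. -/
def stabSq (E : Polygon) (ℓ : ℕ) (m M : ℝ) (uh : Plane → ℝ) : ℝ :=
  stab E ℓ m M (fun x => uh x - polyFun (l2Proj E ℓ uh) x)
    (fun x => uh x - polyFun (l2Proj E ℓ uh) x)

/-- `‖(𝒫_{ℓ-1}^E - I) F‖²_{0,E}` for a vector field `F`. -/
def oscSq (E : Polygon) (ℓ : ℕ) (F : Plane → Plane) : ℝ :=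
  normSq E.carrier fun x => vpolyFun (l2ProjV E (ℓ - 1) F) x - F x

/-- The inconsistency term
`Ψ_E² = ‖(𝒫_{ℓ-1}^E - I)(μ(|𝒫_{ℓ-1}^E ∇u_h|) 𝒫_{ℓ-1}^E ∇u_h)‖²_{0,E}`. -/
def inconsistencySq (Ω : Set Plane) (μ : Plane → ℝ → ℝ) (E : Polygon) (ℓ : ℕ) (uh : Plane → ℝ) :
    ℝ :=
  oscSq E ℓ (flux μ (vpolyFun (l2ProjV E (ℓ - 1) (weakGrad Ω uh))))

end VEM

end

/-! Write `G = ∇u`, `H = ∇u_h`, `K = 𝒫_{ℓ-1}∇u_h`. The projection of the flux of `K` is its best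
polynomial approximation, so it may be replaced by the projection of the flux of `G`. Since `a ↦
μ(x,|a|)a` is Lipschitz with constant `3M`, what remains is the oscillation of the flux of `G` plus
`‖G - K‖ ≤ ‖G - H‖ + ‖K - H‖` (`inconsistency_le`). By best approximation again, `‖K - H‖ ≤ ‖∇v‖`
with `v = u_h - 𝒫_ℓ u_h`. The core of the proof is the bound of `‖∇v‖` by the degrees of freedom of
`v` (`exists_normSq_weakGrad_sub_le`).

On `E` the function `v` has a polynomial Laplacian `q ∈ ℙ_ℓ` and is orthogonal to `ℙ_ℓ`, hence to
`q`. For a Lipschitz function `w` with the boundary values of `v`, testing with `v - w` gives `‖∇v‖²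
= ∫ ∇v·∇w + ∫ q w`. The proof needs three uniform estimates: (a) the boundary values of `v` are
polynomials on the edges, so their size and slope are controlled by vertex values and edge moments
(`exists_abs_eval_le`); (b) the extension `w`, radial from the star centre, satisfies `|w| ≤ S` and
has Lipschitz constant of order `S/h_E`, since `E` is star-shaped with respect to a ball and has no
short edges (`abs_radialExt_sub_le`); (c) `|q| ≤ C h_E⁻² ‖∇v‖` on `E`, by testing `q = Δv` with
rescaled fixed test functions (`exists_abs_polyFun_le`). As `|E| ≤ 4h_E²`, all powers of `h_E`
cancel and `‖∇v‖ ≤ C S` (`exists_sqrt_normSq_le`).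

The trace of `v` is only an `L²(∂E)` limit of traces of smooth functions `φ_n`, so testing with `v -
w` has to be justified (`abs_normSq_add_le`). One tests with `χ_δ(φ_n - w)`, where `χ_δ` cuts off a
boundary strip of width of order `δ`. A Poincaré inequality in the strip bounds `φ_n - w` there by
`O(δ)` up to the boundary mismatch, which compensates `|∇χ_δ| = O(1/δ)`. Letting `n → ∞` removes the
mismatch; letting `δ → 0` then removes the strip term, because the norm of `∇v` on the strip tends
to zero. -/

noncomputable section

namespace VEM

/-! ### The flux -/

namespace IsNonlinearity

variable {Ω : Set Plane} {m M : ℝ} {μ : Plane → ℝ → ℝ}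

theorem abs_sub_le (h : IsNonlinearity Ω m M μ) (hm : 0 < m) {x : Plane} (hx : x ∈ closure Ω)
    {s t : ℝ} (hs : 0 ≤ s) (ht : 0 ≤ t) : |μ x s * s - μ x t * t| ≤ M * |s - t| := by
  rcases le_total s t with hst | hst
  · have h1 := h.bounds x hx s t hs hst
    have h2 : 0 ≤ m * (t - s) := mul_nonneg hm.le (sub_nonneg.2 hst)
    rw [abs_sub_comm, abs_of_nonneg (by linarith), abs_sub_comm, abs_of_nonneg (sub_nonneg.2 hst)]
    exact h1.2
  · have h1 := h.bounds x hx t s ht hst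
    have h2 : 0 ≤ m * (s - t) := mul_nonneg hm.le (sub_nonneg.2 hst)
    rw [abs_of_nonneg (by linarith), abs_of_nonneg (sub_nonneg.2 hst)]
    exact h1.2

theorem norm_smul_le (h : IsNonlinearity Ω m M μ) (hm : 0 < m) {x : Plane} (hx : x ∈ closure Ω)
    (a : Plane) : ‖μ x ‖a‖ • a‖ ≤ M * ‖a‖ := by
  have := h.abs_sub_le hm hx (norm_nonneg a) le_rfl
  simp only [mul_zero, sub_zero, abs_norm, abs_mul] at this
  rwa [norm_smul, Real.norm_eq_abs]

/-- The vector field `a ↦ μ(x,|a|) a` is Lipschitz. -/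
theorem norm_smul_sub_smul_le (h : IsNonlinearity Ω m M μ) (hm : 0 < m) (hM : 0 < M) {x : Plane}
    (hx : x ∈ closure Ω) (a b : Plane) :
    ‖μ x ‖a‖ • a - μ x ‖b‖ • b‖ ≤ 3 * M * ‖a - b‖ := by
  -- The bound `|μ(x,|a|)| ≤ M` comes from dividing by `|a|`, so `a = 0` is treated apart.
  rcases eq_or_ne a 0 with rfl | ha
  · have := h.norm_smul_le hm hx b
    simp only [smul_zero, zero_sub, norm_neg]
    nlinarith [norm_nonneg b]
  have ha' : 0 < ‖a‖ := norm_pos_iff.2 ha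
  have hμ : |μ x ‖a‖| ≤ M := by
    have := h.norm_smul_le hm hx a
    rw [norm_smul, Real.norm_eq_abs] at this
    exact le_of_mul_le_mul_right this ha'
  have h1 : μ x ‖a‖ • a - μ x ‖b‖ • b = μ x ‖a‖ • (a - b) + (μ x ‖a‖ - μ x ‖b‖) • b := by module
  have h2 : ‖μ x ‖a‖ • (a - b)‖ ≤ M * ‖a - b‖ := by
    rw [norm_smul, Real.norm_eq_abs]
    gcongr
  have h3 : ‖(μ x ‖a‖ - μ x ‖b‖) • b‖ ≤ 2 * M * ‖a - b‖ := by
    -- No continuity modulus of `μ` is available; only the scalar flux `μ(x,t)t` is Lipschitz. Both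
    -- terms of this splitting are at most `M|a - b|`, which with the bound in `h2` gives the
    -- constant `3M`.
    have e : (μ x ‖a‖ - μ x ‖b‖) * ‖b‖ =
        (μ x ‖a‖ * ‖a‖ - μ x ‖b‖ * ‖b‖) - μ x ‖a‖ * (‖a‖ - ‖b‖) := by ring
    have h4 := h.abs_sub_le hm hx (norm_nonneg a) (norm_nonneg b)
    have h5 : |μ x ‖a‖ * (‖a‖ - ‖b‖)| ≤ M * |‖a‖ - ‖b‖| := by
      rw [abs_mul]; gcongr
    have h6 := abs_norm_sub_norm_le a b
    calc ‖(μ x ‖a‖ - μ x ‖b‖) • b‖ = |(μ x ‖a‖ - μ x ‖b‖) * ‖b‖| := by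
          rw [norm_smul, Real.norm_eq_abs, abs_mul, abs_norm]
      _ ≤ M * |‖a‖ - ‖b‖| + M * |‖a‖ - ‖b‖| := by
          rw [e]; exact (abs_sub _ _).trans (add_le_add h4 h5)
      _ ≤ 2 * M * ‖a - b‖ := by nlinarith
  rw [h1]
  exact (norm_add_le _ _).trans (by linarith)

/-- The flux of a square integrable vector field is square integrable. -/
theorem memLp_flux (h : IsNonlinearity Ω m M μ) (hm : 0 < m) {U : Set Plane}
    (hU : MeasurableSet U) (hUΩ : U ⊆ closure Ω) {G : Plane → Plane}
    (hG : MemLp G 2 (volume.restrict U)) : MemLp (flux μ G) 2 (volume.restrict U) := by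
  refine hG.of_le_mul (c := M) ?_ ?_
  -- `μ` is only known to be continuous on `closure Ω × [0,∞)`. Its extension by zero is Borel and
  -- agrees with `μ` at every `(x, |G x|)` with `x ∈ U`.
  · have hmeas : Measurable ((closure Ω ×ˢ Ici (0 : ℝ)).indicator
        fun z : Plane × ℝ => μ z.1 z.2) := by
      have hms : MeasurableSet (closure Ω ×ˢ Ici (0 : ℝ)) :=
        isClosed_closure.measurableSet.prod measurableSet_Ici
      classical
      have := h.continuousOn.measurable_piecewise
        (continuousOn_const (c := (0 : ℝ)) (s := (closure Ω ×ˢ Ici (0 : ℝ))ᶜ)) hms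
      rwa [← piecewise_eq_indicator]
    have h1 : AEMeasurable (fun x => (closure Ω ×ˢ Ici (0 : ℝ)).indicator
        (fun z : Plane × ℝ => μ z.1 z.2) (x, ‖G x‖)) (volume.restrict U) :=
      hmeas.comp_aemeasurable (aemeasurable_id.prodMk hG.aestronglyMeasurable.aemeasurable.norm)
    refine (h1.aestronglyMeasurable.smul hG.aestronglyMeasurable).congr ?_
    filter_upwards [ae_restrict_mem hU] with x hx
    simp [flux, indicator_of_mem (show (x, ‖G x‖) ∈ closure Ω ×ˢ Ici (0 : ℝ) from
      ⟨hUΩ hx, norm_nonneg _⟩)]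
  · filter_upwards [ae_restrict_mem hU] with x hx
    exact h.norm_smul_le hm (hUΩ hx) _

end IsNonlinearity

/-! ### Polynomials in one variable: control by degrees of freedom -/

/-- A linear functional is bounded by the components of an injective linear map. -/
theorem exists_abs_le_of_injective {V ι : Type*} [AddCommGroup V] [Module ℝ V] [Fintype ι]
    (Λ : V →ₗ[ℝ] ι → ℝ) (hΛ : Function.Injective Λ) (f : V →ₗ[ℝ] ℝ) :
    ∃ C, 0 ≤ C ∧ ∀ v S, 0 ≤ S → (∀ i, |Λ v i| ≤ S) → |f v| ≤ C * S := by
  -- With a left inverse `g` of `Λ`, the functional `f` factors as `(f ∘ g) ∘ Λ`, and `f ∘ g` is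
  -- bounded on the finite-dimensional space `ι → ℝ` with the sup norm.
  obtain ⟨g, hg⟩ := Λ.exists_leftInverse_of_injective (LinearMap.ker_eq_bot.2 hΛ)
  set F : (ι → ℝ) →L[ℝ] ℝ := (f ∘ₗ g).toContinuousLinearMap
  refine ⟨‖F‖, norm_nonneg _, fun v S hS h => ?_⟩
  have h1 : F (Λ v) = f v := by
    have : g (Λ v) = v := LinearMap.congr_fun hg v
    simp [F, this]
  rw [← h1, ← Real.norm_eq_abs]
  refine (F.le_opNorm _).trans ?_
  gcongr
  exact (pi_norm_le_iff_of_nonneg hS).2 h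

/-- A polynomial of degree at most `ℓ` on `[0,1]` is determined by its values at the end points and
its moments of order at most `ℓ - 2`. -/
theorem eq_zero_of_moments {ℓ : ℕ} {p : Polynomial ℝ} (hp : p.natDegree ≤ ℓ) (h0 : p.eval 0 = 0)
    (h1 : p.eval 1 = 0)
    (hm : ∀ j, j + 2 ≤ ℓ → ∫ t in (0 : ℝ)..1, p.eval t * (t - 1 / 2) ^ j = 0) : p = 0 := by
  by_contra hne
  -- The end point values give `p = t(t-1)s` with `deg s ≤ ℓ - 2`. The moments then annihilate `s`,
  -- so `∫ t(1-t)s² = 0`, which is impossible unless `s = 0`.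
  obtain ⟨r, hr⟩ : Polynomial.X ∣ p := by
    rw [Polynomial.X_dvd_iff, Polynomial.coeff_zero_eq_eval_zero, h0]
  have hr1 : r.eval 1 = 0 := by simpa [hr] using h1
  obtain ⟨s, hs⟩ : Polynomial.X - Polynomial.C 1 ∣ r := Polynomial.dvd_iff_isRoot.2 hr1
  have hs0 : s ≠ 0 := by rintro rfl; simp_all
  have hdeg : s.natDegree + 2 ≤ ℓ := by
    have h2 : Polynomial.X - Polynomial.C (1 : ℝ) ≠ 0 := Polynomial.X_sub_C_ne_zero 1
    have : p.natDegree = 1 + (1 + s.natDegree) := by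
      rw [hr, hs, Polynomial.natDegree_mul Polynomial.X_ne_zero (mul_ne_zero h2 hs0),
        Polynomial.natDegree_mul h2 hs0, Polynomial.natDegree_X, Polynomial.natDegree_X_sub_C]
    omega
  -- The moments are centred at the midpoint, hence the Taylor expansion at `1/2`.
  have hexp : ∀ t : ℝ, s.eval t = ∑ j ∈ Finset.range (s.natDegree + 1),
      ((Polynomial.taylor (1 / 2) s).coeff j) * (t - 1 / 2) ^ j := by
    intro t
    have h3 : (Polynomial.taylor (1 / 2) s).eval (t - 1 / 2) = s.eval t := by
      rw [Polynomial.taylor_eval]; congr 1; ring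
    rw [← h3, Polynomial.eval_eq_sum_range, Polynomial.natDegree_taylor]
  have hint : ∫ t in (0 : ℝ)..1, p.eval t * s.eval t = 0 := by
    simp_rw [hexp, Finset.mul_sum]
    rw [intervalIntegral.integral_finsetSum fun j _ => by
      apply Continuous.intervalIntegrable
      fun_prop]
    refine Finset.sum_eq_zero fun j hj => ?_
    have := hm j (by have := Finset.mem_range.1 hj; omega)
    calc _ = ∫ t in (0 : ℝ)..1,
          (Polynomial.taylor (1 / 2) s).coeff j * (p.eval t * (t - 1 / 2) ^ j) := by
          congr 1; ext t; ring
      _ = 0 := by rw [intervalIntegral.integral_const_mul, this, mul_zero]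
  have hpos : 0 < ∫ t in (0 : ℝ)..1, t * (1 - t) * s.eval t ^ 2 := by
    obtain ⟨z, hz, hzs⟩ : ∃ z ∈ Ioo (0 : ℝ) 1, s.eval z ≠ 0 := by
      by_contra! hall
      exact hs0 (Polynomial.eq_zero_of_infinite_isRoot s
        ((Ioo_infinite (zero_lt_one (α := ℝ))).mono hall))
    refine intervalIntegral.integral_pos zero_lt_one (by fun_prop) (fun t ht => ?_)
      ⟨z, ⟨hz.1.le, hz.2.le⟩, ?_⟩
    · have h4 : 0 ≤ 1 - t := by linarith [ht.2]
      have := ht.1.le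
      positivity
    · have h4 : 0 < 1 - z := by linarith [hz.2]
      have := hz.1
      positivity
  have : ∫ t in (0 : ℝ)..1, p.eval t * s.eval t = -∫ t in (0 : ℝ)..1, t * (1 - t) * s.eval t ^ 2 := by
    rw [← intervalIntegral.integral_neg]
    congr 1; ext t
    rw [hr, hs]; simp; ring
  linarith

/-- The values and the slopes of a polynomial on `[0,1]` are controlled by its values at the end
points and its moments. -/
theorem exists_abs_eval_le (ℓ : ℕ) : ∃ C, 0 ≤ C ∧ ∀ (p : Polynomial ℝ) (S : ℝ), p.natDegree ≤ ℓ →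
    0 ≤ S → |p.eval 0| ≤ S → |p.eval 1| ≤ S →
    (∀ j : Fin (ℓ - 1), |∫ t in (0 : ℝ)..1, p.eval t * (t - 1 / 2) ^ (j : ℕ)| ≤ S) →
    (∀ t ∈ Icc (0 : ℝ) 1, |p.eval t| ≤ C * S) ∧
      ∀ t ∈ Icc (0 : ℝ) 1, ∀ t' ∈ Icc (0 : ℝ) 1, |p.eval t - p.eval t'| ≤ C * S * |t - t'| := by
  have hii : ∀ (p : Polynomial ℝ) (j : ℕ),
      IntervalIntegrable (fun t : ℝ => p.eval t * (t - 1 / 2) ^ j) volume 0 1 := fun p j => by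
    apply Continuous.intervalIntegrable
    fun_prop
  let Λ : Polynomial.degreeLE ℝ ℓ →ₗ[ℝ] (Fin 2 ⊕ Fin (ℓ - 1)) → ℝ :=
    { toFun := fun p => Sum.elim ![p.1.eval 0, p.1.eval 1]
        fun j => ∫ t in (0 : ℝ)..1, p.1.eval t * (t - 1 / 2) ^ (j : ℕ)
      map_add' := fun p q => by
        ext i
        rcases i with i | j
        · fin_cases i <;> simp
        · simp only [Sum.elim_inr, Pi.add_apply, Submodule.coe_add, Polynomial.eval_add, add_mul]
          exact intervalIntegral.integral_add (hii _ _) (hii _ _)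
      map_smul' := fun a p => by
        ext i
        rcases i with i | j
        · fin_cases i <;> simp
        · simp [mul_assoc] }
  have hmem : ∀ p : Polynomial ℝ, p ∈ Polynomial.degreeLE ℝ ℓ ↔ p.natDegree ≤ ℓ := fun p => by
    rw [Polynomial.mem_degreeLE, Polynomial.natDegree_le_iff_degree_le]
  have hΛ : Function.Injective Λ := by
    rw [← LinearMap.ker_eq_bot, LinearMap.ker_eq_bot']
    intro p hp
    have h := congrFun hp
    refine Subtype.ext (eq_zero_of_moments ((hmem _).1 p.2) (h (.inl 0)) (h (.inl 1)) fun j hj => ?_)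
    exact h (.inr ⟨j, by omega⟩)
  choose C hC0 hC using fun k : ℕ => exists_abs_le_of_injective Λ hΛ
    ((Polynomial.lcoeff ℝ k) ∘ₗ (Polynomial.degreeLE ℝ ℓ).subtype)
  -- `C k` bounds the `k`-th coefficient. The factor `k + 1` covers both `|t^k| ≤ 1` and `|t^k -
  -- t'^k| ≤ k|t - t'|`.
  refine ⟨∑ k ∈ Finset.range (ℓ + 1), C k * (k + 1),
    Finset.sum_nonneg fun j _ => mul_nonneg (hC0 j) (by positivity), ?_⟩
  intro p S hp hS h0 h1 hj
  have hcoeff : ∀ k, |p.coeff k| ≤ C k * S := fun k => by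
    refine hC k ⟨p, (hmem p).2 hp⟩ S hS fun i => ?_
    rcases i with i | j
    · fin_cases i
      · exact h0
      · exact h1
    · exact hj j
  have hev : ∀ t : ℝ, p.eval t = ∑ k ∈ Finset.range (ℓ + 1), p.coeff k * t ^ k := fun t =>
    Polynomial.eval_eq_sum_range' (Nat.lt_succ_of_le hp) t
  constructor
  · intro t ht
    rw [hev, Finset.sum_mul]
    refine (Finset.abs_sum_le_sum_abs _ _).trans (Finset.sum_le_sum fun k _ => ?_)
    rw [abs_mul, abs_pow, abs_of_nonneg ht.1]
    calc |p.coeff k| * t ^ k ≤ C k * S * 1 := by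
          exact mul_le_mul (hcoeff k) (pow_le_one₀ ht.1 ht.2) (pow_nonneg ht.1 _)
            (mul_nonneg (hC0 k) hS)
      _ ≤ C k * (k + 1) * S := by
          have := mul_nonneg (hC0 k) hS
          have : 0 ≤ C k * S * (k : ℝ) := by positivity
          linarith
  · intro t ht t' ht'
    rw [hev, hev, ← Finset.sum_sub_distrib, Finset.sum_mul, Finset.sum_mul]
    refine (Finset.abs_sum_le_sum_abs _ _).trans (Finset.sum_le_sum fun k _ => ?_)
    rw [← mul_sub, abs_mul]
    have hpow : |t ^ k - t' ^ k| ≤ k * |t - t'| := by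
      rw [← Commute.geom_sum₂_mul (Commute.all t t') k, abs_mul]
      gcongr
      refine (Finset.abs_sum_le_sum_abs _ _).trans ?_
      calc _ ≤ ∑ i ∈ Finset.range k, (1 : ℝ) := Finset.sum_le_sum fun i _ => by
            rw [abs_mul, abs_pow, abs_pow, abs_of_nonneg ht.1, abs_of_nonneg ht'.1]
            exact mul_le_one₀ (pow_le_one₀ ht.1 ht.2) (pow_nonneg ht'.1 _) (pow_le_one₀ ht'.1 ht'.2)
        _ = k := by simp
    calc |p.coeff k| * |t ^ k - t' ^ k| ≤ (C k * S) * (k * |t - t'|) := by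
          gcongr
          · exact mul_nonneg (hC0 k) hS
          · exact hcoeff k
      _ ≤ C k * (k + 1) * S * |t - t'| := by
          have : 0 ≤ C k * S * |t - t'| := mul_nonneg (mul_nonneg (hC0 k) hS) (abs_nonneg _)
          linarith

/-! ### Calculus of `polyFun` -/

theorem hasFDerivAt_polyFun (p : MvPolynomial (Fin 2) ℝ) (x : Plane) :
    HasFDerivAt (polyFun p)
      (∑ i, polyFun (MvPolynomial.pderiv i p) x • (EuclideanSpace.proj i : Plane →L[ℝ] ℝ)) x := by
  induction p using MvPolynomial.induction_on with
  | C a =>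
    have : polyFun (MvPolynomial.C a) = fun _ => a := by ext; simp [polyFun]
    rw [this]
    exact (hasFDerivAt_const a x).congr_fderiv (by ext v; simp [polyFun])
  | add p q hp hq =>
    have : polyFun (p + q) = fun x => polyFun p x + polyFun q x := by ext; simp [polyFun]
    rw [this]
    refine (hp.add hq).congr_fderiv ?_
    ext v
    simp [polyFun]
    ring
  | mul_X p j hp =>
    have : polyFun (p * MvPolynomial.X j) = fun x => polyFun p x * x j := by ext; simp [polyFun]
    rw [this]
    refine (hp.mul (EuclideanSpace.proj j : Plane →L[ℝ] ℝ).hasFDerivAt).congr_fderiv ?_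
    ext v
    fin_cases j <;> simp [polyFun, MvPolynomial.pderiv_X] <;> ring

theorem contDiff_polyFun (p : MvPolynomial (Fin 2) ℝ) : ContDiff ℝ ∞ (polyFun p) := by
  induction p using MvPolynomial.induction_on with
  | C a =>
    have : polyFun (MvPolynomial.C a) = fun _ => a := by ext; simp [polyFun]
    rw [this]
    exact contDiff_const
  | add p q hp hq =>
    have : polyFun (p + q) = fun x => polyFun p x + polyFun q x := by ext; simp [polyFun]
    rw [this]
    exact hp.add hq
  | mul_X p j hp =>
    have : polyFun (p * MvPolynomial.X j) = fun x => polyFun p x * x j := by ext; simp [polyFun]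
    rw [this]
    exact hp.mul (EuclideanSpace.proj j : Plane →L[ℝ] ℝ).contDiff

/-- The gradient of a polynomial, as a pair of polynomials. -/
def gradPoly (p : MvPolynomial (Fin 2) ℝ) : Fin 2 → MvPolynomial (Fin 2) ℝ :=
  fun i => MvPolynomial.pderiv i p

theorem fderiv_polyFun (p : MvPolynomial (Fin 2) ℝ) (x e : Plane) :
    fderiv ℝ (polyFun p) x e = inner ℝ (vpolyFun (gradPoly p) x) e := by
  rw [(hasFDerivAt_polyFun p x).fderiv]
  simp [vpolyFun, gradPoly, PiLp.inner_apply, mul_comm]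

theorem gradient_polyFun (p : MvPolynomial (Fin 2) ℝ) (x : Plane) :
    gradient (polyFun p) x = vpolyFun (gradPoly p) x := by
  refine ext_inner_right ℝ fun e => ?_
  rw [inner_gradient_left, fderiv_polyFun]

theorem continuous_vpolyFun (q : Fin 2 → MvPolynomial (Fin 2) ℝ) : Continuous (vpolyFun q) :=
  (PiLp.continuous_toLp 2 _).comp (continuous_pi fun i => continuous_polyFun (q i))

theorem totalDegree_pderiv_le (p : MvPolynomial (Fin 2) ℝ) (i : Fin 2) :
    (MvPolynomial.pderiv i p).totalDegree ≤ p.totalDegree - 1 := by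
  rw [MvPolynomial.totalDegree, Finset.sup_le_iff]
  intro s hs
  rw [MvPolynomial.mem_support_iff, MvPolynomial.coeff_pderiv] at hs
  have h1 : s + Finsupp.single i 1 ∈ p.support :=
    MvPolynomial.mem_support_iff.2 (left_ne_zero_of_mul hs)
  have h2 := MvPolynomial.le_totalDegree h1
  rw [Finsupp.sum_add_index' (by simp) (by simp), Finsupp.sum_single_index (by simp)] at h2
  omega

theorem gradPoly_mem {ℓ : ℕ} {p : MvPolynomial (Fin 2) ℝ} (hp : p ∈ polyLE ℓ) (i : Fin 2) :
    gradPoly p i ∈ polyLE (ℓ - 1) := by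
  rw [MvPolynomial.mem_restrictTotalDegree] at hp ⊢
  exact (totalDegree_pderiv_le p i).trans (Nat.sub_le_sub_right hp 1)

/-- The crude degree `ℓ` is enough: it keeps the Laplacian of `u_h - 𝒫_ℓ u_h` among the polynomials
to which this function is orthogonal. -/
theorem divPoly_gradPoly_mem {ℓ : ℕ} {p : MvPolynomial (Fin 2) ℝ} (hp : p ∈ polyLE ℓ) :
    divPoly (gradPoly p) ∈ polyLE ℓ := by
  refine Submodule.sum_mem _ fun i _ => ?_
  rw [MvPolynomial.mem_restrictTotalDegree] at hp ⊢
  exact (totalDegree_pderiv_le _ i).trans ((Nat.sub_le _ _).trans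
    ((totalDegree_pderiv_le p i).trans ((Nat.sub_le _ _).trans hp)))

/-- The restriction of a polynomial to an edge. -/
theorem exists_polyFun_edgePt {ℓ : ℕ} {q : MvPolynomial (Fin 2) ℝ} (hq : q ∈ polyLE ℓ) (E : Polygon)
    (i : E.Idx) : ∃ p : Polynomial ℝ, p.natDegree ≤ ℓ ∧ ∀ t, polyFun q (E.edgePt i t) = p.eval t := by
  rw [MvPolynomial.mem_restrictTotalDegree] at hq
  let f : Fin 2 → Polynomial ℝ := fun k => Polynomial.C (E.vertex (i + 1) k - E.vertex i k) *
    Polynomial.X + Polynomial.C (E.vertex i k)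
  refine ⟨MvPolynomial.aeval f q, ?_, fun t => ?_⟩
  · simpa using MvPolynomial.aeval_natDegree_le q hq f (n := 1)
      fun k => Polynomial.natDegree_linear_le
  · have h : ((Polynomial.evalRingHom t).comp (MvPolynomial.aeval f).toRingHom) =
        (MvPolynomial.eval fun k => E.edgePt i t k) := by
      refine MvPolynomial.ringHom_ext (fun a => by simp) fun k => ?_
      simp [f, Polygon.edgePt, AffineMap.lineMap_apply]
      ring
    exact (RingHom.congr_fun h q).symm

/-- The composition of a polynomial with a dilation and a translation. -/
theorem exists_polyFun_dilation {ℓ : ℕ} {q : MvPolynomial (Fin 2) ℝ} (hq : q ∈ polyLE ℓ) (c : Plane)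
    (h : ℝ) : ∃ p ∈ polyLE ℓ, ∀ y, polyFun q (c + h • y) = polyFun p y := by
  rw [MvPolynomial.mem_restrictTotalDegree] at hq
  let f : Fin 2 → MvPolynomial (Fin 2) ℝ := fun k => MvPolynomial.C h * MvPolynomial.X k +
    MvPolynomial.C (c k)
  have hf : ∀ k, (f k).totalDegree ≤ 1 := fun k => by
    refine (MvPolynomial.totalDegree_add _ _).trans (max_le ?_ (by simp))
    exact (MvPolynomial.totalDegree_mul _ _).trans (by simp)
  refine ⟨MvPolynomial.aeval f q, ?_, fun y => ?_⟩
  · rw [MvPolynomial.mem_restrictTotalDegree, MvPolynomial.aeval_def, MvPolynomial.eval₂]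
    refine (MvPolynomial.totalDegree_finsetSum _ _).trans (Finset.sup_le fun s hs => ?_)
    refine (MvPolynomial.totalDegree_mul _ _).trans ?_
    refine le_trans (add_le_add (MvPolynomial.totalDegree_C _).le le_rfl) ?_
    rw [zero_add]
    refine (MvPolynomial.totalDegree_finsetProd _ _).trans ?_
    refine le_trans ?_ ((MvPolynomial.le_totalDegree hs).trans hq)
    refine Finset.sum_le_sum fun k _ => (MvPolynomial.totalDegree_pow _ _).trans ?_
    exact (Nat.mul_le_mul_left _ (hf k)).trans (by simp)
  · have h : ((MvPolynomial.eval fun k => y k).comp (MvPolynomial.aeval f).toRingHom) =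
        (MvPolynomial.eval fun k => (c + h • y) k) := by
      refine MvPolynomial.ringHom_ext (fun a => by simp) fun k => ?_
      simp [f]
      ring
    exact (RingHom.congr_fun h q).symm

/-! ### Gluing Lipschitz bounds along segments -/

/-- A function which satisfies a Lipschitz bound on each member of a finite closed cover of a real
normed space is Lipschitz. -/
theorem abs_sub_le_of_closed_cover {V ι : Type*} [NormedAddCommGroup V] [NormedSpace ℝ V] [Finite ι]
    {A : ι → Set V} (hA : ∀ i, IsClosed (A i)) (hcov : ∀ x, ∃ i, x ∈ A i) {f : V → ℝ} {K : ℝ}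
    (hK : 0 ≤ K) (hf : ∀ i, ∀ x ∈ A i, ∀ y ∈ A i, |f x - f y| ≤ K * ‖x - y‖) (x y : V) :
    |f x - f y| ≤ K * ‖x - y‖ := by
  have hcont : Continuous f := by
    refine LocallyFinite.continuous (f := A) (locallyFinite_of_finite _)
      (eq_univ_of_forall fun x => mem_iUnion.2 (hcov x)) hA fun i => ?_
    have : LipschitzOnWith K.toNNReal f (A i) := LipschitzOnWith.of_dist_le_mul fun x hx y hy => by
      rw [Real.dist_eq, dist_eq_norm, Real.coe_toNNReal _ hK]
      exact hf i x hx y hy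
    exact this.continuousOn
  have key : ∀ x y : V, f y - f x ≤ K * ‖y - x‖ := by
    intro x y
    set p : ℝ → V := fun t => x + t • (y - x) with hp
    have hpc : Continuous p := by fun_prop
    have hpd : ∀ s t, ‖p s - p t‖ = |s - t| * ‖y - x‖ := fun s t => by
      rw [← Real.norm_eq_abs, ← norm_smul]; congr 1; simp only [hp]; module
    -- This mean value inequality asks for small right slopes only along some sequence `z ↓ t`. One
    -- closed set contains `p z` for such a sequence by pigeonhole, and it contains `p t` because it
    -- is closed.
    have h := image_le_of_liminf_slope_right_le_deriv_boundary (f := f ∘ p) (a := 0) (b := 1)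
      (B := fun t => f x + K * ‖y - x‖ * t) (B' := fun _ => K * ‖y - x‖)
      (hcont.comp hpc).continuousOn (by simp [hp])
      (by fun_prop)
      (fun t _ => (((hasDerivAt_id t).const_mul (K * ‖y - x‖)).const_add (f x)).hasDerivWithinAt.congr_deriv
          (by simp))
      (fun t _ r hr => ?_) (x := 1) (by simp)
    · have h1 : p 1 = y := by simp [hp]
      simp only [Function.comp, h1] at h
      linarith
    · have h1 : ∃ᶠ z in 𝓝[>] t, ∃ i, p z ∈ A i := Eventually.frequently (by simp [hcov])
      obtain ⟨i, hi⟩ : ∃ i, ∃ᶠ z in 𝓝[>] t, p z ∈ A i := by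
        by_contra! hne
        refine h1 ?_
        have := eventually_all.2 hne
        filter_upwards [this] with z hz
        simpa using hz
      have hti : p t ∈ A i := by
        have h2 : ∃ᶠ z in 𝓝 t, p z ∈ A i := hi.filter_mono nhdsWithin_le_nhds
        exact ((hA i).preimage hpc).mem_of_frequently_of_tendsto h2 tendsto_id
      refine (hi.and_eventually self_mem_nhdsWithin).mono fun z hz => ?_
      have hz0 : 0 < z - t := sub_pos.2 hz.2
      have h3 := (le_abs_self _).trans (hf i _ hz.1 _ hti)
      rw [hpd, abs_of_pos hz0] at h3
      refine lt_of_le_of_lt ?_ hr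
      rw [slope_def_field, div_le_iff₀ hz0]
      simp only [Function.comp]
      linarith
  rw [abs_le]
  have h1 := key x y
  have h2 := key y x
  rw [norm_sub_rev] at h1
  constructor <;> linarith

/-! ### Star-shaped polygons -/

namespace Polygon

variable {E : Polygon} {c : Plane} {r : ℝ}

/-- `E` is star-shaped with respect to the ball of radius `r > 0` with centre `c`. -/
structure IsStar (E : Polygon) (c : Plane) (r : ℝ) : Prop where
  pos : 0 < r
  star : ∀ y ∈ Metric.ball c r, StarConvex ℝ y E.carrier

theorem edgePt_eq (i : E.Idx) (t : ℝ) :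
    E.edgePt i t = E.vertex i + t • (E.vertex (i + 1) - E.vertex i) := by
  simp [edgePt, AffineMap.lineMap_apply, add_comm]

theorem continuous_edgePt (i : E.Idx) : Continuous (E.edgePt i) := AffineMap.lineMap_continuous

theorem mem_frontier_iff {x : Plane} :
    x ∈ frontier E.carrier ↔ ∃ i, ∃ t ∈ Icc (0 : ℝ) 1, x = E.edgePt i t := by
  simp only [E.frontier_eq, mem_iUnion, segment_eq_image_lineMap, mem_image, edgePt, eq_comm]

theorem edgePt_mem_frontier (i : E.Idx) {t : ℝ} (ht : t ∈ Icc (0 : ℝ) 1) :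
    E.edgePt i t ∈ frontier E.carrier := mem_frontier_iff.2 ⟨i, t, ht, rfl⟩

theorem notMem_of_mem_frontier {x : Plane} (hx : x ∈ frontier E.carrier) : x ∉ E.carrier := by
  rw [E.isOpen.frontier_eq] at hx; exact hx.2

theorem diam_pos (E : Polygon) : 0 < E.diam := by
  refine lt_of_le_of_ne Metric.diam_nonneg fun h => ?_
  obtain ⟨x, hx⟩ := E.isConnected.nonempty
  have hsub : E.carrier.Subsingleton := fun x hx y hy => dist_le_zero.1 <|
    (Metric.dist_le_diam_of_mem E.isBounded hx hy).trans h.ge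
  obtain ⟨ε, hε, hb⟩ := Metric.isOpen_iff.1 E.isOpen x hx
  obtain ⟨y, hy⟩ := exists_norm_eq Plane (half_pos hε).le
  have h1 : x + y ∈ E.carrier := hb (by simp [hy, hε])
  have h2 := hsub h1 hx
  have : y = 0 := by simpa using h2
  rw [this, norm_zero] at hy
  linarith

theorem dist_le_diam_of_mem_closure {x y : Plane} (hx : x ∈ closure E.carrier)
    (hy : y ∈ closure E.carrier) : dist x y ≤ E.diam := by
  rw [diam, ← Metric.diam_closure]
  exact Metric.dist_le_diam_of_mem E.isBounded.closure hx hy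

namespace IsStar

variable (hE : E.IsStar c r)
include hE

theorem ball_subset : Metric.ball c r ⊆ E.carrier := fun y hy => by
  obtain ⟨x, hx⟩ := E.isConnected.nonempty
  simpa using hE.star y hy hx zero_le_one le_rfl (by simp)

theorem center_mem : c ∈ E.carrier := hE.ball_subset (Metric.mem_ball_self hE.pos)

/-- Here the ball, rather than a single centre, is essential. If `x' ∈ E` is close to `x`, then the
apex moved to `y + t/(1-t)(x - x')` is still in the ball, and the segment from it to `x'` passes
through the same point `y + t(x - y)`. -/
theorem segment_mem {x y : Plane} (hx : x ∈ closure E.carrier) (hy : y ∈ Metric.ball c r) {t : ℝ}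
    (h0 : 0 ≤ t) (h1 : t < 1) : y + t • (x - y) ∈ E.carrier := by
  have h1' : (1 - t) ≠ 0 := by linarith
  let g : Plane → Plane := fun x' => y + (t / (1 - t)) • (x - x')
  have hg : Continuous g := by fun_prop
  have hgx : g x = y := by simp [g]
  have hnhds : g ⁻¹' Metric.ball c r ∈ 𝓝 x :=
    hg.continuousAt.preimage_mem_nhds (by rw [hgx]; exact Metric.isOpen_ball.mem_nhds hy)
  obtain ⟨x', hx', hx'E⟩ := mem_closure_iff_nhds.1 hx _ hnhds
  have := hE.star _ hx' hx'E (a := 1 - t) (b := t) (by linarith) h0 (by ring)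
  convert this using 1
  simp only [g, smul_add, smul_smul, mul_div_cancel₀ _ h1']
  module

end IsStar

/-- The gauge of `E` with respect to the centre `c`. -/
def radius (E : Polygon) (c x : Plane) : ℝ := gauge {y | c + y ∈ E.carrier} (x - c)

theorem radius_nonneg (x : Plane) : 0 ≤ E.radius c x := gauge_nonneg _

@[simp] theorem radius_center : E.radius c c = 0 := by simp [radius]

theorem radius_add_smul (x : Plane) {s : ℝ} (hs : 0 ≤ s) :
    E.radius c (c + s • x) = s * E.radius c (c + x) := by
  simp only [radius, add_sub_cancel_left]
  rw [gauge_smul_of_nonneg hs, smul_eq_mul]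

namespace IsStar

variable (hE : E.IsStar c r)
include hE

theorem radius_lt_one_iff {x : Plane} : E.radius c x < 1 ↔ x ∈ E.carrier := by
  have hopen : IsOpen {y | c + y ∈ E.carrier} := E.isOpen.preimage (by fun_prop)
  constructor
  · intro h
    have hnh : {y | c + y ∈ E.carrier} ∈ 𝓝 (0 : Plane) :=
      hopen.mem_nhds (by simpa using hE.center_mem)
    obtain ⟨s, hs0, hs1, y, hy, hxy⟩ := exists_lt_of_gauge_lt (absorbent_nhds_zero hnh) h
    have := hE.segment_mem (subset_closure hy) (Metric.mem_ball_self hE.pos) hs0.le hs1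
    simp only [add_sub_cancel_left] at this hxy
    rwa [hxy, add_sub_cancel] at this
  · intro h
    exact gauge_lt_one_of_mem_of_isOpen hopen (by simpa using h)

/-- If the gauge exceeded one at `x`, shrinking `x` towards `c` to gauge exactly one would give a
point of `E` by `segment_mem`, where the gauge is below one. -/
theorem radius_of_mem_frontier {x : Plane} (hx : x ∈ frontier E.carrier) : E.radius c x = 1 := by
  refine le_antisymm ?_ (not_lt.1 fun h => notMem_of_mem_frontier hx (hE.radius_lt_one_iff.1 h))
  by_contra! h
  have h0 : 0 < E.radius c x := zero_lt_one.trans h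
  have h1 := hE.radius_lt_one_iff.2 (hE.segment_mem (frontier_subset_closure hx)
    (Metric.mem_ball_self hE.pos) (inv_nonneg.2 h0.le) (inv_lt_one_of_one_lt₀ h))
  rw [radius_add_smul _ (inv_nonneg.2 h0.le), add_sub_cancel, inv_mul_cancel₀ h0.ne'] at h1
  exact lt_irrefl _ h1

theorem radius_pos {x : Plane} (hx : x ≠ c) : 0 < E.radius c x := by
  have hopen : IsOpen {y | c + y ∈ E.carrier} := E.isOpen.preimage (by fun_prop)
  have hnh : {y | c + y ∈ E.carrier} ∈ 𝓝 (0 : Plane) :=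
    hopen.mem_nhds (by simpa using hE.center_mem)
  refine (gauge_pos (absorbent_nhds_zero hnh) ?_).2 (sub_ne_zero.2 hx)
  refine NormedSpace.isVonNBounded_of_isBounded ℝ ?_
  obtain ⟨R, hR⟩ := E.isBounded.subset_closedBall c
  refine (Metric.isBounded_closedBall (x := (0 : Plane)) (r := R)).subset fun y hy => ?_
  simpa [dist_eq_norm] using hR hy

/-- Every ray from the centre meets an edge. -/
theorem exists_edgePt {x : Plane} (hx : x ≠ c) :
    ∃ i, ∃ t ∈ Icc (0 : ℝ) 1, x = c + E.radius c x • (E.edgePt i t - c) := by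
  set g := E.radius c x with hg
  have h0 : 0 < g := hE.radius_pos hx
  set z := c + g⁻¹ • (x - c) with hz
  have hzr : ∀ s : ℝ, 0 ≤ s → E.radius c (c + s • (z - c)) = s := fun s hs => by
    rw [hz, add_sub_cancel_left, smul_smul, radius_add_smul _ (by positivity), add_sub_cancel,
      ← hg, inv_mul_cancel_right₀ h0.ne']
  have hz1 : E.radius c z = 1 := by simpa using hzr 1 zero_le_one
  -- `z` is the point of gauge one on the ray. It lies outside `E`, and it is the limit of the
  -- points of gauge `s < 1` on the same ray.
  have hfr : z ∈ frontier E.carrier := by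
    rw [E.isOpen.frontier_eq]
    refine ⟨?_, fun h => (hE.radius_lt_one_iff.2 h).ne hz1⟩
    have hc : Continuous fun s : ℝ => c + s • (z - c) := by fun_prop
    have h1 : Tendsto (fun s : ℝ => c + s • (z - c)) (𝓝[<] 1) (𝓝 z) := by
      have := hc.tendsto 1
      simp only [one_smul, add_sub_cancel] at this
      exact this.mono_left nhdsWithin_le_nhds
    refine mem_closure_of_tendsto h1 ?_
    filter_upwards [Ioo_mem_nhdsLT (zero_lt_one (α := ℝ))] with s hs
    exact hE.radius_lt_one_iff.1 ((hzr s hs.1.le).trans_lt hs.2)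
  obtain ⟨i, t, ht, hit⟩ := mem_frontier_iff.1 hfr
  refine ⟨i, t, ht, ?_⟩
  rw [← hit, hz, add_sub_cancel_left, smul_smul, mul_inv_cancel₀ h0.ne', one_smul, add_sub_cancel]

theorem radius_edgePt (i : E.Idx) {t : ℝ} (ht : t ∈ Icc (0 : ℝ) 1) {s : ℝ} (hs : 0 ≤ s) :
    E.radius c (c + s • (E.edgePt i t - c)) = s := by
  rw [radius_add_smul _ hs, add_sub_cancel, hE.radius_of_mem_frontier (edgePt_mem_frontier i ht),
    mul_one]

end IsStar

/-! ### Barycentric coordinates in the cone over an edge -/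

/-- The determinant of two vectors. -/
def cross (u v : Plane) : ℝ := u 0 * v 1 - u 1 * v 0

theorem abs_cross_le (u v : Plane) : |cross u v| ≤ ‖u‖ * ‖v‖ := by
  refine abs_le_of_sq_le_sq ?_ (by positivity)
  rw [mul_pow, EuclideanSpace.real_norm_sq_eq, EuclideanSpace.real_norm_sq_eq]
  simp only [cross, Fin.sum_univ_two]
  nlinarith [sq_nonneg (u 0 * v 0 + u 1 * v 1)]

theorem cross_sub_left (u u' v : Plane) : cross (u - u') v = cross u v - cross u' v := by
  simp [cross]; ring

theorem cross_sub_right (u v v' : Plane) : cross u (v - v') = cross u v - cross u v' := by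
  simp [cross]; ring

theorem continuous_cross_left (v : Plane) : Continuous fun u => cross u v := by
  unfold cross; fun_prop

theorem continuous_cross_right (u : Plane) : Continuous fun v => cross u v := by
  unfold cross; fun_prop

/-- Twice the signed area of the triangle spanned by `c` and the edge `i`. -/
def edgeDet (E : Polygon) (c : Plane) (i : E.Idx) : ℝ :=
  cross (E.vertex i - c) (E.vertex (i + 1) - c)

/-- The barycentric coordinate of the left end point. -/
def coordL (E : Polygon) (c : Plane) (i : E.Idx) (x : Plane) : ℝ :=
  cross (x - c) (E.vertex (i + 1) - c) / E.edgeDet c i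

/-- The barycentric coordinate of the right end point. -/
def coordR (E : Polygon) (c : Plane) (i : E.Idx) (x : Plane) : ℝ :=
  cross (E.vertex i - c) (x - c) / E.edgeDet c i

theorem eq_add_coord {i : E.Idx} (hd : E.edgeDet c i ≠ 0) (x : Plane) :
    x = c + (E.coordL c i x • (E.vertex i - c) + E.coordR c i x • (E.vertex (i + 1) - c)) := by
  ext k
  fin_cases k <;>
  · simp only [coordL, coordR, Fin.zero_eta, Fin.mk_one, PiLp.add_apply, PiLp.smul_apply,
      PiLp.sub_apply, smul_eq_mul]
    field_simp
    simp only [edgeDet, cross, PiLp.sub_apply]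
    ring

theorem coordL_add {i : E.Idx} (hd : E.edgeDet c i ≠ 0) (α β : ℝ) :
    E.coordL c i (c + (α • (E.vertex i - c) + β • (E.vertex (i + 1) - c))) = α := by
  rw [coordL, div_eq_iff hd, edgeDet]
  simp [cross]; ring

theorem coordR_add {i : E.Idx} (hd : E.edgeDet c i ≠ 0) (α β : ℝ) :
    E.coordR c i (c + (α • (E.vertex i - c) + β • (E.vertex (i + 1) - c))) = β := by
  rw [coordR, div_eq_iff hd, edgeDet]
  simp [cross]; ring

theorem ray_eq (i : E.Idx) (s t : ℝ) : c + s • (E.edgePt i t - c) =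
    c + ((s * (1 - t)) • (E.vertex i - c) + (s * t) • (E.vertex (i + 1) - c)) := by
  rw [edgePt_eq]; module

/-- The cone over an edge. -/
def cone (E : Polygon) (c : Plane) (i : E.Idx) : Set Plane :=
  {x | 0 ≤ E.coordL c i x ∧ 0 ≤ E.coordR c i x}

theorem isClosed_cone (i : E.Idx) : IsClosed (E.cone c i) := by
  have hL : Continuous (E.coordL c i) :=
    ((continuous_cross_left _).comp (by fun_prop : Continuous fun x => x - c)).div_const _
  have hR : Continuous (E.coordR c i) :=
    ((continuous_cross_right _).comp (by fun_prop : Continuous fun x => x - c)).div_const _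
  exact (isClosed_le continuous_const hL).inter (isClosed_le continuous_const hR)

theorem norm_vertex_sub_le {x : Plane} (hx : x ∈ E.carrier) (i : E.Idx) :
    ‖E.vertex i - x‖ ≤ E.diam := by
  rw [← dist_eq_norm]
  refine dist_le_diam_of_mem_closure (frontier_subset_closure ?_) (subset_closure hx)
  simpa [edgePt_eq] using edgePt_mem_frontier i (t := 0) (by simp)

theorem edgeLength_eq (i : E.Idx) : E.edgeLength i = ‖E.vertex (i + 1) - E.vertex i‖ := by
  rw [edgeLength, dist_comm, dist_eq_norm]

theorem edgeLength_pos (i : E.Idx) : 0 < E.edgeLength i := by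
  refine dist_pos.2 fun h => ?_
  have := E.vertex_injective h
  simp at this

namespace IsStar

variable (hE : E.IsStar c r)
include hE

/-- The line through an edge does not meet the ball `E` is star-shaped with respect to. -/
theorem edge_line_notMem (i : E.Idx) (t : ℝ) : E.edgePt i t ∉ Metric.ball c r := by
  intro hy
  have ha := edgePt_mem_frontier i (t := 0) (by simp)
  have hb := edgePt_mem_frontier i (t := 1) (by simp)
  -- If the point lies beyond an end point of the edge, that end point is strictly between it and
  -- the opposite end point, so `segment_mem` would put a boundary vertex into `E`.
  rcases lt_or_ge t 0 with h0 | h0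
  · refine notMem_of_mem_frontier ha ?_
    have := hE.segment_mem (frontier_subset_closure hb) hy (t := -t / (1 - t))
      (div_nonneg (by linarith) (by linarith)) ((div_lt_one (by linarith)).2 (by linarith))
    convert this using 1
    have h1 : t + (-t / (1 - t)) * (1 - t) = 0 := by
      rw [div_mul_cancel₀ _ (by linarith : (0 : ℝ) < 1 - t).ne', add_neg_cancel]
    have h2 : E.edgePt i t + (-t / (1 - t)) • (E.edgePt i 1 - E.edgePt i t) =
      E.vertex i + (t + (-t / (1 - t)) * (1 - t)) • (E.vertex (i + 1) - E.vertex i) := by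
      simp only [edgePt_eq]; module
    rw [h2, h1, edgePt_eq]
  rcases lt_or_ge 1 t with h1 | h1
  · refine notMem_of_mem_frontier hb ?_
    have := hE.segment_mem (frontier_subset_closure ha) hy (t := (t - 1) / t)
      (div_nonneg (by linarith) (by linarith)) ((div_lt_one (by linarith)).2 (by linarith))
    convert this using 1
    have h1 : t + ((t - 1) / t) * (- t) = 1 := by field_simp; ring
    have h2 : E.edgePt i t + ((t - 1) / t) • (E.edgePt i 0 - E.edgePt i t) =
      E.vertex i + (t + ((t - 1) / t) * (- t)) • (E.vertex (i + 1) - E.vertex i) := by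
      simp only [edgePt_eq]; module
    rw [h2, h1, edgePt_eq]
  exact notMem_of_mem_frontier (edgePt_mem_frontier i ⟨h0, h1⟩) (hE.ball_subset hy)

/-- The determinant is the edge length times the distance from `c` to the line of the edge, and that
line avoids the ball of radius `r`. The parameter `t` below is that of the foot of the
perpendicular. -/
theorem le_abs_edgeDet (i : E.Idx) : r * E.edgeLength i ≤ |E.edgeDet c i| := by
  have hl := edgeLength_pos i
  set u := E.vertex i - c with hu
  set e := E.vertex (i + 1) - E.vertex i with he
  have hle : E.edgeLength i ^ 2 = e 0 ^ 2 + e 1 ^ 2 := by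
    rw [edgeLength_eq, EuclideanSpace.real_norm_sq_eq, Fin.sum_univ_two]
  have hD : E.edgeDet c i = u 0 * e 1 - u 1 * e 0 := by
    simp only [edgeDet, cross, hu, he, PiLp.sub_apply]; ring
  set t := -(u 0 * e 0 + u 1 * e 1) / E.edgeLength i ^ 2 with ht
  have hn := hE.edge_line_notMem i t
  rw [Metric.mem_ball, not_lt, dist_eq_norm] at hn
  have h1 : E.edgePt i t - c = u + t • e := by rw [edgePt_eq]; simp only [hu, he]; module
  rw [h1] at hn
  have hte : t * (e 0 ^ 2 + e 1 ^ 2) = -(u 0 * e 0 + u 1 * e 1) := by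
    rw [ht, ← hle]; field_simp
  have h2 : (‖u + t • e‖ * E.edgeLength i) ^ 2 = E.edgeDet c i ^ 2 := by
    rw [mul_pow, EuclideanSpace.real_norm_sq_eq, Fin.sum_univ_two, hle, hD]
    simp only [PiLp.add_apply, PiLp.smul_apply, smul_eq_mul]
    linear_combination (t * (e 0 ^ 2 + e 1 ^ 2) + (u 0 * e 0 + u 1 * e 1)) * hte
  have h3 := sq_le_sq.1 h2.le
  rw [abs_of_nonneg (by positivity)] at h3
  exact (mul_le_mul_of_nonneg_right hn hl.le).trans h3

theorem edgeDet_ne_zero (i : E.Idx) : E.edgeDet c i ≠ 0 :=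
  abs_pos.1 ((mul_pos hE.pos (edgeLength_pos i)).trans_le (hE.le_abs_edgeDet i))

theorem ray_mem_cone (i : E.Idx) {s t : ℝ} (hs : 0 ≤ s) (ht : t ∈ Icc (0 : ℝ) 1) :
    c + s • (E.edgePt i t - c) ∈ E.cone c i := by
  rw [ray_eq]
  refine ⟨?_, ?_⟩
  · rw [coordL_add (hE.edgeDet_ne_zero i)]
    exact mul_nonneg hs (sub_nonneg.2 ht.2)
  · rw [coordR_add (hE.edgeDet_ne_zero i)]
    exact mul_nonneg hs ht.1

theorem exists_mem_cone (x : Plane) : ∃ i, x ∈ E.cone c i := by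
  rcases eq_or_ne x c with rfl | hx
  · exact ⟨0, by simp [cone, coordL, coordR, cross]⟩
  · obtain ⟨i, t, ht, h⟩ := hE.exists_edgePt hx
    exact ⟨i, by rw [h]; exact hE.ray_mem_cone i (radius_nonneg _) ht⟩

/-- Polar coordinates in a cone: `s` is the radius and `t` the parameter on the edge. -/
theorem eq_ray_of_mem_cone {i : E.Idx} {x : Plane} (hx : x ∈ E.cone c i) :
    ∃ t ∈ Icc (0 : ℝ) 1, x = c + (E.coordL c i x + E.coordR c i x) • (E.edgePt i t - c) ∧
      (E.coordL c i x + E.coordR c i x) * t = E.coordR c i x := by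
  obtain ⟨hα, hβ⟩ := hx
  have hxe := eq_add_coord (hE.edgeDet_ne_zero i) x
  set α := E.coordL c i x
  set β := E.coordR c i x
  rcases (add_nonneg hα hβ).eq_or_lt with h | h
  · have h1 : α = 0 := by linarith
    have h2 : β = 0 := by linarith
    refine ⟨0, by simp, ?_, by linarith⟩
    rw [hxe, h1, h2]; simp
  · have h1 : (α + β) * (β / (α + β)) = β := by field_simp
    refine ⟨β / (α + β), ⟨by positivity, (div_le_one h).2 (by linarith)⟩, ?_, h1⟩
    rw [ray_eq, mul_sub, h1]
    simpa using hxe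

end IsStar

/-! ### Radial extension of boundary functions -/

/-- The radial extension, homogeneous of degree one, of a function on `∂E`. -/
def radialExt (E : Polygon) (c : Plane) (γ : Plane → ℝ) (x : Plane) : ℝ :=
  E.radius c x * γ (c + (E.radius c x)⁻¹ • (x - c))

theorem radialExt_one : E.radialExt c (fun _ => 1) = E.radius c := by
  ext x; simp [radialExt]

namespace IsStar

variable (hE : E.IsStar c r)
include hE

theorem radialExt_ray (γ : Plane → ℝ) (i : E.Idx) {s t : ℝ} (hs : 0 ≤ s) (ht : t ∈ Icc (0 : ℝ) 1) :
    E.radialExt c γ (c + s • (E.edgePt i t - c)) = s * γ (E.edgePt i t) := by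
  rcases hs.eq_or_lt with rfl | hs'
  · simp [radialExt]
  · rw [radialExt, hE.radius_edgePt i ht hs, add_sub_cancel_left, smul_smul,
      inv_mul_cancel₀ hs'.ne', one_smul, add_sub_cancel]

theorem radialExt_edgePt (γ : Plane → ℝ) (i : E.Idx) {t : ℝ} (ht : t ∈ Icc (0 : ℝ) 1) :
    E.radialExt c γ (E.edgePt i t) = γ (E.edgePt i t) := by
  simpa using hE.radialExt_ray γ i zero_le_one ht

theorem abs_radialExt_le {γ : Plane → ℝ} {S : ℝ}
    (hS : ∀ i, ∀ t ∈ Icc (0 : ℝ) 1, |γ (E.edgePt i t)| ≤ S) {x : Plane} (hx : x ∈ E.carrier) :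
    |E.radialExt c γ x| ≤ S := by
  have hx1 := hE.radius_lt_one_iff.2 hx
  have hS0 : 0 ≤ S := (abs_nonneg _).trans (hS 0 0 (by simp))
  rcases eq_or_ne x c with rfl | hxc
  · simpa [radialExt] using hS0
  obtain ⟨i, t, ht, h⟩ := hE.exists_edgePt hxc
  rw [h, hE.radialExt_ray γ i (radius_nonneg _) ht, abs_mul, abs_of_nonneg (radius_nonneg _)]
  nlinarith [hS i t ht, radius_nonneg (E := E) (c := c) x]

/-- The radial extension of a piecewise Lipschitz boundary function is Lipschitz. -/
theorem abs_radialExt_sub_le {γ : Plane → ℝ} {S L d : ℝ} (hd : 0 < d)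
    (hdet : ∀ i, d ≤ |E.edgeDet c i|) (hL0 : 0 ≤ L)
    (hS : ∀ i, ∀ t ∈ Icc (0 : ℝ) 1, |γ (E.edgePt i t)| ≤ S)
    (hL : ∀ i, ∀ t ∈ Icc (0 : ℝ) 1, ∀ t' ∈ Icc (0 : ℝ) 1,
      |γ (E.edgePt i t) - γ (E.edgePt i t')| ≤ L * |t - t'|) (x y : Plane) :
    |E.radialExt c γ x - E.radialExt c γ y| ≤ (2 * S + 3 * L) * (E.diam / d) * ‖x - y‖ := by
  have hS0 : 0 ≤ S := (abs_nonneg _).trans (hS 0 0 (by simp))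
  have hdiam := E.diam_pos
  -- The cones form a finite closed cover of the plane, so it suffices to compare points of one
  -- cone, where the barycentric coordinates are affine with slope at most `diam / d`.
  refine abs_sub_le_of_closed_cover (fun i => isClosed_cone (E := E) (c := c) i)
    hE.exists_mem_cone (by positivity) (fun i x hx y hy => ?_) x y
  have hq : ∀ z : ℝ, |z| ≤ ‖x - y‖ * E.diam → |z / E.edgeDet c i| ≤ E.diam / d * ‖x - y‖ := by
    intro z hz
    rw [abs_div, div_mul_eq_mul_div, mul_comm E.diam]
    exact div_le_div₀ (by positivity) hz hd (hdet i)
  have hα : |E.coordL c i x - E.coordL c i y| ≤ E.diam / d * ‖x - y‖ := by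
    rw [coordL, coordL, ← sub_div, ← cross_sub_left, sub_sub_sub_cancel_right]
    refine hq _ ((abs_cross_le _ _).trans ?_)
    gcongr
    exact norm_vertex_sub_le hE.center_mem _
  have hβ : |E.coordR c i x - E.coordR c i y| ≤ E.diam / d * ‖x - y‖ := by
    rw [coordR, coordR, ← sub_div, ← cross_sub_right, sub_sub_sub_cancel_right]
    refine hq _ ((abs_cross_le _ _).trans ?_)
    rw [mul_comm]
    gcongr
    exact norm_vertex_sub_le hE.center_mem _
  obtain ⟨t, ht, hxt, hst⟩ := hE.eq_ray_of_mem_cone hx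
  obtain ⟨t', ht', hyt, hst'⟩ := hE.eq_ray_of_mem_cone hy
  have hs := add_nonneg hx.1 hx.2
  have hs' := add_nonneg hy.1 hy.2
  rw [show E.radialExt c γ x = _ from (congrArg _ hxt).trans (hE.radialExt_ray γ i hs ht),
    show E.radialExt c γ y = _ from (congrArg _ hyt).trans (hE.radialExt_ray γ i hs' ht')]
  set α := E.coordL c i x
  set β := E.coordR c i x
  set α' := E.coordL c i y
  set β' := E.coordR c i y
  set s := α + β
  set s' := α' + β'
  set η := E.diam / d * ‖x - y‖
  have hss : |s - s'| ≤ 2 * η := by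
    have : s - s' = (α - α') + (β - β') := by simp only [s, s']; ring
    rw [this]
    exact (abs_add_le _ _).trans (by linarith)
  -- The parameter `t` itself is not Lipschitz near the centre, but `s t = β` is; only the product
  -- with the radius enters the estimate.
  have htt : s' * |t - t'| ≤ 3 * η := by
    have : s' * |t - t'| = |(s' - s) * t + (β - β')| := by
      rw [← abs_of_nonneg hs', ← abs_mul, abs_of_nonneg hs', ← hst, ← hst']; congr 1; ring
    rw [this]
    refine (abs_add_le _ _).trans ?_
    rw [abs_mul, abs_of_nonneg ht.1, abs_sub_comm]
    nlinarith [ht.1, ht.2, abs_nonneg (s - s')]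
  have e : s * γ (E.edgePt i t) - s' * γ (E.edgePt i t') =
      (s - s') * γ (E.edgePt i t) + s' * (γ (E.edgePt i t) - γ (E.edgePt i t')) := by ring
  rw [e]
  refine (abs_add_le _ _).trans ?_
  rw [abs_mul, abs_mul, abs_of_nonneg hs']
  have h1 : |s - s'| * |γ (E.edgePt i t)| ≤ 2 * η * S :=
    mul_le_mul hss (hS i t ht) (abs_nonneg _) ((abs_nonneg _).trans hss)
  have h2 : s' * |γ (E.edgePt i t) - γ (E.edgePt i t')| ≤ L * (3 * η) := by
    calc _ ≤ s' * (L * |t - t'|) := by gcongr; exact hL i t ht t' ht'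
      _ = L * (s' * |t - t'|) := by ring
      _ ≤ _ := by gcongr
  calc _ ≤ 2 * η * S + L * (3 * η) := add_le_add h1 h2
    _ = (2 * S + 3 * L) * (E.diam / d) * ‖x - y‖ := by simp only [η]; ring

/-- The gauge is the radial extension of the constant `1`, which has size one and slope zero. -/
theorem abs_radius_sub_le {d : ℝ} (hd : 0 < d) (hdet : ∀ i, d ≤ |E.edgeDet c i|) (x y : Plane) :
    |E.radius c x - E.radius c y| ≤ 2 * (E.diam / d) * ‖x - y‖ := by
  have := hE.abs_radialExt_sub_le (γ := fun _ => 1) (S := 1) (L := 0) hd hdet le_rfl (by simp)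
    (by simp) x y
  simpa [radialExt_one] using this

end IsStar

end Polygon

/-! ### Cauchy-Schwarz inequalities -/

theorem abs_integral_mul_le_sqrt {α : Type*} {_ : MeasurableSpace α} {ν : Measure α} {f g : α → ℝ}
    (hf : MemLp f 2 ν) (hg : MemLp g 2 ν) :
    |∫ x, f x * g x ∂ν| ≤ √(∫ x, f x ^ 2 ∂ν) * √(∫ x, g x ^ 2 ∂ν) := by
  have hff := hf.integrable_sq
  have hgg := hg.integrable_sq
  have hfg : Integrable (fun x => f x * g x) ν := hf.integrable_mul hg
  rw [← Real.sqrt_mul (integral_nonneg fun x => sq_nonneg _)]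
  refine Real.abs_le_sqrt ?_
  have h := discrim_le_zero (a := ∫ x, f x ^ 2 ∂ν) (b := 2 * ∫ x, f x * g x ∂ν)
    (c := ∫ x, g x ^ 2 ∂ν) fun t => ?_
  · rw [discrim] at h
    linarith
  · have h1 : 0 ≤ ∫ x, (t * f x + g x) ^ 2 ∂ν := integral_nonneg fun x => sq_nonneg _
    have h2 : ∫ x, (t * f x + g x) ^ 2 ∂ν =
        ∫ x, ((t * t) * f x ^ 2 + (2 * t) * (f x * g x) + g x ^ 2) ∂ν := by
      congr 1; ext x; ring
    have h3 : Integrable (fun x => t * t * f x ^ 2 + 2 * t * (f x * g x)) ν :=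
      (hff.const_mul _).add (hfg.const_mul _)
    rw [h2, integral_add h3 hgg,
      integral_add (hff.const_mul _) (hfg.const_mul _), integral_const_mul, integral_const_mul] at h1
    linarith

theorem abs_integral_inner_le_sqrt {U : Set Plane} {F G : Plane → Plane}
    (hF : MemLp F 2 (volume.restrict U)) (hG : MemLp G 2 (volume.restrict U)) :
    |∫ x in U, inner ℝ (F x) (G x)| ≤ √(normSq U F) * √(normSq U G) := by
  refine le_trans ?_ ((le_abs_self _).trans (abs_integral_mul_le_sqrt hF.norm hG.norm))
  rw [← Real.norm_eq_abs]
  refine (norm_integral_le_integral_norm _).trans ?_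
  refine integral_mono_of_nonneg (ae_of_all _ fun x => norm_nonneg _)
    (hF.norm.integrable_mul hG.norm) (ae_of_all _ fun x => ?_)
  exact norm_inner_le_norm _ _

theorem norm_gradient (f : Plane → ℝ) (x : Plane) : ‖gradient f x‖ = ‖fderiv ℝ f x‖ :=
  LinearIsometryEquiv.norm_map _ _

theorem continuous_gradient {f : Plane → ℝ} (hf : ContDiff ℝ ∞ f) : Continuous (gradient f) :=
  (InnerProductSpace.toDual ℝ Plane).symm.continuous.comp (hf.continuous_fderiv (by simp))

/-! ### Test functions representing linear functionals on polynomials -/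

theorem eq_zero_of_polyFun_eqOn_zero {U : Set Plane} (hU : IsOpen U) (hne : U.Nonempty)
    {p : MvPolynomial (Fin 2) ℝ} (h : ∀ x ∈ U, polyFun p x = 0) : p = 0 := by
  obtain ⟨c, hc⟩ := hne
  have hopen : IsOpen ((fun y : Fin 2 → ℝ => (WithLp.toLp 2 y : Plane)) ⁻¹' U) :=
    hU.preimage (PiLp.continuous_toLp 2 _)
  obtain ⟨ε, hε, hball⟩ := Metric.isOpen_iff.1 hopen (fun i => c i) (by simpa using hc)
  refine MvPolynomial.funext_set (fun i => Metric.ball (c i) ε) (fun i => ?_) fun y hy => ?_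
  · rw [Real.ball_eq_Ioo]
    exact Set.Ioo_infinite (by linarith)
  · have hy' : y ∈ Metric.ball (fun i => c i) ε := by
      rw [ball_pi _ hε]; exact hy
    simpa [polyFun] using h _ (hball hy')

/-- The form `∫ p q b` with a bump function `b` is positive definite on `ℙ_ℓ`, so every functional
is represented by some `φ = p b`. Applied to coefficients, this gives test functions chosen once for
all elements, depending on `ℓ` and `ρ` alone. -/
theorem exists_isTest_integral_eq (ℓ : ℕ) {ρ : ℝ} (hρ : 0 < ρ) (f : polyLE ℓ →ₗ[ℝ] ℝ) :
    ∃ φ, IsTest (Metric.ball (0 : Plane) ρ) φ ∧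
      ∀ Q : polyLE ℓ, f Q = ∫ y, polyFun Q.1 y * φ y := by
  let b : ContDiffBump (0 : Plane) := ⟨ρ / 4, ρ / 2, by positivity, by linarith⟩
  have hint : ∀ p q, Integrable (fun x => polyFun q x * (polyFun p x * b x)) := fun p q => by
    refine Continuous.integrable_of_hasCompactSupport ?_ ?_
    · exact (continuous_polyFun q).mul ((continuous_polyFun p).mul b.continuous)
    · exact (b.hasCompactSupport.mul_left).mul_left
  let B : polyLE ℓ →ₗ[ℝ] (polyLE ℓ →ₗ[ℝ] ℝ) :=
    LinearMap.mk₂ ℝ (fun p q => ∫ x, polyFun q.1 x * (polyFun p.1 x * b x))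
      (fun p p' q => by
        rw [← integral_add (hint _ _) (hint _ _)]
        simp [polyFun, add_mul, mul_add])
      (fun a p q => by
        rw [smul_eq_mul, ← integral_const_mul]
        simp [polyFun, mul_left_comm, mul_assoc])
      (fun p q q' => by
        rw [← integral_add (hint _ _) (hint _ _)]
        simp [polyFun, add_mul])
      (fun a p q => by
        rw [smul_eq_mul, ← integral_const_mul]
        simp [polyFun, mul_assoc])
  have hB : ∀ p q : polyLE ℓ, B p q = ∫ x, polyFun q.1 x * (polyFun p.1 x * b x) :=
    fun p q => rfl
  have hinj : Function.Injective B := by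
    rw [← LinearMap.ker_eq_bot, LinearMap.ker_eq_bot']
    intro p hp
    have h0 : ∫ x, polyFun p.1 x * (polyFun p.1 x * b x) = 0 := by
      rw [← hB, hp]; rfl
    have hnn : ∀ x, 0 ≤ polyFun p.1 x * (polyFun p.1 x * b x) := fun x => by
      rw [← mul_assoc]; exact mul_nonneg (mul_self_nonneg _) b.nonneg
    rw [integral_eq_zero_iff_of_nonneg hnn (hint _ _)] at h0
    have h1 := Continuous.ae_eq_iff_eq (μ := volume)
      ((continuous_polyFun p.1).mul ((continuous_polyFun p.1).mul b.continuous))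
      continuous_const |>.1 h0
    refine Subtype.ext (eq_zero_of_polyFun_eqOn_zero (U := Metric.ball 0 (ρ / 4))
      Metric.isOpen_ball ⟨0, Metric.mem_ball_self (by positivity)⟩ fun x hx => ?_)
    have h2 : polyFun p.1 x * (polyFun p.1 x * b x) = 0 := congrFun h1 x
    rw [b.one_of_mem_closedBall (Metric.ball_subset_closedBall hx), mul_one] at h2
    exact mul_self_eq_zero.1 h2
  have hsurj : Function.Surjective B :=
    (LinearMap.injective_iff_surjective_of_finrank_eq_finrank
      (Subspace.dual_finrank_eq (K := ℝ) (V := polyLE ℓ)).symm).1 hinj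
  obtain ⟨p, hp⟩ := hsurj f
  refine ⟨fun x => polyFun p.1 x * b x, ⟨(contDiff_polyFun _).mul b.contDiff,
    b.hasCompactSupport.mul_left, ?_⟩, fun q => by rw [← hp, hB]⟩
  refine (tsupport_mul_subset_right).trans ?_
  rw [b.tsupport_eq]
  exact Metric.closedBall_subset_ball (by simp only [b]; linarith)

/-! ### An inverse estimate -/

namespace Polygon

variable {E : Polygon} {c : Plane} {r : ℝ}

theorem isFiniteMeasure_restrict (E : Polygon) : IsFiniteMeasure (volume.restrict E.carrier) :=
  ⟨by simpa using E.isBounded.measure_lt_top⟩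

theorem area_le (E : Polygon) : E.area ≤ (2 * E.diam) ^ 2 := by
  obtain ⟨x, hx⟩ := E.isConnected.nonempty
  have hsub : E.carrier ⊆ Metric.closedBall x E.diam := fun y hy =>
    dist_le_diam_of_mem_closure (subset_closure hy) (subset_closure hx)
  have h := measureReal_mono (μ := volume) hsub
    (Metric.isBounded_closedBall.measure_lt_top.ne)
  refine h.trans ?_
  have hd := E.diam_pos
  rw [measureReal_def, EuclideanSpace.volume_closedBall_fin_two, ENNReal.toReal_mul,
    ENNReal.toReal_pow, ENNReal.toReal_ofReal hd.le, ENNReal.toReal_ofReal Real.pi_pos.le]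
  nlinarith [Real.pi_le_four, sq_nonneg E.diam]

theorem sqrt_area_le (E : Polygon) : √E.area ≤ 2 * E.diam :=
  (Real.sqrt_le_sqrt E.area_le).trans (Real.sqrt_sq (by have := E.diam_pos; positivity)).le

theorem integral_norm_le (E : Polygon) {G : Plane → Plane}
    (hG : MemLp G 2 (volume.restrict E.carrier)) :
    ∫ x in E.carrier, ‖G x‖ ≤ 2 * E.diam * √(normSq E.carrier G) := by
  have := E.isFiniteMeasure_restrict
  have h := (le_abs_self _).trans (abs_integral_mul_le_sqrt (memLp_const (1 : ℝ)) hG.norm)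
  simp only [one_mul, one_pow, integral_const, smul_eq_mul, mul_one, measureReal_restrict_apply_univ]
    at h
  exact h.trans (mul_le_mul_of_nonneg_right E.sqrt_area_le (Real.sqrt_nonneg _))

theorem abs_integral_inner_le (E : Polygon) {G F : Plane → Plane} {K : ℝ}
    (hG : MemLp G 2 (volume.restrict E.carrier)) (hK : 0 ≤ K) (hF : ∀ x, ‖F x‖ ≤ K) :
    |∫ x in E.carrier, inner ℝ (G x) (F x)| ≤ K * (2 * E.diam * √(normSq E.carrier G)) := by
  have := E.isFiniteMeasure_restrict
  rw [← Real.norm_eq_abs]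
  refine (norm_integral_le_integral_norm _).trans ?_
  refine le_trans ?_ (mul_le_mul_of_nonneg_left (E.integral_norm_le hG) hK)
  rw [← integral_const_mul]
  refine integral_mono_of_nonneg (ae_of_all _ fun x => norm_nonneg _)
    ((hG.norm.integrable (by norm_num)).const_mul K) (ae_of_all _ fun x => ?_)
  refine (norm_inner_le_norm _ _).trans ?_
  rw [mul_comm]
  exact mul_le_mul_of_nonneg_right (hF x) (norm_nonneg _)

end Polygon

theorem IsTest.bound {U : Set Plane} {φ : Plane → ℝ} (h : IsTest U φ) :
    ∃ K, 0 ≤ K ∧ ∀ x, ‖fderiv ℝ φ x‖ ≤ K := by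
  obtain ⟨K, hK⟩ := (h.1.continuous_fderiv (by simp)).bounded_above_of_compact_support
    (h.2.1.fderiv ℝ)
  exact ⟨K, (norm_nonneg _).trans (hK 0), hK⟩

theorem IsTest.eq_zero {U : Set Plane} {φ : Plane → ℝ} (h : IsTest U φ) {x : Plane} (hx : x ∉ U) :
    φ x = 0 := image_eq_zero_of_notMem_tsupport fun hx' => hx (h.2.2 hx')

/-- The coefficients of a polynomial which is a weak divergence. -/
theorem abs_functional_le {ρ : ℝ} {φ : Plane → ℝ} (hφ : IsTest (Metric.ball (0 : Plane) ρ) φ)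
    {K : ℝ} (hK : 0 ≤ K) (hφK : ∀ x, ‖fderiv ℝ φ x‖ ≤ K) {E : Polygon} {c : Plane}
    (hE : E.IsStar c (ρ * E.diam)) {G : Plane → Plane} (hG : MemLp G 2 (volume.restrict E.carrier))
    {q Q : MvPolynomial (Fin 2) ℝ}
    (hq : ∀ φ, IsTest E.carrier φ →
      ∫ x in E.carrier, inner ℝ (G x) (gradient φ x) = -∫ x in E.carrier, polyFun q x * φ x)
    (hQ : ∀ y, polyFun q (c + E.diam • y) = polyFun Q y) :
    |∫ y, polyFun Q y * φ y| ≤ 2 * K / E.diam ^ 2 * √(normSq E.carrier G) := by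
  have hh := E.diam_pos
  set h := E.diam with hh'
  -- The test function is transplanted to the ball of radius `ρ h` about `c`. The left side scales
  -- like `h²`, while `|∇φ'| ≤ K/h` and `√|E| ≤ 2h` make the right side scale-free; hence the factor
  -- `h⁻²`.
  set φ' : Plane → ℝ := fun x => φ (h⁻¹ • (x - c)) with hφ'
  have hsup : tsupport φ' ⊆ (fun y => c + h • y) '' tsupport φ := by
    have hcpt : IsCompact ((fun y => c + h • y) '' tsupport φ) :=
      IsCompact.image hφ.2.1 (by fun_prop)
    refine closure_minimal (fun x hx => ?_) hcpt.isClosed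
    refine ⟨h⁻¹ • (x - c), subset_tsupport _ hx, ?_⟩
    simp [smul_smul, mul_inv_cancel₀ hh.ne']
  have hT : IsTest E.carrier φ' := by
    refine ⟨hφ.1.comp (by fun_prop), ?_, hsup.trans ?_⟩
    · exact (IsCompact.image hφ.2.1 (by fun_prop : Continuous fun y => c + h • y)).of_isClosed_subset
        (isClosed_tsupport _) hsup
    · rintro _ ⟨y, hy, rfl⟩
      refine hE.ball_subset ?_
      have h1 := hφ.2.2 hy
      rw [Metric.mem_ball, dist_zero_right] at h1
      rw [Metric.mem_ball, dist_eq_norm, add_sub_cancel_left, norm_smul, Real.norm_of_nonneg hh.le,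
        mul_comm]
      exact mul_lt_mul_of_pos_right h1 hh
  have h1 : ∫ x in E.carrier, polyFun q x * φ' x = h ^ 2 * ∫ y, polyFun Q y * φ y := by
    rw [setIntegral_eq_integral_of_forall_compl_eq_zero
      (fun x hx => by rw [hT.eq_zero hx, mul_zero])]
    have h2 := Measure.integral_comp_smul_of_nonneg (volume : Measure Plane)
      (fun z => polyFun q (c + z) * φ' (c + z)) h (hR := hh.le)
    rw [integral_add_left_eq_self (fun x => polyFun q x * φ' x) c] at h2
    have h3 : ∀ y, polyFun q (c + h • y) * φ' (c + h • y) = polyFun Q y * φ y := fun y => by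
      rw [hQ]; simp [hφ', smul_smul, inv_mul_cancel₀ hh.ne']
    simp only [h3, finrank_euclideanSpace, Fintype.card_fin, smul_eq_mul] at h2
    rw [h2, mul_inv_cancel_left₀ (by positivity)]
  have hgr : ∀ x, ‖gradient φ' x‖ ≤ K / h := fun x => by
    rw [norm_gradient]
    have hd : HasFDerivAt φ' ((fderiv ℝ φ (h⁻¹ • (x - c))).comp
        (h⁻¹ • ContinuousLinearMap.id ℝ Plane)) x := by
      refine HasFDerivAt.comp x (hφ.1.differentiable (by simp) _).hasFDerivAt ?_
      exact ((hasFDerivAt_id x).sub_const c).const_smul h⁻¹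
    rw [hd.fderiv, ContinuousLinearMap.comp_smul, ContinuousLinearMap.comp_id, norm_smul,
      Real.norm_of_nonneg (by positivity), div_eq_inv_mul]
    gcongr
    exact hφK _
  have h4 := E.abs_integral_inner_le hG (by positivity) hgr
  rw [hq _ hT, h1, abs_neg, abs_mul, abs_of_nonneg (by positivity)] at h4
  have h5 : K / h * (2 * h * √(normSq E.carrier G)) = 2 * K * √(normSq E.carrier G) := by
    field_simp
  rw [h5] at h4
  rw [div_mul_eq_mul_div, le_div_iff₀ (by positivity)]
  linarith

/-- If the divergence of a square integrable field is a polynomial, then the maximum of this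
polynomial is bounded by the norm of the field. -/
theorem exists_abs_polyFun_le (ℓ : ℕ) {ρ : ℝ} (hρ : 0 < ρ) : ∃ C, 0 ≤ C ∧
    ∀ (E : Polygon) (c : Plane), E.IsStar c (ρ * E.diam) → ∀ G : Plane → Plane,
      MemLp G 2 (volume.restrict E.carrier) → ∀ q ∈ polyLE ℓ,
      (∀ φ, IsTest E.carrier φ →
        ∫ x in E.carrier, inner ℝ (G x) (gradient φ x) = -∫ x in E.carrier, polyFun q x * φ x) →
      ∀ x ∈ E.carrier, |polyFun q x| ≤ C / E.diam ^ 2 * √(normSq E.carrier G) := by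
  -- One test function per monomial, fixed before the element is introduced, so that the bounds `K
  -- s` are uniform. Only the finitely many exponents of degree at most `ℓ` enter the constant.
  choose φ hφ hφQ using fun s : Fin 2 →₀ ℕ => exists_isTest_integral_eq ℓ hρ
    ((MvPolynomial.lcoeff ℝ s) ∘ₗ (polyLE ℓ).subtype)
  choose K hK0 hK using fun s => (hφ s).bound
  have hfin : {s : Fin 2 →₀ ℕ | (s.sum fun _ e => e) ≤ ℓ}.Finite := by
    refine (Finset.finite_toSet (Finset.Iic (Finsupp.equivFunOnFinite.symm fun _ : Fin 2 => ℓ))).subset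
      fun s hs => ?_
    simp only [Finset.coe_Iic, mem_Iic]
    intro i
    refine le_trans ?_ hs
    rw [Finsupp.sum_fintype _ _ (by simp)]
    exact Finset.single_le_sum (f := fun i => s i) (fun _ _ => Nat.zero_le _) (Finset.mem_univ i)
  refine ⟨∑ s ∈ hfin.toFinset, 2 * K s, Finset.sum_nonneg fun s _ => by
    have := hK0 s; positivity, ?_⟩
  intro E c hE G hG q hq hqG x hx
  have hh := E.diam_pos
  obtain ⟨Q, hQ, hQq⟩ := exists_polyFun_dilation hq c E.diam
  have hcoeff : ∀ s, |Q.coeff s| ≤ 2 * K s / E.diam ^ 2 * √(normSq E.carrier G) := fun s => by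
    have := hφQ s ⟨Q, hQ⟩
    simp only [LinearMap.comp_apply, Submodule.subtype_apply, MvPolynomial.lcoeff_apply] at this
    rw [this]
    exact abs_functional_le (hφ s) (hK0 s) (hK s) hE hG hqG hQq
  have hxy : x = c + E.diam • (E.diam⁻¹ • (x - c)) := by
    rw [smul_smul, mul_inv_cancel₀ hh.ne', one_smul, add_sub_cancel]
  -- In the rescaled variable `E` lies in the unit ball, so every monomial is at most one and the
  -- coefficients bound the value.
  set y := E.diam⁻¹ • (x - c) with hy
  have hy1 : ‖y‖ ≤ 1 := by
    rw [hy, norm_smul, norm_inv, Real.norm_of_nonneg hh.le, inv_mul_le_iff₀ hh, mul_one,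
      ← dist_eq_norm]
    exact Polygon.dist_le_diam_of_mem_closure (subset_closure hx) (subset_closure hE.center_mem)
  rw [hxy, hQq, polyFun, MvPolynomial.eval_eq']
  rw [MvPolynomial.mem_restrictTotalDegree] at hQ
  have hsub : Q.support ⊆ hfin.toFinset := fun s hs => by
    simpa using (MvPolynomial.le_totalDegree hs).trans hQ
  rw [Finset.sum_div, Finset.sum_mul]
  refine (Finset.abs_sum_le_sum_abs _ _).trans ((Finset.sum_le_sum fun s _ => ?_).trans
    (Finset.sum_le_sum_of_subset_of_nonneg hsub fun s _ _ => by have := hK0 s; positivity))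
  rw [abs_mul, Finset.abs_prod]
  refine (mul_le_of_le_one_right (abs_nonneg _) ?_).trans (hcoeff s)
  refine Finset.prod_le_one (fun i _ => abs_nonneg _) fun i _ => ?_
  rw [abs_pow]
  exact pow_le_one₀ (abs_nonneg _) ((PiLp.norm_apply_le y i).trans hy1)

/-! ### Integration over sectors -/

theorem continuous_of_abs_sub_le {w : Plane → ℝ} {K : ℝ} (hK : 0 ≤ K)
    (hw : ∀ x y, |w x - w y| ≤ K * ‖x - y‖) : Continuous w := by
  have : LipschitzWith K.toNNReal w := LipschitzWith.of_dist_le_mul fun x y => by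
    rw [Real.dist_eq, dist_eq_norm, Real.coe_toNNReal _ hK]
    exact hw x y
  exact this.continuous

namespace Polygon

variable {E : Polygon} {c : Plane} {r : ℝ}

/-- The point with parameter `p.1` on the edge and radius `p.2`. -/
def ray (E : Polygon) (c : Plane) (i : E.Idx) (p : ℝ × ℝ) : Plane :=
  c + p.2 • (E.edgePt i p.1 - c)

theorem continuous_ray (i : E.Idx) : Continuous (E.ray c i) := by
  have := continuous_edgePt (E := E) i
  unfold ray
  fun_prop

/-- The part of the triangle over the edge `i` where the radius lies in `S`. -/
def sector (E : Polygon) (c : Plane) (i : E.Idx) (S : Set ℝ) : Set Plane :=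
  E.ray c i '' (Icc 0 1 ×ˢ S)

theorem integrableOn_carrier (E : Polygon) {f : Plane → ℝ} (hf : Continuous f) :
    IntegrableOn f E.carrier :=
  (hf.continuousOn.integrableOn_compact E.isBounded.isCompact_closure).mono_set subset_closure

theorem integrableOn_ray (i : E.Idx) {S : Set ℝ} (hS0 : S ⊆ Ioo 0 1) {f : Plane → ℝ}
    (hf : Continuous f) :
    IntegrableOn (fun p : ℝ × ℝ => p.2 * f (E.ray c i p)) (Icc 0 1 ×ˢ S) := by
  have hray := continuous_ray (E := E) (c := c) i
  have hcont : Continuous fun p : ℝ × ℝ => p.2 * f (E.ray c i p) := by fun_prop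
  exact (hcont.continuousOn.integrableOn_compact ((isCompact_Icc (a := (0 : ℝ)) (b := 1)).prod
    (isCompact_Icc (a := (0 : ℝ)) (b := 1)))).mono_set
    (prod_mono le_rfl (hS0.trans Ioo_subset_Icc_self))

theorem integral_pair (S : Set (ℝ × ℝ)) (g : Plane → ℝ) :
    ∫ x in (fun p : ℝ × ℝ => (!₂[p.1, p.2] : Plane)) '' S, g x = ∫ p in S, g !₂[p.1, p.2] := by
  have h1 : MeasurePreserving (fun p : ℝ × ℝ => (!₂[p.1, p.2] : Plane)) := by
    have := (PiLp.volume_preserving_toLp (Fin 2)).comp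
      (volume_preserving_finTwoArrow ℝ).symm
    exact this
  have h2 : MeasurableEmbedding (fun p : ℝ × ℝ => (!₂[p.1, p.2] : Plane)) :=
    (MeasurableEquiv.finTwoArrow.symm.trans (MeasurableEquiv.toLp 2 (Fin 2 → ℝ))).measurableEmbedding
  exact h1.setIntegral_image_emb h2 g S

namespace IsStar

variable (hE : E.IsStar c r)
include hE

theorem injOn_ray (i : E.Idx) : InjOn (E.ray c i) (univ ×ˢ Ioi 0) := by
  rintro ⟨t, s⟩ ⟨-, hs⟩ ⟨t', s'⟩ ⟨-, hs'⟩ h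
  simp only [mem_Ioi] at hs hs'
  simp only [ray, ray_eq] at h
  have hd := hE.edgeDet_ne_zero i
  have h1 := congrArg (E.coordL c i) h
  have h2 := congrArg (E.coordR c i) h
  rw [coordL_add hd, coordL_add hd] at h1
  rw [coordR_add hd, coordR_add hd] at h2
  have h3 : s = s' := by linarith
  subst h3
  have h4 := mul_left_cancel₀ hs.ne' h2
  rw [h4]

/-- The map `(t,s) ↦ c + s(e(t) - c)` has Jacobian determinant `-s · edgeDet`. The pair `(t,s)` is
packed into a vector of `Plane` so that the change of variables is a self-map of one space. -/
theorem integral_sector (i : E.Idx) {S : Set ℝ} (hS : MeasurableSet S) (hS0 : S ⊆ Ioi 0)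
    (f : Plane → ℝ) : ∫ x in E.sector c i S, f x =
      ∫ p in Icc (0 : ℝ) 1 ×ˢ S, |E.edgeDet c i| * (p.2 * f (E.ray c i p)) := by
  set e : ℝ × ℝ → Plane := fun p => !₂[p.1, p.2] with he
  set Ψ : Plane → Plane := fun x => c + x 1 • (E.vertex i - c +
    x 0 • (E.vertex (i + 1) - E.vertex i)) with hΨ
  set Ψ' : Plane → Plane →L[ℝ] Plane := fun x =>
    (EuclideanSpace.proj 1 : Plane →L[ℝ] ℝ).smulRight (E.vertex i - c +
      x 0 • (E.vertex (i + 1) - E.vertex i)) +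
    (EuclideanSpace.proj 0 : Plane →L[ℝ] ℝ).smulRight (x 1 • (E.vertex (i + 1) - E.vertex i))
    with hΨ'
  have hcomp : ∀ p, Ψ (e p) = E.ray c i p := fun p => by
    simp only [hΨ, he, ray, edgePt_eq]; simp; module
  have hder : ∀ x, HasFDerivAt Ψ (Ψ' x) x := fun x => by
    have h0 : HasFDerivAt (fun x : Plane => x 0) (EuclideanSpace.proj 0 : Plane →L[ℝ] ℝ) x :=
      (EuclideanSpace.proj 0 : Plane →L[ℝ] ℝ).hasFDerivAt
    have h1 : HasFDerivAt (fun x : Plane => x 1) (EuclideanSpace.proj 1 : Plane →L[ℝ] ℝ) x :=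
      (EuclideanSpace.proj 1 : Plane →L[ℝ] ℝ).hasFDerivAt
    refine ((h1.smul ((h0.smul_const _).const_add _)).const_add c).congr_fderiv ?_
    ext v k
    simp [hΨ']
    ring
  have hdet : ∀ x, (Ψ' x).det = -(x 1 * E.edgeDet c i) := fun x => by
    rw [ContinuousLinearMap.det, ← LinearMap.det_toMatrix (EuclideanSpace.basisFun (Fin 2) ℝ).toBasis,
      Matrix.det_fin_two]
    simp [LinearMap.toMatrix_apply, hΨ', edgeDet, cross]
    ring
  have himg : E.sector c i S = Ψ '' (e '' (Icc 0 1 ×ˢ S)) := by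
    rw [image_image, sector]
    exact image_congr fun p _ => (hcomp p).symm
  have hmeas : MeasurableSet (e '' (Icc 0 1 ×ˢ S)) := by
    have h2 : MeasurableEmbedding e := (MeasurableEquiv.finTwoArrow.symm.trans
      (MeasurableEquiv.toLp 2 (Fin 2 → ℝ))).measurableEmbedding
    exact h2.measurableSet_image.2 (measurableSet_Icc.prod hS)
  have hinj : InjOn Ψ (e '' (Icc 0 1 ×ˢ S)) := by
    rintro _ ⟨p, hp, rfl⟩ _ ⟨q, hq, rfl⟩ hpq
    rw [hcomp, hcomp] at hpq
    rw [hE.injOn_ray i ⟨mem_univ _, hS0 hp.2⟩ ⟨mem_univ _, hS0 hq.2⟩ hpq]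
  rw [himg, integral_image_eq_integral_abs_det_fderiv_smul volume hmeas
    (fun x _ => (hder x).hasFDerivWithinAt) hinj, he, integral_pair]
  refine setIntegral_congr_fun (measurableSet_Icc.prod hS) fun p hp => ?_
  have h0 : 0 < p.2 := hS0 hp.2
  have := hcomp p
  simp only [he] at this
  simp only [hdet, this, smul_eq_mul, abs_neg, abs_mul]
  simp [abs_of_pos h0]
  ring

/-- Integration in polar coordinates over a sector. -/
theorem integral_sector_eq (i : E.Idx) {S : Set ℝ} (hS : MeasurableSet S) (hS0 : S ⊆ Ioo 0 1)
    {f : Plane → ℝ} (hf : Continuous f) : ∫ x in E.sector c i S, f x =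
      |E.edgeDet c i| * ∫ t in Icc (0 : ℝ) 1, ∫ s in S, s * f (E.ray c i (t, s)) := by
  rw [hE.integral_sector i hS (hS0.trans fun s hs => hs.1), integral_const_mul]
  congr 1
  exact setIntegral_prod _ (integrableOn_ray i hS0 hf)

theorem sector_subset (i : E.Idx) {S : Set ℝ} (hS0 : S ⊆ Ioo 0 1) : E.sector c i S ⊆ E.carrier := by
  rintro _ ⟨⟨t, s⟩, ⟨ht, hs⟩, rfl⟩
  refine hE.radius_lt_one_iff.1 ?_
  rw [ray, hE.radius_edgePt i ht (hS0 hs).1.le]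
  exact (hS0 hs).2

theorem integral_sector_le (i : E.Idx) {S : Set ℝ} (hS0 : S ⊆ Ioo 0 1) {f : Plane → ℝ}
    (hf : Continuous f) (hf0 : ∀ x, 0 ≤ f x) :
    ∫ x in E.sector c i S, f x ≤ ∫ x in E.carrier, f x :=
  setIntegral_mono_set (E.integrableOn_carrier hf) (ae_of_all _ hf0)
    (hE.sector_subset i hS0).eventuallyLE

end IsStar

end Polygon

/-! ### Trace and strip inequalities -/

/-- Fundamental theorem of calculus and Cauchy-Schwarz on `(s,1)`. The anchor is the end point `1`,
where a ray reaches the boundary. -/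
theorem sq_integral_deriv_le {g : ℝ → ℝ} (hg : ContDiff ℝ 1 g) {a s : ℝ} (hs : s ∈ Ioo a 1) :
    (g 1 - g s) ^ 2 ≤ (1 - a) * ∫ σ in Ioo a 1, deriv g σ ^ 2 := by
  have hd : Continuous (deriv g) := hg.continuous_deriv le_rfl
  have hint : ∀ s, IntegrableOn (fun σ => deriv g σ ^ 2) (Ioc s 1) := fun s =>
    ((hd.pow 2).continuousOn.integrableOn_compact (isCompact_Icc (a := s) (b := 1))).mono_set
      Ioc_subset_Icc_self
  have h1 : ∫ σ in s..1, deriv g σ = g 1 - g s :=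
    intervalIntegral.integral_deriv_eq_sub (fun x _ => hg.differentiable (by simp) x)
      (hd.intervalIntegrable _ _)
  rw [← h1, intervalIntegral.integral_of_le hs.2.le]
  have hfin : IsFiniteMeasure (volume.restrict (Ioc s 1)) := inferInstance
  have h2 := abs_integral_mul_le_sqrt (ν := volume.restrict (Ioc s 1)) (memLp_const (1 : ℝ))
    ((memLp_two_iff_integrable_sq hd.aestronglyMeasurable).2 (hint s))
  simp only [one_mul, one_pow, integral_const, smul_eq_mul, mul_one, measureReal_restrict_apply_univ,
    Real.volume_real_Ioc_of_le hs.2.le] at h2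
  have h3 : ∫ σ in Ioc s 1, deriv g σ ^ 2 ≤ ∫ σ in Ioo a 1, deriv g σ ^ 2 := by
    rw [← integral_Ioc_eq_integral_Ioo]
    exact setIntegral_mono_set (hint a) (ae_of_all _ fun _ => sq_nonneg _)
      (Ioc_subset_Ioc_left hs.1.le).eventuallyLE
  have h0 : 0 ≤ ∫ σ in Ioc s 1, deriv g σ ^ 2 := integral_nonneg fun _ => sq_nonneg _
  have h4 := pow_le_pow_left₀ (abs_nonneg _) h2 2
  rw [sq_abs, mul_pow, Real.sq_sqrt (by linarith [hs.2]), Real.sq_sqrt h0] at h4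
  exact h4.trans (mul_le_mul (by linarith [hs.1]) h3 h0 (by linarith [hs.1, hs.2]))

/-- Integrating `(s²g²)'` produces the weight `s`, which is the Jacobian of the radial coordinates.
The remainder in the pointwise bound is `s(1-s)(g² + g'²) + s²(g - g')² ≥ 0`. -/
theorem sq_le_integral {g : ℝ → ℝ} (hg : ContDiff ℝ 1 g) :
    g 1 ^ 2 ≤ ∫ s in Ioo (0 : ℝ) 1, s * (3 * g s ^ 2 + deriv g s ^ 2) := by
  have hc : Continuous g := hg.continuous
  have hd : Continuous (deriv g) := hg.continuous_deriv le_rfl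
  have h1 : ∫ s in (0 : ℝ)..1, (2 * s * g s ^ 2 + s ^ 2 * (2 * g s * deriv g s)) =
      1 ^ 2 * g 1 ^ 2 - 0 ^ 2 * g 0 ^ 2 := by
    refine intervalIntegral.integral_eq_sub_of_hasDerivAt (f := fun s => s ^ 2 * g s ^ 2)
      (fun s _ => ?_) (by apply Continuous.intervalIntegrable; fun_prop)
    have h2 := (hg.differentiable (by simp) s).hasDerivAt
    refine (((hasDerivAt_id s).pow 2).mul (h2.pow 2)).congr_deriv ?_
    simp
  rw [one_pow, one_mul, zero_pow two_ne_zero, zero_mul, sub_zero] at h1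
  rw [← h1, intervalIntegral.integral_of_le zero_le_one, integral_Ioc_eq_integral_Ioo]
  have hint : ∀ f : ℝ → ℝ, Continuous f → IntegrableOn f (Ioo 0 1) := fun f hf =>
    (hf.continuousOn.integrableOn_compact (isCompact_Icc (a := (0 : ℝ)) (b := 1))).mono_set
      Ioo_subset_Icc_self
  refine setIntegral_mono_on (hint _ (by fun_prop)) (hint _ (by fun_prop)) measurableSet_Ioo
    fun s hs => ?_
  have h3 : 0 ≤ s * (1 - s) * (g s ^ 2 + deriv g s ^ 2) := by
    have h5 := hs.1.le
    have h4 : 0 ≤ 1 - s := by linarith [hs.2]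
    positivity
  have h4 : 0 ≤ s ^ 2 * (g s - deriv g s) ^ 2 := by positivity
  nlinarith

namespace Polygon

variable {E : Polygon} {c : Plane} {r : ℝ}

theorem contDiff_ray {φ : Plane → ℝ} (hφ : ContDiff ℝ ∞ φ) (i : E.Idx) (t : ℝ) :
    ContDiff ℝ 1 fun s => φ (E.ray c i (t, s)) := by
  refine (hφ.of_le (by simp)).comp (?_ : ContDiff ℝ 1 fun s : ℝ => c + s • (E.edgePt i t - c))
  exact contDiff_const.add (contDiff_id.smul contDiff_const)

/-- The part of `E` close to the boundary, where the radius exceeds `1 - 2 δ`. -/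
def strip (E : Polygon) (c : Plane) (δ : ℝ) : Set Plane := {x ∈ E.carrier | 1 - 2 * δ < E.radius c x}

namespace IsStar

variable (hE : E.IsStar c r)
include hE

theorem norm_edgePt_sub_le (i : E.Idx) {t : ℝ} (ht : t ∈ Icc (0 : ℝ) 1) :
    ‖E.edgePt i t - c‖ ≤ E.diam := by
  rw [← dist_eq_norm]
  exact dist_le_diam_of_mem_closure (frontier_subset_closure (edgePt_mem_frontier i ht))
    (subset_closure hE.center_mem)

theorem deriv_ray_sq_le {φ : Plane → ℝ} (hφ : ContDiff ℝ ∞ φ) (i : E.Idx) {t : ℝ}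
    (ht : t ∈ Icc (0 : ℝ) 1) (s : ℝ) :
    deriv (fun s => φ (E.ray c i (t, s))) s ^ 2 ≤
      E.diam ^ 2 * ‖gradient φ (E.ray c i (t, s))‖ ^ 2 := by
  have h1 : HasDerivAt (fun s : ℝ => E.ray c i (t, s)) (E.edgePt i t - c) s := by
    simpa [ray] using ((hasDerivAt_id s).smul_const (E.edgePt i t - c)).const_add c
  have h2 := (hφ.differentiable (by simp) (E.ray c i (t, s))).hasFDerivAt.comp_hasDerivAt s h1
  rw [show deriv (fun s => φ (E.ray c i (t, s))) s = _ from h2.deriv, norm_gradient, ← mul_pow,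
    ← sq_abs, ← Real.norm_eq_abs]
  refine pow_le_pow_left₀ (norm_nonneg _) (((fderiv ℝ φ _).le_opNorm _).trans ?_) 2
  rw [mul_comm]
  exact mul_le_mul_of_nonneg_right (hE.norm_edgePt_sub_le i ht) (norm_nonneg _)

/-- The trace inequality for smooth functions on an edge. -/
theorem integral_edge_sq_le {φ : Plane → ℝ} (hφ : ContDiff ℝ ∞ φ) (i : E.Idx) :
    ∫ t in Icc (0 : ℝ) 1, φ (E.edgePt i t) ^ 2 ≤ |E.edgeDet c i|⁻¹ *
      (3 * (∫ x in E.carrier, φ x ^ 2) + E.diam ^ 2 * normSq E.carrier (gradient φ)) := by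
  have hφc := hφ.continuous
  have hgc := continuous_gradient hφ
  have hec := continuous_edgePt (E := E) i
  set f : Plane → ℝ := fun x => 3 * φ x ^ 2 + E.diam ^ 2 * ‖gradient φ x‖ ^ 2 with hf
  have hfc : Continuous f := by fun_prop
  have hD : 0 < |E.edgeDet c i| := abs_pos.2 (hE.edgeDet_ne_zero i)
  have hfE : ∫ x in E.carrier, f x =
      3 * (∫ x in E.carrier, φ x ^ 2) + E.diam ^ 2 * normSq E.carrier (gradient φ) := by
    rw [normSq, ← integral_const_mul, ← integral_const_mul]
    exact integral_add (E.integrableOn_carrier (by fun_prop)) (E.integrableOn_carrier (by fun_prop))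
  have h1 := hE.integral_sector_le i (S := Ioo 0 1) le_rfl hfc fun x => by positivity
  rw [hE.integral_sector_eq i measurableSet_Ioo le_rfl hfc, hfE] at h1
  -- It remains to integrate `sq_le_integral` over all rays through the edge; in radial coordinates
  -- the right side becomes an integral over the sector, which lies in `E`.
  rw [← div_eq_inv_mul, le_div_iff₀ hD, mul_comm]
  refine le_trans (mul_le_mul_of_nonneg_left ?_ hD.le) h1
  have hint := integrableOn_ray (E := E) (c := c) i (S := Ioo 0 1) le_rfl hfc
  rw [IntegrableOn, Measure.volume_eq_prod, ← Measure.prod_restrict] at hint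
  refine setIntegral_mono_on ?_ hint.integral_prod_left measurableSet_Icc fun t ht => ?_
  · exact ContinuousOn.integrableOn_compact isCompact_Icc (by fun_prop)
  · have h2 := sq_le_integral (contDiff_ray (c := c) hφ i t)
    have h3 : E.ray c i (t, 1) = E.edgePt i t := by simp [ray]
    rw [h3] at h2
    refine h2.trans ?_
    have hray := continuous_ray (E := E) (c := c) i
    have hdc := (contDiff_ray (c := c) hφ i t).continuous_deriv le_rfl
    have hint : ∀ f : ℝ → ℝ, Continuous f → IntegrableOn f (Ioo 0 1) := fun f hf =>
      (hf.continuousOn.integrableOn_compact (isCompact_Icc (a := (0 : ℝ)) (b := 1))).mono_set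
        Ioo_subset_Icc_self
    refine setIntegral_mono_on (hint _ (by fun_prop)) (hint _ (by fun_prop)) measurableSet_Ioo
      fun s hs => ?_
    exact mul_le_mul_of_nonneg_left (add_le_add le_rfl (hE.deriv_ray_sq_le hφ i ht s)) hs.1.le

theorem strip_subset_iUnion_sector {δ : ℝ} (h1 : δ ≤ 1 / 4) :
    E.strip c δ ⊆ ⋃ i, E.sector c i (Ioo (1 - 2 * δ) 1) := by
  rintro x ⟨hx, hδ⟩
  have hxc : x ≠ c := by
    rintro rfl
    rw [radius_center] at hδ
    linarith
  obtain ⟨i, t, ht, h⟩ := hE.exists_edgePt hxc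
  exact mem_iUnion.2 ⟨i, (t, E.radius c x), ⟨ht, hδ, hE.radius_lt_one_iff.2 hx⟩, h.symm⟩

/-- The Poincaré inequality in a strip along the boundary, for one sector. -/
theorem integral_sector_sq_le {w : Plane → ℝ} {K : ℝ} (hK : 0 ≤ K) (hw : ∀ x y, |w x - w y| ≤ K * ‖x - y‖)
    {φ : Plane → ℝ} (hφ : ContDiff ℝ ∞ φ) {δ : ℝ} (h0 : 0 < δ) (h1 : δ ≤ 1 / 4) (i : E.Idx) :
    ∫ x in E.sector c i (Ioo (1 - 2 * δ) 1), (φ x - w x) ^ 2 ≤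
      6 * δ * |E.edgeDet c i| * (∫ t in Icc (0 : ℝ) 1, (φ (E.edgePt i t) - w (E.edgePt i t)) ^ 2)
        + 24 * δ ^ 2 * E.diam ^ 2 * normSq E.carrier (gradient φ)
        + 24 * δ ^ 3 * |E.edgeDet c i| * (K * E.diam) ^ 2 := by
  have hφc := hφ.continuous
  have hgc := continuous_gradient hφ
  have hec := continuous_edgePt (E := E) i
  have hray := continuous_ray (E := E) (c := c) i
  have hwc : Continuous w := continuous_of_abs_sub_le hK hw
  have hD : 0 < |E.edgeDet c i| := abs_pos.2 (hE.edgeDet_ne_zero i)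
  set S := Ioo (1 - 2 * δ) 1 with hS
  have hS1 : S ⊆ Ioo 0 1 := Ioo_subset_Ioo_left (by linarith)
  have hSint : ∀ f : ℝ → ℝ, Continuous f → IntegrableOn f S := fun f hf =>
    (hf.continuousOn.integrableOn_compact (isCompact_Icc (a := (0 : ℝ)) (b := 1))).mono_set
      (hS1.trans Ioo_subset_Icc_self)
  have hTint : ∀ f : ℝ → ℝ, Continuous f → IntegrableOn f (Icc 0 1) := fun f hf =>
    hf.continuousOn.integrableOn_compact isCompact_Icc
  set N : Plane → ℝ := fun x => ‖gradient φ x‖ ^ 2 with hN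
  have hNc : Continuous N := by fun_prop
  set I : ℝ → ℝ := fun t => ∫ s in S, s * N (E.ray c i (t, s)) with hI
  have hIint : IntegrableOn I (Icc 0 1) := by
    have hint := integrableOn_ray (E := E) (c := c) i hS1 hNc
    rw [IntegrableOn, Measure.volume_eq_prod, ← Measure.prod_restrict] at hint
    exact hint.integral_prod_left
  have hInt : |E.edgeDet c i| * ∫ t in Icc (0 : ℝ) 1, I t ≤ normSq E.carrier (gradient φ) := by
    have h2 := hE.integral_sector_le i hS1 hNc fun x => by positivity
    rwa [hE.integral_sector_eq i measurableSet_Ioo hS1 hNc] at h2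
  have hzc : Continuous fun x => (φ x - w x) ^ 2 := by fun_prop
  rw [hE.integral_sector_eq i measurableSet_Ioo hS1 hzc]
  have hpt : ∀ t ∈ Icc (0 : ℝ) 1, ∫ s in S, s * (φ (E.ray c i (t, s)) - w (E.ray c i (t, s))) ^ 2 ≤
      6 * δ * (φ (E.edgePt i t) - w (E.edgePt i t)) ^ 2 + 24 * δ ^ 2 * E.diam ^ 2 * I t
        + 24 * δ ^ 3 * (K * E.diam) ^ 2 := by
    intro t ht
    set g : ℝ → ℝ := fun s => φ (E.ray c i (t, s)) with hg
    have hgC : ContDiff ℝ 1 g := contDiff_ray hφ i t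
    have hgd := hgC.continuous_deriv le_rfl
    have hr1 : E.ray c i (t, 1) = E.edgePt i t := by simp [ray]
    -- Since `δ ≤ 1/4`, the radius is at least `1/2` in the strip, so the Jacobian weight `s` can be
    -- inserted at the cost of a factor two.
    have hJ : ∫ s in S, deriv g s ^ 2 ≤ 2 * E.diam ^ 2 * I t := by
      rw [hI, ← integral_const_mul]
      refine setIntegral_mono_on (hSint _ (by fun_prop)) (hSint _ (by fun_prop)) measurableSet_Ioo
        fun s hs => ?_
      refine (hE.deriv_ray_sq_le hφ i ht s).trans ?_
      have h3 : 1 ≤ 2 * s := by linarith [hs.1]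
      have h4 : 0 ≤ E.diam ^ 2 * N (E.ray c i (t, s)) := by positivity
      calc E.diam ^ 2 * ‖gradient φ (E.ray c i (t, s))‖ ^ 2
          = E.diam ^ 2 * N (E.ray c i (t, s)) * 1 := by rw [mul_one]
        _ ≤ E.diam ^ 2 * N (E.ray c i (t, s)) * (2 * s) := by gcongr
        _ = _ := by ring
    -- The difference is split into its value on the edge, the variation of `φ` along the ray and
    -- that of `w`. Integrating over `S`, of length `2δ`, yields `3·2δ`, `3·(2δ)²·2` and `3·(2δ)³`
    -- as factors.
    have hbd : ∀ s ∈ S, s * (g s - w (E.ray c i (t, s))) ^ 2 ≤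
        3 * ((φ (E.edgePt i t) - w (E.edgePt i t)) ^ 2 + 2 * δ * (2 * E.diam ^ 2 * I t)
          + (2 * δ) ^ 2 * (K * E.diam) ^ 2) := by
      intro s hs
      have hs1 : s ≤ 1 := hs.2.le
      have hs0 : 0 ≤ s := by linarith [hs.1]
      have h5 := sq_integral_deriv_le hgC hs
      have h6 : (g 1 - g s) ^ 2 ≤ 2 * δ * (2 * E.diam ^ 2 * I t) := by
        refine h5.trans ?_
        rw [sub_sub_cancel]
        exact mul_le_mul_of_nonneg_left hJ (by positivity)
      have h7 : (w (E.ray c i (t, 1)) - w (E.ray c i (t, s))) ^ 2 ≤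
          (2 * δ) ^ 2 * (K * E.diam) ^ 2 := by
        rw [← mul_pow, ← sq_abs]
        refine pow_le_pow_left₀ (abs_nonneg _) ((hw _ _).trans ?_) 2
        have h8 : E.ray c i (t, 1) - E.ray c i (t, s) = (1 - s) • (E.edgePt i t - c) := by
          simp only [ray]; module
        rw [h8, norm_smul, Real.norm_of_nonneg (by linarith)]
        calc K * ((1 - s) * ‖E.edgePt i t - c‖) ≤ K * ((2 * δ) * E.diam) := by
              gcongr
              · linarith [hs.1]
              · exact hE.norm_edgePt_sub_le i ht
          _ = _ := by ring
      have h9 : g s - w (E.ray c i (t, s)) = (φ (E.edgePt i t) - w (E.edgePt i t))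
          + (-(g 1 - g s)) + (w (E.ray c i (t, 1)) - w (E.ray c i (t, s))) := by
        simp only [hg, hr1]; ring
      have h10 : (g s - w (E.ray c i (t, s))) ^ 2 ≤
          3 * ((φ (E.edgePt i t) - w (E.edgePt i t)) ^ 2 + (g 1 - g s) ^ 2
            + (w (E.ray c i (t, 1)) - w (E.ray c i (t, s))) ^ 2) := by
        rw [h9]
        have aux : ∀ a b d : ℝ, (a + -b + d) ^ 2 ≤ 3 * (a ^ 2 + b ^ 2 + d ^ 2) := fun a b d => by
          nlinarith [sq_nonneg (a + b), sq_nonneg (a - d), sq_nonneg (b + d)]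
        exact aux _ _ _
      calc s * (g s - w (E.ray c i (t, s))) ^ 2 ≤ 1 * (g s - w (E.ray c i (t, s))) ^ 2 := by gcongr
        _ ≤ _ := by linarith
    have h11 := setIntegral_mono_on (hSint _ (by fun_prop)) (hSint _ continuous_const)
      measurableSet_Ioo hbd
    refine h11.trans (le_of_eq ?_)
    rw [setIntegral_const, hS, Real.volume_real_Ioo_of_le (by linarith), smul_eq_mul]
    ring
  have hmono : ∫ t in Icc (0 : ℝ) 1, ∫ s in S,
      s * (φ (E.ray c i (t, s)) - w (E.ray c i (t, s))) ^ 2 ≤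
      ∫ t in Icc (0 : ℝ) 1, (6 * δ * (φ (E.edgePt i t) - w (E.edgePt i t)) ^ 2
        + 24 * δ ^ 2 * E.diam ^ 2 * I t + 24 * δ ^ 3 * (K * E.diam) ^ 2) := by
    have hint := integrableOn_ray (E := E) (c := c) i hS1 hzc
    rw [IntegrableOn, Measure.volume_eq_prod, ← Measure.prod_restrict] at hint
    refine setIntegral_mono_on hint.integral_prod_left ?_ measurableSet_Icc hpt
    exact ((hTint _ (by fun_prop)).add (hIint.const_mul _)).add (hTint _ continuous_const)
  have hA : IntegrableOn (fun t => 6 * δ * (φ (E.edgePt i t) - w (E.edgePt i t)) ^ 2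
      + 24 * δ ^ 2 * E.diam ^ 2 * I t) (Icc 0 1) :=
    Integrable.add (hTint _ (by fun_prop)) (hIint.const_mul _)
  rw [integral_add hA (hTint _ continuous_const), integral_add (hTint _ (by fun_prop)) (hIint.const_mul _),
    integral_const_mul, integral_const_mul, setIntegral_const, Real.volume_real_Icc_of_le zero_le_one,
    smul_eq_mul, sub_zero, one_mul] at hmono
  calc _ ≤ |E.edgeDet c i| * _ := mul_le_mul_of_nonneg_left hmono hD.le
    _ = 6 * δ * |E.edgeDet c i| * (∫ t in Icc (0 : ℝ) 1,
          (φ (E.edgePt i t) - w (E.edgePt i t)) ^ 2)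
        + 24 * δ ^ 2 * E.diam ^ 2 * (|E.edgeDet c i| * ∫ t in Icc (0 : ℝ) 1, I t)
        + 24 * δ ^ 3 * |E.edgeDet c i| * (K * E.diam) ^ 2 := by ring
    _ ≤ _ := by gcongr

/-- The Poincaré inequality in a strip along the boundary. -/
theorem integral_strip_sq_le {w : Plane → ℝ} {K : ℝ} (hK : 0 ≤ K) (hw : ∀ x y, |w x - w y| ≤ K * ‖x - y‖)
    {φ : Plane → ℝ} (hφ : ContDiff ℝ ∞ φ) {δ : ℝ} (h0 : 0 < δ) (h1 : δ ≤ 1 / 4) :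
    ∫ x in E.strip c δ, (φ x - w x) ^ 2 ≤
      ∑ i, (6 * δ * |E.edgeDet c i| *
          (∫ t in Icc (0 : ℝ) 1, (φ (E.edgePt i t) - w (E.edgePt i t)) ^ 2)
        + 24 * δ ^ 2 * E.diam ^ 2 * normSq E.carrier (gradient φ)
        + 24 * δ ^ 3 * |E.edgeDet c i| * (K * E.diam) ^ 2) := by
  refine le_trans ?_ (Finset.sum_le_sum fun i _ => hE.integral_sector_sq_le hK hw hφ h0 h1 i)
  have hφc := hφ.continuous
  have hwc : Continuous w := continuous_of_abs_sub_le hK hw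
  have hzc : Continuous fun x => (φ x - w x) ^ 2 := by fun_prop
  have hint : ∀ i, IntegrableOn (fun x => (φ x - w x) ^ 2) (E.sector c i (Ioo (1 - 2 * δ) 1)) :=
    fun i => (E.integrableOn_carrier hzc).mono_set
      (hE.sector_subset i (Ioo_subset_Ioo_left (by linarith)))
  have hle : volume.restrict (E.strip c δ) ≤
      ∑ i, volume.restrict (E.sector c i (Ioo (1 - 2 * δ) 1)) := by
    rw [← Measure.sum_fintype]
    exact (Measure.restrict_mono (hE.strip_subset_iUnion_sector h1) le_rfl).trans
      Measure.restrict_iUnion_le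
  rw [← integral_finsetSum_measure fun i _ => hint i]
  exact integral_mono_measure hle (ae_of_all _ fun _ => sq_nonneg _)
    (integrable_finsetSum_measure.2 fun i _ => hint i)

end IsStar

end Polygon

/-! ### Mollification and cut-off functions -/

open scoped Convolution in
/-- Smooth approximation of a Lipschitz function. -/
theorem exists_smooth_approx {f : Plane → ℝ} {K : ℝ} (hK : 0 ≤ K)
    (hf : ∀ x y, |f x - f y| ≤ K * ‖x - y‖) {ε : ℝ} (hε : 0 < ε) :
    ∃ g : Plane → ℝ, ContDiff ℝ ∞ g ∧ (∀ x, ‖gradient g x‖ ≤ K) ∧ (∀ x, |g x - f x| ≤ K * ε) ∧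
      ∀ x, (∀ y ∈ Metric.ball x ε, f y = f x) → g x = f x := by
  have hfc : Continuous f := continuous_of_abs_sub_le hK hf
  let b : ContDiffBump (0 : Plane) := ⟨ε / 2, ε, by positivity, by linarith⟩
  set g : Plane → ℝ := b.normed volume ⋆[ContinuousLinearMap.lsmul ℝ ℝ, volume] f with hg
  have hgs : ContDiff ℝ ∞ g := b.hasCompactSupport_normed.contDiff_convolution_left _
    b.contDiff_normed hfc.locallyIntegrable
  have hint : ∀ x, Integrable fun t => b.normed volume t * f (x - t) := fun x => by
    refine Continuous.integrable_of_hasCompactSupport ?_ b.hasCompactSupport_normed.mul_right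
    have := b.continuous_normed (μ := volume)
    fun_prop
  have hlip : ∀ x y, |g x - g y| ≤ K * ‖x - y‖ := fun x y => by
    have h1 : ∀ x, g x = ∫ t, b.normed volume t * f (x - t) := fun x => rfl
    rw [h1, h1, ← integral_sub (hint x) (hint y), ← Real.norm_eq_abs]
    have h2 : ∫ t, b.normed volume t * (K * ‖x - y‖) = K * ‖x - y‖ := by
      rw [integral_mul_const, b.integral_normed, one_mul]
    rw [← h2]
    refine norm_integral_le_of_norm_le (b.integrable_normed.mul_const _) (ae_of_all _ fun t => ?_)
    rw [← mul_sub, norm_mul, Real.norm_of_nonneg (b.nonneg_normed t), Real.norm_eq_abs]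
    refine mul_le_mul_of_nonneg_left ((hf _ _).trans_eq ?_) (b.nonneg_normed t)
    rw [sub_sub_sub_cancel_right]
  refine ⟨g, hgs, fun x => ?_, fun x => ?_, fun x hx => ?_⟩
  · rw [norm_gradient]
    have : LipschitzWith K.toNNReal g := LipschitzWith.of_dist_le_mul fun x y => by
      rw [Real.dist_eq, dist_eq_norm, Real.coe_toNNReal _ hK]
      exact hlip x y
    exact (norm_fderiv_le_of_lipschitz ℝ this).trans_eq (Real.coe_toNNReal _ hK)
  · rw [← Real.dist_eq]
    refine b.dist_normed_convolution_le hfc.aestronglyMeasurable fun y hy => ?_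
    rw [Real.dist_eq]
    refine (hf _ _).trans (mul_le_mul_of_nonneg_left ?_ hK)
    rw [← dist_eq_norm]
    exact (Metric.mem_ball.1 hy).le
  · exact b.normed_convolution_eq_right hx

namespace Polygon.IsStar

variable {E : Polygon} {c : Plane} {r : ℝ} (hE : E.IsStar c r)
include hE

/-- Cut-off functions which are constant outside a strip along the boundary. -/
theorem exists_cutoff {L : ℝ} (hL : 0 < L)
    (hrad : ∀ x y, |E.radius c x - E.radius c y| ≤ L * ‖x - y‖) {δ : ℝ} (hδ : 0 < δ) :
    ∃ χ : Plane → ℝ, IsTest E.carrier χ ∧ (∀ x, |χ x| ≤ 2) ∧ (∀ x, ‖gradient χ x‖ ≤ 2 * L / δ) ∧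
      ∀ x ∈ E.carrier, x ∉ E.strip c δ → χ x = 1 ∧ gradient χ x = 0 := by
  -- A piecewise linear profile in the gauge: one for radius at most `1 - δ`, zero for radius at
  -- least `1 - δ/2`.
  set f : Plane → ℝ := fun x => max 0 (min 1 (2 / δ * (1 - δ / 2 - E.radius c x))) with hf
  have hf0 : ∀ x, 0 ≤ f x := fun x => le_max_left _ _
  have hf1 : ∀ x, f x ≤ 1 := fun x => max_le zero_le_one (min_le_left _ _)
  have hrc : Continuous (E.radius c) := continuous_of_abs_sub_le hL.le hrad
  have hfL : ∀ x y, |f x - f y| ≤ 2 * L / δ * ‖x - y‖ := fun x y => by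
    refine (abs_max_sub_max_le_max _ _ _ _).trans ?_
    rw [sub_self, abs_zero, max_eq_right (abs_nonneg _)]
    refine (abs_min_sub_min_le_max _ _ _ _).trans ?_
    rw [sub_self, abs_zero, max_eq_right (abs_nonneg _), ← mul_sub, abs_mul,
      abs_of_pos (by positivity), sub_sub_sub_cancel_left, abs_sub_comm]
    calc 2 / δ * |E.radius c x - E.radius c y| ≤ 2 / δ * (L * ‖x - y‖) := by gcongr; exact hrad x y
      _ = _ := by ring
  -- Within distance `ε` the gauge changes by at most `δ/4`. The mollified profile therefore
  -- vanishes beyond `1 - δ/4` and equals one below `1 - 5δ/4`, in particular in a neighbourhood of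
  -- each point of `E` off the strip.
  set ε := δ / (4 * L) with hε
  have hε0 : 0 < ε := by positivity
  have hLε : L * ε = δ / 4 := by rw [hε]; field_simp
  obtain ⟨χ, hχs, hχg, hχf, hχl⟩ := exists_smooth_approx (by positivity) hfL hε0
  have hball : ∀ x, ∀ y ∈ Metric.ball x ε, |E.radius c y - E.radius c x| ≤ δ / 4 := fun x y hy => by
    refine (hrad y x).trans ?_
    rw [← hLε, ← dist_eq_norm]
    exact mul_le_mul_of_nonneg_left (Metric.mem_ball.1 hy).le hL.le
  have hzero : ∀ x, 1 - δ / 2 ≤ E.radius c x → f x = 0 := fun x hx => by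
    refine max_eq_left ((min_le_right _ _).trans ?_)
    exact mul_nonpos_of_nonneg_of_nonpos (by positivity) (by linarith)
  have hone : ∀ x, E.radius c x ≤ 1 - δ → f x = 1 := fun x hx => by
    have : 1 ≤ 2 / δ * (1 - δ / 2 - E.radius c x) := by
      rw [div_mul_eq_mul_div, le_div_iff₀ hδ]; linarith
    simp [hf, min_eq_left this]
  have hχ0 : ∀ x, 1 - δ / 4 < E.radius c x → χ x = 0 := fun x hx => by
    have h1 : ∀ y ∈ Metric.ball x ε, f y = 0 := fun y hy => by
      have := abs_le.1 (hball x y hy)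
      exact hzero y (by linarith [this.1])
    have h2 := h1 x (Metric.mem_ball_self hε0)
    rw [hχl x fun y hy => by rw [h1 y hy, h2], h2]
  have hχ1 : ∀ x, E.radius c x < 1 - 5 / 4 * δ → χ x = 1 := fun x hx => by
    have h1 : ∀ y ∈ Metric.ball x ε, f y = 1 := fun y hy => by
      have := abs_le.1 (hball x y hy)
      exact hone y (by linarith [this.2])
    have h2 := h1 x (Metric.mem_ball_self hε0)
    rw [hχl x fun y hy => by rw [h1 y hy, h2], h2]
  have hsup : tsupport χ ⊆ {x | E.radius c x ≤ 1 - δ / 4} := by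
    refine closure_minimal (fun x hx => ?_) (isClosed_le hrc continuous_const)
    by_contra h
    exact hx (hχ0 x (not_le.1 h))
  have hsupE : tsupport χ ⊆ E.carrier := fun x hx => hE.radius_lt_one_iff.1 <| by
    have h1 : E.radius c x ≤ 1 - δ / 4 := hsup hx
    linarith
  refine ⟨χ, ⟨hχs, ?_, hsupE⟩, fun x => ?_, hχg, fun x hx hxs => ?_⟩
  · exact (Metric.isCompact_of_isClosed_isBounded (isClosed_tsupport _)
      (E.isBounded.subset hsupE))
  · have h1 : 2 * L / δ * ε = 1 / 2 := by rw [mul_div_assoc, hε]; field_simp; norm_num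
    have h2 := abs_le.1 (hχf x)
    rw [h1] at h2
    rw [abs_le]
    constructor <;> linarith [hf0 x, hf1 x, h2.1, h2.2]
  · have h1 : E.radius c x ≤ 1 - 2 * δ := by
      by_contra h
      exact hxs ⟨hx, not_le.1 h⟩
    have h2 : E.radius c x < 1 - 5 / 4 * δ := by linarith
    refine ⟨hχ1 x h2, ?_⟩
    have h3 : χ =ᶠ[𝓝 x] fun _ => 1 := by
      filter_upwards [(isOpen_lt hrc continuous_const).mem_nhds h2] with y hy
      exact hχ1 y hy
    rw [h3.gradient_eq, gradient_fun_const]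

end Polygon.IsStar

/-! ### Convergence in `L²` -/

theorem integral_norm_sq_eq {α V : Type*} {_ : MeasurableSpace α} [NormedAddCommGroup V]
    {ν : Measure α} {f : α → V} (hf : MemLp f 2 ν) :
    ∫ x, ‖f x‖ ^ 2 ∂ν = (eLpNorm f 2 ν).toReal ^ 2 := by
  rw [hf.eLpNorm_eq_integral_rpow_norm two_ne_zero ENNReal.ofNat_ne_top]
  have h0 : 0 ≤ ∫ x, ‖f x‖ ^ 2 ∂ν := integral_nonneg fun x => by positivity
  simp only [ENNReal.toReal_ofNat, Real.rpow_ofNat]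
  rw [ENNReal.toReal_ofReal (by positivity), ← Real.rpow_natCast, ← Real.rpow_mul h0]
  norm_num

theorem tendsto_integral_norm_sq {α V : Type*} {_ : MeasurableSpace α} [NormedAddCommGroup V]
    {ν : Measure α} {f : ℕ → α → V} (hf : ∀ n, MemLp (f n) 2 ν)
    (h : Tendsto (fun n => eLpNorm (f n) 2 ν) atTop (𝓝 0)) :
    Tendsto (fun n => ∫ x, ‖f n x‖ ^ 2 ∂ν) atTop (𝓝 0) := by
  simp_rw [fun n => integral_norm_sq_eq (hf n)]
  have := ((ENNReal.tendsto_toReal ENNReal.zero_ne_top).comp h).pow 2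
  simpa using this

theorem normSq_nonneg {V : Type*} [NormedAddCommGroup V] (U : Set Plane) (F : Plane → V) :
    0 ≤ normSq U F := integral_nonneg fun x => by positivity

theorem integrable_mul_of_memLp {α : Type*} {_ : MeasurableSpace α} {ν : Measure α} {f g : α → ℝ}
    (hf : MemLp f 2 ν) (hg : MemLp g 2 ν) : Integrable (fun x => f x * g x) ν :=
  hf.integrable_mul hg

theorem integrable_inner_of_memLp {α : Type*} {_ : MeasurableSpace α} {ν : Measure α}
    {F G : α → Plane} (hF : MemLp F 2 ν) (hG : MemLp G 2 ν) :
    Integrable (fun x => inner ℝ (F x) (G x)) ν := by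
  refine (integrable_mul_of_memLp hF.norm hG.norm).mono'
    (hF.aestronglyMeasurable.inner hG.aestronglyMeasurable) (ae_of_all _ fun x => ?_)
  exact norm_inner_le_norm _ _

theorem tendsto_integral_inner {U : Set Plane} {H G : Plane → Plane} {Φ : ℕ → Plane → Plane}
    (hH : MemLp H 2 (volume.restrict U)) (hG : MemLp G 2 (volume.restrict U))
    (hΦ : ∀ n, MemLp (Φ n) 2 (volume.restrict U))
    (h : Tendsto (fun n => normSq U fun x => Φ n x - G x) atTop (𝓝 0)) :
    Tendsto (fun n => ∫ x in U, inner ℝ (H x) (Φ n x)) atTop (𝓝 (∫ x in U, inner ℝ (H x) (G x))) := by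
  rw [tendsto_iff_norm_sub_tendsto_zero]
  have h1 : Tendsto (fun n => √(normSq U H) * √(normSq U fun x => Φ n x - G x)) atTop (𝓝 0) := by
    have := (h.sqrt).const_mul √(normSq U H)
    simpa using this
  refine squeeze_zero (fun n => norm_nonneg _) (fun n => ?_) h1
  rw [← integral_sub (integrable_inner_of_memLp hH (hΦ n)) (integrable_inner_of_memLp hH hG), Real.norm_eq_abs]
  simp_rw [← inner_sub_right]
  exact abs_integral_inner_le_sqrt hH ((hΦ n).sub hG)

theorem tendsto_integral_mul {U : Set Plane} {p v : Plane → ℝ} {f : ℕ → Plane → ℝ}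
    (hp : MemLp p 2 (volume.restrict U)) (hv : MemLp v 2 (volume.restrict U))
    (hf : ∀ n, MemLp (f n) 2 (volume.restrict U))
    (h : Tendsto (fun n => ∫ x in U, (f n x - v x) ^ 2) atTop (𝓝 0)) :
    Tendsto (fun n => ∫ x in U, p x * f n x) atTop (𝓝 (∫ x in U, p x * v x)) := by
  rw [tendsto_iff_norm_sub_tendsto_zero]
  have h1 : Tendsto (fun n => √(∫ x in U, p x ^ 2) * √(∫ x in U, (f n x - v x) ^ 2)) atTop (𝓝 0) := by
    have := (h.sqrt).const_mul √(∫ x in U, p x ^ 2)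
    simpa using this
  refine squeeze_zero (fun n => norm_nonneg _) (fun n => ?_) h1
  rw [← integral_sub (integrable_mul_of_memLp hp (hf n)) (integrable_mul_of_memLp hp hv), Real.norm_eq_abs]
  simp_rw [← mul_sub]
  exact abs_integral_mul_le_sqrt hp ((hf n).sub hv)

namespace Polygon

variable {E : Polygon} {c : Plane} {r : ℝ}

theorem memLp_of_continuous (E : Polygon) {V : Type*} [NormedAddCommGroup V]
    [SecondCountableTopologyEither Plane V] {f : Plane → V} (hf : Continuous f) :
    MemLp f 2 (volume.restrict E.carrier) := by
  obtain ⟨C, hC⟩ := E.isBounded.isCompact_closure.exists_bound_of_continuousOn hf.continuousOn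
  have := E.isFiniteMeasure_restrict
  refine MemLp.of_bound hf.aestronglyMeasurable C ?_
  filter_upwards [ae_restrict_mem E.isOpen.measurableSet] with x hx
  exact hC x (subset_closure hx)

end Polygon

/-! ### The energy identity: cut-off and passage to the limit -/

/-- Testing a weak divergence with the product of a cut-off function and the difference of a smooth
and a Lipschitz function. -/
theorem abs_cutoff_identity_le {E : Polygon} {G : Plane → Plane}
    (hG : MemLp G 2 (volume.restrict E.carrier)) {q : Plane → ℝ} (hqc : Continuous q)
    (hq : ∀ φ, IsTest E.carrier φ →
      ∫ x in E.carrier, inner ℝ (G x) (gradient φ x) = -∫ x in E.carrier, q x * φ x)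
    {w : Plane → ℝ} {K : ℝ} (hK : 0 ≤ K) (hw : ∀ x y, |w x - w y| ≤ K * ‖x - y‖)
    {χ : Plane → ℝ} (hχ : IsTest E.carrier χ) (hχ2 : ∀ x, |χ x| ≤ 2) {φ : Plane → ℝ}
    (hφ : ContDiff ℝ ∞ φ) :
    |(∫ x in E.carrier, inner ℝ (χ x • G x) (gradient φ x)) +
        (∫ x in E.carrier, (φ x - w x) * inner ℝ (G x) (gradient χ x)) +
        ∫ x in E.carrier, q x * χ x * (φ x - w x)| ≤
      2 * K * (2 * E.diam * √(normSq E.carrier G)) := by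
  have := E.isFiniteMeasure_restrict
  have hχc := hχ.1.continuous
  have hχg := continuous_gradient hχ.1
  have hφc := hφ.continuous
  have hφg := continuous_gradient hφ
  have hwc : Continuous w := continuous_of_abs_sub_le hK hw
  have hGi : Integrable G (volume.restrict E.carrier) := hG.integrable (by norm_num)
  have hinn : ∀ F : Plane → Plane, Continuous F →
      Integrable (fun x => inner ℝ (G x) (F x)) (volume.restrict E.carrier) := fun F hF =>
    integrable_inner_of_memLp hG (E.memLp_of_continuous hF)
  -- `X` is the integrand obtained formally from the test function `χ(φ - w)`, without the term `-χ
  -- G·∇w`. No derivative of the Lipschitz function `w` is ever taken; that term accounts for the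
  -- bound `2K∫|G|`.
  set X : Plane → ℝ := fun x => inner ℝ (G x) (χ x • gradient φ x + (φ x - w x) • gradient χ x) +
    q x * χ x * (φ x - w x) with hX
  have hXint : (∫ x in E.carrier, inner ℝ (χ x • G x) (gradient φ x)) +
        (∫ x in E.carrier, (φ x - w x) * inner ℝ (G x) (gradient χ x)) +
        (∫ x in E.carrier, q x * χ x * (φ x - w x)) = ∫ x in E.carrier, X x := by
    have e1 : ∀ x, inner ℝ (χ x • G x) (gradient φ x) = inner ℝ (G x) (χ x • gradient φ x) :=
      fun x => by rw [real_inner_smul_left, real_inner_smul_right]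
    have e2 : ∀ x, (φ x - w x) * inner ℝ (G x) (gradient χ x) =
      inner ℝ (G x) ((φ x - w x) • gradient χ x) := fun x => by rw [real_inner_smul_right]
    simp_rw [e1, e2, hX, inner_add_right]
    have i1 := hinn (fun x => χ x • gradient φ x) (by fun_prop)
    have i2 := hinn (fun x => (φ x - w x) • gradient χ x) (by fun_prop)
    have i3 : Integrable (fun x => q x * χ x * (φ x - w x)) (volume.restrict E.carrier) :=
      E.integrableOn_carrier (by fun_prop)
    have i4 := integral_add (i1.add i2) i3
    have i5 := integral_add i1 i2
    simp only [Pi.add_apply] at i4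
    rw [i4, i5]
  rw [hXint]
  obtain ⟨B, hB⟩ := hχg.bounded_above_of_compact_support
    (show HasCompactSupport (gradient χ) from (hχ.2.1.fderiv ℝ).comp_left (map_zero _))
  have hB0 : 0 ≤ B := (norm_nonneg _).trans (hB 0)
  set J := ∫ x in E.carrier, (B * ‖G x‖ + 2 * |q x|) with hJ
  have hJ0 : 0 ≤ J := integral_nonneg fun x => by positivity
  have hiJ : Integrable (fun x => B * ‖G x‖ + 2 * |q x|) (volume.restrict E.carrier) :=
    (hGi.norm.const_mul B).add (E.integrableOn_carrier (by fun_prop))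
  refine le_of_forall_pos_le_add fun η hη => ?_
  -- Replacing `w` by a smooth `g` with `|g - w| ≤ Kε` and `|∇g| ≤ K` makes `χ(φ - g)` an admissible
  -- test function; `KεJ` bounds the integrated error from the zeroth-order terms.
  obtain ⟨ε, hε, hεη⟩ : ∃ ε > 0, K * ε * J ≤ η := by
    refine ⟨η / (K * J + 1), by positivity, ?_⟩
    rw [mul_comm K, mul_assoc, div_mul_eq_mul_div, div_le_iff₀ (by positivity)]
    nlinarith
  obtain ⟨g, hgs, hgK, hgw, -⟩ := exists_smooth_approx hK hw hε
  have hgc := hgs.continuous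
  have hgg := continuous_gradient hgs
  set ψ : Plane → ℝ := fun x => χ x * (φ x - g x) with hψ
  have hψT : IsTest E.carrier ψ :=
    ⟨hχ.1.mul (hφ.sub hgs), hχ.2.1.mul_right, (tsupport_mul_subset_left).trans hχ.2.2⟩
  have hψg : ∀ x, gradient ψ x =
      χ x • (gradient φ x - gradient g x) + (φ x - g x) • gradient χ x := fun x => by
    have h1 := (hχ.1.differentiable (by simp) x).hasFDerivAt
    have h2 := (hφ.differentiable (by simp) x).hasFDerivAt
    have h3 := (hgs.differentiable (by simp) x).hasFDerivAt
    refine ext_inner_right ℝ fun e => ?_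
    have h4 : HasFDerivAt ψ _ x := h1.mul (h2.sub h3)
    rw [inner_gradient_left, h4.fderiv]
    simp [inner_add_left, inner_sub_left, real_inner_smul_left, inner_gradient_left]
  have hψ0 : ∫ x in E.carrier, (inner ℝ (G x) (gradient ψ x) + q x * ψ x) = 0 := by
    have hψgc := continuous_gradient hψT.1
    have hψc := hψT.1.continuous
    rw [integral_add (hinn _ hψgc) (E.integrableOn_carrier (by fun_prop)), hq ψ hψT]
    ring
  have hXi : Integrable X (volume.restrict E.carrier) :=
    (hinn _ (by fun_prop)).add (E.integrableOn_carrier (by fun_prop))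
  have hYi : Integrable (fun x => inner ℝ (G x) (gradient ψ x) + q x * ψ x)
      (volume.restrict E.carrier) := by
    have hψgc := continuous_gradient hψT.1
    have hψc := hψT.1.continuous
    exact (hinn _ hψgc).add (E.integrableOn_carrier (by fun_prop))
  rw [← sub_zero (∫ x in E.carrier, X x), ← hψ0, ← integral_sub hXi hYi, ← Real.norm_eq_abs]
  have hbd : ∀ x, ‖X x - (inner ℝ (G x) (gradient ψ x) + q x * ψ x)‖ ≤
      2 * K * ‖G x‖ + K * ε * (B * ‖G x‖ + 2 * |q x|) := fun x => by
    have e1 : X x - (inner ℝ (G x) (gradient ψ x) + q x * ψ x) =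
        inner ℝ (G x) (χ x • gradient g x) + (g x - w x) * (inner ℝ (G x) (gradient χ x) + χ x * q x)
        := by
      rw [hψg, hX]
      simp only [hψ, inner_add_right, real_inner_smul_right, inner_sub_right]
      ring
    rw [e1]
    refine (norm_add_le _ _).trans (add_le_add ?_ ?_)
    · refine (norm_inner_le_norm _ _).trans ?_
      rw [norm_smul, Real.norm_eq_abs, mul_comm]
      gcongr
      · exact hχ2 x
      · exact hgK x
    · rw [norm_mul, Real.norm_eq_abs]
      refine mul_le_mul (hgw x) ?_ (norm_nonneg _) (by positivity)
      refine (norm_add_le _ _).trans (add_le_add ?_ ?_)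
      · refine (norm_inner_le_norm _ _).trans ?_
        rw [mul_comm]
        gcongr
        exact hB x
      · rw [norm_mul, Real.norm_eq_abs, Real.norm_eq_abs]
        gcongr
        exact hχ2 x
  refine (norm_integral_le_of_norm_le
    ((hGi.norm.const_mul _).add (hiJ.const_mul _)) (ae_of_all _ hbd)).trans ?_
  rw [integral_add' (hGi.norm.const_mul _) (hiJ.const_mul _), integral_const_mul, integral_const_mul]
  exact add_le_add (mul_le_mul_of_nonneg_left (E.integral_norm_le hG) (by positivity)) hεη

/-- On `E` the gradient of the cut-off lives in the strip only, so Cauchy-Schwarz leaves the norm of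
`G` on the strip. This norm is the small factor; the first one, by the Poincaré inequality,
compensates `1/δ`. -/
theorem Polygon.abs_integral_strip_le {E : Polygon} {c : Plane} {L : ℝ} (hL : 0 < L)
    (hrad : ∀ x y, |E.radius c x - E.radius c y| ≤ L * ‖x - y‖) {G : Plane → Plane}
    (hG : MemLp G 2 (volume.restrict E.carrier)) {δ : ℝ} (hδ : 0 < δ) {χ : Plane → ℝ}
    (hχ : ∀ x, ‖gradient χ x‖ ≤ 2 * L / δ)
    (hχ1 : ∀ x ∈ E.carrier, x ∉ E.strip c δ → χ x = 1 ∧ gradient χ x = 0) {z : Plane → ℝ}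
    (hz : Continuous z) :
    |∫ x in E.carrier, z x * inner ℝ (G x) (gradient χ x)| ≤
      2 * L / δ * (√(∫ x in E.strip c δ, z x ^ 2) * √(normSq (E.strip c δ) G)) := by
  have hrc : Continuous (E.radius c) := continuous_of_abs_sub_le hL.le hrad
  have hsub : E.strip c δ ⊆ E.carrier := fun x hx => hx.1
  rw [setIntegral_eq_of_subset_of_forall_sdiff_eq_zero E.isOpen.measurableSet hsub fun x hx => by
    rw [(hχ1 x hx.1 hx.2).2, inner_zero_right, mul_zero]]
  have hGs : MemLp G 2 (volume.restrict (E.strip c δ)) :=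
    hG.mono_measure (Measure.restrict_mono hsub le_rfl)
  have hzs : MemLp z 2 (volume.restrict (E.strip c δ)) :=
    (E.memLp_of_continuous hz).mono_measure (Measure.restrict_mono hsub le_rfl)
  have h1 := (le_abs_self _).trans (abs_integral_mul_le_sqrt hzs.norm hGs.norm)
  simp only [Real.norm_eq_abs, sq_abs] at h1
  refine le_trans ?_ (mul_le_mul_of_nonneg_left h1 (by positivity))
  rw [← integral_const_mul, ← Real.norm_eq_abs]
  refine norm_integral_le_of_norm_le ((integrable_mul_of_memLp hzs.norm hGs.norm).const_mul _)
    (ae_of_all _ fun x => ?_)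
  rw [norm_mul, Real.norm_eq_abs]
  have h2 : ‖inner ℝ (G x) (gradient χ x)‖ ≤ ‖G x‖ * (2 * L / δ) :=
    (norm_inner_le_norm _ _).trans (mul_le_mul_of_nonneg_left (hχ x) (norm_nonneg _))
  calc |z x| * ‖inner ℝ (G x) (gradient χ x)‖ ≤ |z x| * (‖G x‖ * (2 * L / δ)) := by gcongr
    _ = _ := by ring

namespace Polygon.IsStar

variable {E : Polygon} {c : Plane} {r : ℝ} (hE : E.IsStar c r)
include hE

/-- The energy identity for `v - w`, where `w` is a Lipschitz function with the boundary values of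
`v`, up to the terms due to a cut-off near the boundary. -/
theorem abs_cutoff_limit_le {L : ℝ} (hL : 0 < L)
    (hrad : ∀ x y, |E.radius c x - E.radius c y| ≤ L * ‖x - y‖) {v : Plane → ℝ}
    (hv : MemLp v 2 (volume.restrict E.carrier)) {G : Plane → Plane}
    (hG : MemLp G 2 (volume.restrict E.carrier)) {φ : ℕ → Plane → ℝ} (hφ : ∀ n, ContDiff ℝ ∞ (φ n))
    (hφv : Tendsto (fun n => ∫ x in E.carrier, (φ n x - v x) ^ 2) atTop (𝓝 0))
    (hφG : Tendsto (fun n => normSq E.carrier fun x => gradient (φ n) x - G x) atTop (𝓝 0))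
    {w : Plane → ℝ} {K : ℝ} (hK : 0 ≤ K) (hw : ∀ x y, |w x - w y| ≤ K * ‖x - y‖)
    (hφw : ∀ i, Tendsto (fun n => ∫ t in Icc (0 : ℝ) 1, (φ n (E.edgePt i t) - w (E.edgePt i t)) ^ 2)
      atTop (𝓝 0))
    {q : Plane → ℝ} (hqc : Continuous q)
    (hq : ∀ φ, IsTest E.carrier φ →
      ∫ x in E.carrier, inner ℝ (G x) (gradient φ x) = -∫ x in E.carrier, q x * φ x)
    {δ : ℝ} (hδ : 0 < δ) (hδ1 : δ ≤ 1 / 4) {χ : Plane → ℝ} (hχT : IsTest E.carrier χ)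
    (hχ2 : ∀ x, |χ x| ≤ 2) (hχ : ∀ x, ‖gradient χ x‖ ≤ 2 * L / δ)
    (hχ1 : ∀ x ∈ E.carrier, x ∉ E.strip c δ → χ x = 1 ∧ gradient χ x = 0) :
    |(∫ x in E.carrier, inner ℝ (χ x • G x) (G x)) + ∫ x in E.carrier, q x * χ x * (v x - w x)| ≤
      2 * K * (2 * E.diam * √(normSq E.carrier G)) +
        2 * L * √(∑ i, (48 * E.diam ^ 2 * normSq E.carrier G +
          24 * |E.edgeDet c i| * (K * E.diam) ^ 2)) * √(normSq (E.strip c δ) G) := by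
  have hwc : Continuous w := continuous_of_abs_sub_le hK hw
  have hχc := hχT.1.continuous
  set N := normSq E.carrier G with hN
  have hN0 : 0 ≤ N := normSq_nonneg _ _
  set A := 2 * K * (2 * E.diam * √N) with hA
  set M : ℕ → ℝ := fun n => normSq E.carrier fun x => gradient (φ n) x - G x with hM
  set Z : E.Idx → ℕ → ℝ := fun i n =>
    ∫ t in Icc (0 : ℝ) 1, (φ n (E.edgePt i t) - w (E.edgePt i t)) ^ 2 with hZ
  set T : ℕ → ℝ := fun n => ∑ i, (6 * δ * |E.edgeDet c i| * Z i n +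
    24 * δ ^ 2 * E.diam ^ 2 * (2 * M n + 2 * N) + 24 * δ ^ 3 * |E.edgeDet c i| * (K * E.diam) ^ 2)
    with hT
  have hgφ : ∀ n, MemLp (gradient (φ n)) 2 (volume.restrict E.carrier) := fun n =>
    E.memLp_of_continuous (continuous_gradient (hφ n))
  have hMN : ∀ n, normSq E.carrier (gradient (φ n)) ≤ 2 * M n + 2 * N := fun n => by
    have i1 : Integrable (fun x => ‖gradient (φ n) x - G x‖ ^ 2) (volume.restrict E.carrier) :=
      ((hgφ n).sub hG).integrable_norm_pow two_ne_zero
    have i2 : Integrable (fun x => ‖G x‖ ^ 2) (volume.restrict E.carrier) :=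
      hG.integrable_norm_pow two_ne_zero
    simp only [hM, hN, normSq]
    rw [← integral_const_mul, ← integral_const_mul, ← integral_add (i1.const_mul _) (i2.const_mul _)]
    refine integral_mono_of_nonneg (ae_of_all _ fun x => by positivity)
      ((i1.const_mul _).add (i2.const_mul _)) (ae_of_all _ fun x => ?_)
    have h1 : ‖gradient (φ n) x‖ ≤ ‖gradient (φ n) x - G x‖ + ‖G x‖ := by
      simpa using norm_add_le (gradient (φ n) x - G x) (G x)
    have h2 := pow_le_pow_left₀ (norm_nonneg _) h1 2
    simp only
    nlinarith [sq_nonneg (‖gradient (φ n) x - G x‖ - ‖G x‖)]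
  have hstep : ∀ n, |(∫ x in E.carrier, inner ℝ (χ x • G x) (gradient (φ n) x)) +
      ∫ x in E.carrier, q x * χ x * (φ n x - w x)| ≤
      A + 2 * L / δ * (√(T n) * √(normSq (E.strip c δ) G)) := fun n => by
    have h1 := abs_cutoff_identity_le hG hqc hq hK hw hχT hχ2 (hφ n)
    have hφc := (hφ n).continuous
    have h2 := abs_integral_strip_le hL hrad hG hδ hχ hχ1 (z := fun x => φ n x - w x)
      (by fun_prop)
    have h3 : ∫ x in E.strip c δ, (φ n x - w x) ^ 2 ≤ T n := by
      refine (hE.integral_strip_sq_le hK hw (hφ n) hδ hδ1).trans (Finset.sum_le_sum fun i _ => ?_)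
      gcongr
      exact hMN n
    have h4 : 2 * L / δ * (√(∫ x in E.strip c δ, (φ n x - w x) ^ 2) * √(normSq (E.strip c δ) G)) ≤
        2 * L / δ * (√(T n) * √(normSq (E.strip c δ) G)) := by gcongr
    have h5 := abs_le.1 h1
    have h6 := abs_le.1 (h2.trans h4)
    rw [abs_le]
    constructor <;> linarith [h5.1, h5.2, h6.1, h6.2]
  have hTlim : Tendsto T atTop (𝓝 (∑ i : E.Idx, (6 * δ * |E.edgeDet c i| * 0 +
      24 * δ ^ 2 * E.diam ^ 2 * (2 * 0 + 2 * N) + 24 * δ ^ 3 * |E.edgeDet c i| * (K * E.diam) ^ 2))) :=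
    tendsto_finsetSum _ fun i _ => (((hφw i).const_mul _).add
      (((hφG.const_mul 2).add_const _).const_mul _)).add_const _
  -- Once the boundary mismatch has vanished in the limit, every remaining term carries `δ²` or
  -- `δ³`, so the root is of order `δ` and cancels the `1/δ` of the cut-off gradient.
  have hTle : √(∑ i : E.Idx, (6 * δ * |E.edgeDet c i| * 0 +
      24 * δ ^ 2 * E.diam ^ 2 * (2 * 0 + 2 * N) + 24 * δ ^ 3 * |E.edgeDet c i| * (K * E.diam) ^ 2)) ≤
      δ * √(∑ i, (48 * E.diam ^ 2 * N + 24 * |E.edgeDet c i| * (K * E.diam) ^ 2)) := by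
    rw [Real.sqrt_le_left (by positivity), mul_pow δ, Real.sq_sqrt (Finset.sum_nonneg fun i _ => by
      positivity), Finset.mul_sum]
    refine Finset.sum_le_sum fun i _ => ?_
    have h1 : δ ^ 3 ≤ δ ^ 2 := pow_le_pow_of_le_one hδ.le (by linarith) (by norm_num)
    have h2 : 0 ≤ |E.edgeDet c i| * (K * E.diam) ^ 2 := by positivity
    nlinarith [mul_le_mul_of_nonneg_right h1 h2]
  have hlim1 := tendsto_integral_inner (H := fun x => χ x • G x) (U := E.carrier) (G := G)
    (Φ := fun n => gradient (φ n)) ?_ hG hgφ hφG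
  · have hlim2 : Tendsto (fun n => ∫ x in E.carrier, q x * χ x * (φ n x - w x)) atTop
        (𝓝 (∫ x in E.carrier, q x * χ x * (v x - w x))) := by
      refine tendsto_integral_mul (p := fun x => q x * χ x) (f := fun n x => φ n x - w x)
        (E.memLp_of_continuous (by fun_prop)) (hv.sub (E.memLp_of_continuous hwc)) (fun n => ?_) ?_
      · have hφc := (hφ n).continuous
        exact E.memLp_of_continuous (by fun_prop)
      · simpa only [sub_sub_sub_cancel_right] using hφv
    refine (le_of_tendsto_of_tendsto' (hlim1.add hlim2).abs
      (((hTlim.sqrt.mul_const _).const_mul _).const_add _) hstep).trans ?_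
    refine add_le_add le_rfl ?_
    calc _ ≤ 2 * L / δ * ((δ * √(∑ i, (48 * E.diam ^ 2 * N +
          24 * |E.edgeDet c i| * (K * E.diam) ^ 2))) * √(normSq (E.strip c δ) G)) := by gcongr
      _ = _ := by
        generalize √(∑ i, (48 * E.diam ^ 2 * N + 24 * |E.edgeDet c i| * (K * E.diam) ^ 2)) = R
        field_simp
  · refine hG.of_le_mul (c := 2) (hχc.aestronglyMeasurable.smul hG.aestronglyMeasurable)
      (ae_of_all _ fun x => ?_)
    rw [norm_smul, Real.norm_eq_abs]
    gcongr
    exact hχ2 x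

/-- The energy identity for `v - w`, where `w` is a Lipschitz function with the boundary values of
`v`. -/
theorem abs_normSq_add_le {L : ℝ} (hL : 0 < L)
    (hrad : ∀ x y, |E.radius c x - E.radius c y| ≤ L * ‖x - y‖) {v : Plane → ℝ}
    (hv : MemLp v 2 (volume.restrict E.carrier)) {G : Plane → Plane}
    (hG : MemLp G 2 (volume.restrict E.carrier)) {φ : ℕ → Plane → ℝ} (hφ : ∀ n, ContDiff ℝ ∞ (φ n))
    (hφv : Tendsto (fun n => ∫ x in E.carrier, (φ n x - v x) ^ 2) atTop (𝓝 0))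
    (hφG : Tendsto (fun n => normSq E.carrier fun x => gradient (φ n) x - G x) atTop (𝓝 0))
    {w : Plane → ℝ} {K : ℝ} (hK : 0 ≤ K) (hw : ∀ x y, |w x - w y| ≤ K * ‖x - y‖)
    (hφw : ∀ i, Tendsto (fun n => ∫ t in Icc (0 : ℝ) 1, (φ n (E.edgePt i t) - w (E.edgePt i t)) ^ 2)
      atTop (𝓝 0))
    {q : Plane → ℝ} (hqc : Continuous q)
    (hq : ∀ φ, IsTest E.carrier φ →
      ∫ x in E.carrier, inner ℝ (G x) (gradient φ x) = -∫ x in E.carrier, q x * φ x) :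
    |normSq E.carrier G + ∫ x in E.carrier, q x * (v x - w x)| ≤
      2 * K * (2 * E.diam * √(normSq E.carrier G)) := by
  have hwc : Continuous w := continuous_of_abs_sub_le hK hw
  have hrc : Continuous (E.radius c) := continuous_of_abs_sub_le hL.le hrad
  set δ : ℕ → ℝ := fun k => 1 / ((k : ℝ) + 4) with hδ
  have hδ0 : ∀ k, 0 < δ k := fun k => by simp only [hδ]; positivity
  have hδ1 : ∀ k, δ k ≤ 1 / 4 := fun k =>
    one_div_le_one_div_of_le (by norm_num) (by linarith [k.cast_nonneg (α := ℝ)])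
  have hδlim : Tendsto δ atTop (𝓝 0) := by
    have := tendsto_one_div_add_atTop_nhds_zero_nat (𝕜 := ℝ)
    refine squeeze_zero (fun k => (hδ0 k).le) (fun k => ?_) this
    exact one_div_le_one_div_of_le (by positivity) (by linarith)
  choose χ hχT hχ2 hχ hχ1 using fun k => hE.exists_cutoff hL hrad (hδ0 k)
  -- Every point of the open set `E` eventually leaves the strips, which gives the pointwise
  -- convergence in the three dominated convergence arguments below.
  have hev : ∀ x ∈ E.carrier, ∀ᶠ k in atTop, x ∉ E.strip c (δ k) := fun x hx => by
    have h1 : 0 < (1 - E.radius c x) / 2 := by linarith [hE.radius_lt_one_iff.2 hx]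
    filter_upwards [(tendsto_order.1 hδlim).2 _ h1] with k hk hxs
    linarith [hxs.2]
  have hmE := E.isOpen.measurableSet
  have hG2 : Integrable (fun x => ‖G x‖ ^ 2) (volume.restrict E.carrier) :=
    hG.integrable_norm_pow two_ne_zero
  have hlim1 : Tendsto (fun k => ∫ x in E.carrier, inner ℝ (χ k x • G x) (G x)) atTop
      (𝓝 (normSq E.carrier G)) := by
    refine tendsto_integral_of_dominated_convergence (fun x => 2 * ‖G x‖ ^ 2) (fun k => ?_)
      (hG2.const_mul 2) (fun k => ae_of_all _ fun x => ?_) ?_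
    · exact (((hχT k).1.continuous.aestronglyMeasurable).smul hG.aestronglyMeasurable).inner
        hG.aestronglyMeasurable
    · rw [real_inner_smul_left, real_inner_self_eq_norm_sq, norm_mul, Real.norm_eq_abs,
        Real.norm_of_nonneg (sq_nonneg _)]
      gcongr
      exact hχ2 k x
    · filter_upwards [ae_restrict_mem hmE] with x hx
      refine tendsto_const_nhds.congr' ?_
      filter_upwards [hev x hx] with k hk
      rw [(hχ1 k x hx hk).1, one_smul, real_inner_self_eq_norm_sq]
  have hqvw : Integrable (fun x => q x * (v x - w x)) (volume.restrict E.carrier) :=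
    integrable_mul_of_memLp (E.memLp_of_continuous hqc) (hv.sub (E.memLp_of_continuous hwc))
  have hlim2 : Tendsto (fun k => ∫ x in E.carrier, q x * χ k x * (v x - w x)) atTop
      (𝓝 (∫ x in E.carrier, q x * (v x - w x))) := by
    refine tendsto_integral_of_dominated_convergence (fun x => 2 * ‖q x * (v x - w x)‖) (fun k => ?_)
      (hqvw.norm.const_mul 2) (fun k => ae_of_all _ fun x => ?_) ?_
    · exact ((hqc.mul (hχT k).1.continuous).aestronglyMeasurable).mul
        (hv.aestronglyMeasurable.sub hwc.aestronglyMeasurable)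
    · rw [mul_right_comm, norm_mul, mul_comm]
      gcongr
      exact hχ2 k x
    · filter_upwards [ae_restrict_mem hmE] with x hx
      refine tendsto_const_nhds.congr' ?_
      filter_upwards [hev x hx] with k hk
      rw [(hχ1 k x hx hk).1, mul_one]
  have hlim3 : Tendsto (fun k => normSq (E.strip c (δ k)) G) atTop (𝓝 0) := by
    have hms : ∀ k, MeasurableSet (E.strip c (δ k)) := fun k =>
      hmE.inter (isOpen_lt continuous_const hrc).measurableSet
    have h1 : ∀ k, normSq (E.strip c (δ k)) G =
        ∫ x in E.carrier, (E.strip c (δ k)).indicator (fun x => ‖G x‖ ^ 2) x := fun k => by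
      rw [setIntegral_indicator (hms k), inter_eq_right.2 fun x hx => hx.1]
      rfl
    simp_rw [h1]
    rw [← integral_zero Plane ℝ (μ := volume.restrict E.carrier)]
    refine tendsto_integral_of_dominated_convergence (fun x => ‖G x‖ ^ 2) (fun k => ?_)
      hG2 (fun k => ae_of_all _ fun x => ?_) ?_
    · exact hG2.aestronglyMeasurable.indicator (hms k)
    · refine (norm_indicator_le_norm_self _ _).trans_eq ?_
      rw [Real.norm_of_nonneg (sq_nonneg _)]
    · filter_upwards [ae_restrict_mem hmE] with x hx
      refine tendsto_const_nhds.congr' ?_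
      filter_upwards [hev x hx] with k hk
      rw [indicator_of_notMem hk]
  have hfin := le_of_tendsto_of_tendsto' (hlim1.add hlim2).abs
    ((hlim3.sqrt.const_mul (2 * L * √(∑ i, (48 * E.diam ^ 2 * normSq E.carrier G +
          24 * |E.edgeDet c i| * (K * E.diam) ^ 2)))).const_add
            (2 * K * (2 * E.diam * √(normSq E.carrier G)))) fun k =>
    hE.abs_cutoff_limit_le hL hrad hv hG hφ hφv hφG hK hw hφw hqc hq (hδ0 k) (hδ1 k) (hχT k)
      (hχ2 k) (hχ k) (hχ1 k)
  simpa using hfin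

end Polygon.IsStar

/-- The gradient of a function with polynomial Laplacian, orthogonal to the polynomials, is bounded
by its boundary values. -/
theorem exists_sqrt_normSq_le (ℓ : ℕ) {ρ : ℝ} (hρ : 0 < ρ) : ∃ C, 0 ≤ C ∧
    ∀ (E : Polygon) (c : Plane), E.IsStar c (ρ * E.diam) → (∀ i, ρ * E.diam ≤ E.edgeLength i) →
      ∀ v : Plane → ℝ, MemLp v 2 (volume.restrict E.carrier) →
      ∀ G : Plane → Plane, MemLp G 2 (volume.restrict E.carrier) →
      ∀ φ : ℕ → Plane → ℝ, (∀ n, ContDiff ℝ ∞ (φ n)) →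
      Tendsto (fun n => ∫ x in E.carrier, (φ n x - v x) ^ 2) atTop (𝓝 0) →
      Tendsto (fun n => normSq E.carrier fun x => gradient (φ n) x - G x) atTop (𝓝 0) →
      ∀ γ : Plane → ℝ,
      (∀ i, Tendsto (fun n => ∫ t in Icc (0 : ℝ) 1, (φ n (E.edgePt i t) - γ (E.edgePt i t)) ^ 2)
        atTop (𝓝 0)) →
      ∀ q ∈ polyLE ℓ, (∀ φ, IsTest E.carrier φ →
        ∫ x in E.carrier, inner ℝ (G x) (gradient φ x) = -∫ x in E.carrier, polyFun q x * φ x) →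
      ∫ x in E.carrier, polyFun q x * v x = 0 →
      ∀ S : ℝ, (∀ i, ∀ t ∈ Icc (0 : ℝ) 1, |γ (E.edgePt i t)| ≤ S) →
      (∀ i, ∀ t ∈ Icc (0 : ℝ) 1, ∀ t' ∈ Icc (0 : ℝ) 1,
        |γ (E.edgePt i t) - γ (E.edgePt i t')| ≤ S * |t - t'|) →
      √(normSq E.carrier G) ≤ C * S := by
  obtain ⟨Q, hQ0, hQ⟩ := exists_abs_polyFun_le ℓ hρ
  -- With `d = (ρh)²` the Lipschitz constant of `w` is `K = 5S·h/d`, so `4Kh = 20S/ρ²`. The term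
  -- `4Q` is `Q/h²` times the area bound `(2h)²`.
  refine ⟨20 / ρ ^ 2 + 4 * Q, by positivity, ?_⟩
  intro E c hE hedge v hv G hG φ hφ hφv hφG γ hγ q hqℓ hq hqv S hS hSL
  have hh := E.diam_pos
  have hS0 : 0 ≤ S := (abs_nonneg _).trans (hS 0 0 (by simp))
  set h := E.diam with hh'
  -- Distance from the centre to the line of an edge times the edge length, each at least `ρh`.
  set d := (ρ * h) * (ρ * h) with hd'
  have hd : 0 < d := by positivity
  have hdet : ∀ i, d ≤ |E.edgeDet c i| := fun i =>
    (mul_le_mul_of_nonneg_left (hedge i) (by positivity)).trans (hE.le_abs_edgeDet i)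
  set w := E.radialExt c γ with hw'
  set K := (2 * S + 3 * S) * (h / d) with hK'
  have hK : 0 ≤ K := by positivity
  have hw : ∀ x y, |w x - w y| ≤ K * ‖x - y‖ := hE.abs_radialExt_sub_le hd hdet hS0 hS hSL
  have hrad := hE.abs_radius_sub_le hd hdet
  have hwc : Continuous w := continuous_of_abs_sub_le hK hw
  have hqc := continuous_polyFun q
  have hmain := hE.abs_normSq_add_le (L := 2 * (h / d)) (by positivity) hrad hv hG hφ hφv hφG hK hw
    (fun i => by
      refine (hγ i).congr fun n => setIntegral_congr_fun measurableSet_Icc fun t ht => ?_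
      simp only [hw', hE.radialExt_edgePt γ i ht]) hqc hq
  set N := normSq E.carrier G with hN
  have hN0 : 0 ≤ N := normSq_nonneg _ _
  have hqw : |∫ x in E.carrier, polyFun q x * w x| ≤ 4 * Q * S * √N := by
    have h1 : ∀ x ∈ E.carrier, ‖polyFun q x * w x‖ ≤ Q / h ^ 2 * √N * S := fun x hx => by
      rw [norm_mul]
      exact mul_le_mul (hQ E c hE G hG q hqℓ hq x hx) (hE.abs_radialExt_le hS hx) (norm_nonneg _)
        (by positivity)
    have h2 := norm_setIntegral_le_of_norm_le_const (μ := volume) E.isBounded.measure_lt_top h1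
    rw [Real.norm_eq_abs] at h2
    refine h2.trans ?_
    calc Q / h ^ 2 * √N * S * volume.real E.carrier ≤ Q / h ^ 2 * √N * S * (2 * h) ^ 2 := by
          gcongr
          exact E.area_le
      _ = _ := by field_simp; ring
  -- Orthogonality of `v` to its own Laplacian removes `v`, for which no bound is available, and
  -- leaves the bounded function `w`.
  have hsplit : ∫ x in E.carrier, polyFun q x * (v x - w x) =
      -∫ x in E.carrier, polyFun q x * w x := by
    simp_rw [mul_sub]
    rw [integral_sub (integrable_mul_of_memLp (memLp_polyFun E q) hv)
      (integrable_mul_of_memLp (memLp_polyFun E q) (E.memLp_of_continuous hwc)), hqv, zero_sub]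
  rw [hsplit] at hmain
  have hKh : K * h = 5 * S / ρ ^ 2 := by
    rw [hK', hd']; field_simp; ring
  have h3 : N ≤ (20 / ρ ^ 2 + 4 * Q) * S * √N := by
    have h4 := (abs_le.1 hmain).2
    have h5 := (abs_le.1 hqw).2
    have h6 : 2 * K * (2 * h * √N) = 4 * (K * h) * √N := by ring
    rw [h6, hKh] at h4
    have h7 : (20 / ρ ^ 2 + 4 * Q) * S * √N = 4 * (5 * S / ρ ^ 2) * √N + 4 * Q * S * √N := by ring
    linarith
  rcases hN0.eq_or_lt with h0 | h0
  · rw [← h0, Real.sqrt_zero]; positivity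
  · have h8 : 0 < √N := Real.sqrt_pos.2 h0
    have h9 : √N * √N ≤ (20 / ρ ^ 2 + 4 * Q) * S * √N := by rwa [Real.mul_self_sqrt hN0]
    exact le_of_mul_le_mul_right h9 h8

/-! ### Weak gradients -/

theorem inner_single (a : Plane) (i : Fin 2) : inner ℝ a (EuclideanSpace.single i 1) = a i := by
  simp [EuclideanSpace.inner_single_right]

theorem memLp_apply {U : Set Plane} {F : Plane → Plane} (hF : MemLp F 2 (volume.restrict U))
    (i : Fin 2) : MemLp (fun x => F x i) 2 (volume.restrict U) := by
  simpa only [inner_single] using hF.inner_const (𝕜 := ℝ) (EuclideanSpace.single i (1 : ℝ))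

theorem IsTest.mono {U V : Set Plane} (hUV : U ⊆ V) {φ : Plane → ℝ} (h : IsTest U φ) : IsTest V φ :=
  ⟨h.1, h.2.1, h.2.2.trans hUV⟩

theorem IsTest.memLp {U : Set Plane} {φ : Plane → ℝ} (h : IsTest U φ) :
    MemLp φ 2 (volume.restrict U) :=
  (h.1.continuous.memLp_of_hasCompactSupport h.2.1).restrict U

theorem IsTest.fderiv_apply {U : Set Plane} {φ : Plane → ℝ} (h : IsTest U φ) (e : Plane) :
    IsTest U fun x => fderiv ℝ φ x e := by
  refine ⟨(h.1.fderiv_right (m := ∞) (by simp)).clm_apply contDiff_const, h.2.1.fderiv_apply ℝ e, ?_⟩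
  exact (tsupport_fderiv_apply_subset ℝ e).trans h.2.2

theorem weakGrad_spec {U : Set Plane} {v : Plane → ℝ} (h : MemH1 U v) :
    IsWeakGradient U v (weakGrad U v) := by
  rw [weakGrad, dif_pos h.2]
  exact h.2.choose_spec

namespace IsWeakGradient

variable {U V : Set Plane} {v w : Plane → ℝ} {G H : Plane → Plane}

theorem mono (hV : MeasurableSet V) (hUV : U ⊆ V) (h : IsWeakGradient V v G) :
    IsWeakGradient U v G := by
  refine ⟨h.1.mono_measure (Measure.restrict_mono hUV le_rfl), fun φ hφ e => ?_⟩
  rw [← setIntegral_eq_of_subset_of_forall_sdiff_eq_zero hV hUV fun x hx => by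
      rw [(hφ.fderiv_apply e).eq_zero hx.2, mul_zero],
    ← setIntegral_eq_of_subset_of_forall_sdiff_eq_zero hV hUV fun x hx => by
      rw [hφ.eq_zero hx.2, mul_zero]]
  exact h.2 φ (hφ.mono hUV) e

theorem integrable_inner_mul (h : MemLp G 2 (volume.restrict U)) {φ : Plane → ℝ} (hφ : IsTest U φ)
    (e : Plane) : Integrable (fun x => inner ℝ (G x) e * φ x) (volume.restrict U) :=
  integrable_mul_of_memLp (h.inner_const e) hφ.memLp

theorem sub (hv : MemLp v 2 (volume.restrict U)) (hw : MemLp w 2 (volume.restrict U))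
    (hG : IsWeakGradient U v G) (hH : IsWeakGradient U w H) :
    IsWeakGradient U (fun x => v x - w x) fun x => G x - H x := by
  refine ⟨hG.1.sub hH.1, fun φ hφ e => ?_⟩
  simp_rw [inner_sub_left, sub_mul]
  rw [integral_sub (integrable_mul_of_memLp hv (hφ.fderiv_apply e).memLp)
      (integrable_mul_of_memLp hw (hφ.fderiv_apply e).memLp),
    integral_sub (integrable_inner_mul hG.1 hφ e) (integrable_inner_mul hH.1 hφ e),
    hG.2 φ hφ e, hH.2 φ hφ e]
  ring

/-- Weak gradients are unique almost everywhere. -/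
theorem ae_eq (hU : IsOpen U) (hG : IsWeakGradient U v G) (hH : IsWeakGradient U v H) :
    G =ᵐ[volume.restrict U] H := by
  have key : ∀ e : Plane, ∀ᵐ x ∂volume.restrict U, inner ℝ (G x) e - inner ℝ (H x) e = 0 := by
    intro e
    rw [ae_restrict_iff' hU.measurableSet]
    refine hU.ae_eq_zero_of_integral_contDiff_smul_eq_zero
      (locallyIntegrableOn_of_locallyIntegrable_restrict
        (((hG.1.inner_const e).sub (hH.1.inner_const e)).locallyIntegrable (by norm_num))) ?_
    intro φ h1 h2 h3
    have hφ : IsTest U φ := ⟨h1, h2, h3⟩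
    rw [← setIntegral_eq_integral_of_forall_compl_eq_zero (s := U) fun x hx => by
      rw [hφ.eq_zero hx, zero_smul]]
    simp only [smul_eq_mul, mul_comm (φ _), sub_mul]
    rw [integral_sub (integrable_inner_mul hG.1 hφ e) (integrable_inner_mul hH.1 hφ e)]
    linarith [hG.2 φ hφ e, hH.2 φ hφ e]
  have hall : ∀ᵐ x ∂volume.restrict U, ∀ i : Fin 2,
      inner ℝ (G x) (EuclideanSpace.single i 1) - inner ℝ (H x) (EuclideanSpace.single i (1 : ℝ)) = 0 :=
    ae_all_iff.2 fun i => key _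
  filter_upwards [hall] with x hx
  ext i
  simpa only [inner_single, sub_eq_zero] using hx i

end IsWeakGradient

/-- The gradient of a smooth function is its weak gradient. -/
theorem isWeakGradient_gradient (E : Polygon) {f : Plane → ℝ} (hf : ContDiff ℝ ∞ f) :
    IsWeakGradient E.carrier f (gradient f) := by
  refine ⟨E.memLp_of_continuous (continuous_gradient hf), fun φ hφ e => ?_⟩
  have hφ' := hφ.fderiv_apply e
  have hf' : Continuous fun x => fderiv ℝ f x e :=
    (hf.continuous_fderiv (by simp)).clm_apply continuous_const
  rw [setIntegral_eq_integral_of_forall_compl_eq_zero fun x hx => by rw [hφ'.eq_zero hx, mul_zero],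
    setIntegral_eq_integral_of_forall_compl_eq_zero fun x hx => by rw [hφ.eq_zero hx, mul_zero]]
  simp_rw [inner_gradient_left]
  exact integral_mul_fderiv_eq_neg_fderiv_mul_of_integrable
    ((hf'.mul hφ.1.continuous).integrable_of_hasCompactSupport hφ.2.1.mul_left)
    ((hf.continuous.mul hφ'.1.continuous).integrable_of_hasCompactSupport hφ'.2.1.mul_left)
    ((hf.continuous.mul hφ.1.continuous).integrable_of_hasCompactSupport hφ.2.1.mul_left)
    (fun x _ => hf.differentiable (by simp) x) (fun x _ => hφ.1.differentiable (by simp) x)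

theorem isWeakGradient_polyFun (E : Polygon) (p : MvPolynomial (Fin 2) ℝ) :
    IsWeakGradient E.carrier (polyFun p) (vpolyFun (gradPoly p)) := by
  have := isWeakGradient_gradient E (contDiff_polyFun p)
  rwa [show gradient (polyFun p) = vpolyFun (gradPoly p) from funext (gradient_polyFun p)] at this

theorem integral_inner_gradient {U : Set Plane} {F : Plane → Plane}
    (hF : MemLp F 2 (volume.restrict U)) {φ : Plane → ℝ} (hφ : IsTest U φ) :
    ∫ x in U, inner ℝ (F x) (gradient φ x) =
      ∑ i, ∫ x in U, F x i * fderiv ℝ φ x (EuclideanSpace.single i 1) := by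
  rw [← integral_finsetSum]
  · refine integral_congr_ae (ae_of_all _ fun x => ?_)
    simp only [PiLp.inner_apply]
    refine Finset.sum_congr rfl fun i _ => ?_
    rw [← inner_gradient_left, inner_single]
    simp [mul_comm]
  · intro i _
    exact integrable_mul_of_memLp (memLp_apply hF i)
      (hφ.fderiv_apply _).memLp

/-- The weak divergence of the gradient of a polynomial. -/
theorem integral_inner_gradPoly (E : Polygon) (p : MvPolynomial (Fin 2) ℝ) {φ : Plane → ℝ}
    (hφ : IsTest E.carrier φ) :
    ∫ x in E.carrier, inner ℝ (vpolyFun (gradPoly p) x) (gradient φ x) =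
      -∫ x in E.carrier, polyFun (divPoly (gradPoly p)) x * φ x := by
  rw [integral_inner_gradient (E.memLp_of_continuous (continuous_vpolyFun _)) hφ]
  have h1 : ∀ x, polyFun (divPoly (gradPoly p)) x * φ x = ∑ i,
      inner ℝ (vpolyFun (gradPoly (gradPoly p i)) x) (EuclideanSpace.single i 1) * φ x := fun x => by
    simp only [← Finset.sum_mul, inner_single]
    simp [divPoly, vpolyFun, polyFun, gradPoly]
  simp_rw [h1]
  rw [integral_finsetSum _ fun i _ => IsWeakGradient.integrable_inner_mul
    (E.memLp_of_continuous (continuous_vpolyFun _)) hφ _, ← Finset.sum_neg_distrib]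
  exact Finset.sum_congr rfl fun i _ => (isWeakGradient_polyFun E (gradPoly p i)).2 φ hφ _

/-- A distributional Laplacian is the weak divergence of the weak gradient. -/
theorem integral_inner_of_laplacian {U : Set Plane} {v q : Plane → ℝ} {G : Plane → Plane}
    (hv : MemLp v 2 (volume.restrict U)) (hG : IsWeakGradient U v G)
    (hq : ∀ φ, IsTest U φ →
      ∫ x in U, v x * Laplacian.laplacian φ x = ∫ x in U, q x * φ x)
    {φ : Plane → ℝ} (hφ : IsTest U φ) :
    ∫ x in U, inner ℝ (G x) (gradient φ x) = -∫ x in U, q x * φ x := by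
  have hlap : ∀ x, Laplacian.laplacian φ x = ∑ i : Fin 2,
      fderiv ℝ (fun y => fderiv ℝ φ y (EuclideanSpace.single i 1)) x (EuclideanSpace.single i 1) := by
    intro x
    have h1 : DifferentiableAt ℝ (fderiv ℝ φ) x :=
      (hφ.1.fderiv_right (m := ∞) (by simp)).differentiable (by simp) x
    rw [InnerProductSpace.laplacian_eq_iteratedFDeriv_orthonormalBasis φ
      (EuclideanSpace.basisFun (Fin 2) ℝ)]
    simp [iteratedFDeriv_two_apply, fderiv_clm_apply h1 (differentiableAt_const _)]
  rw [← hq φ hφ, integral_inner_gradient hG.1 hφ]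
  simp_rw [hlap, Finset.mul_sum]
  rw [integral_finsetSum _ fun i _ => integrable_mul_of_memLp hv
    ((hφ.fderiv_apply _).fderiv_apply _).memLp, ← Finset.sum_neg_distrib]
  refine Finset.sum_congr rfl fun i _ => ?_
  -- The partial derivative of a test function is itself a test function, so the definition of the
  -- weak gradient applies to it.
  rw [hG.2 _ (hφ.fderiv_apply (EuclideanSpace.single i 1)), neg_neg]
  simp only [inner_single]

/-! ### Polynomial best approximation -/

theorem isL2Proj_l2Proj (E : Polygon) (k : ℕ) {w : Plane → ℝ}
    (hw : MemLp w 2 (volume.restrict E.carrier)) : IsL2Proj E k w (l2Proj E k w) := by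
  have h := (existsUnique_isL2Proj E k hw).exists
  rw [l2Proj, dif_pos h]
  exact h.choose_spec

/-- Pythagoras: `𝒫w - w` is orthogonal to the polynomial `r - 𝒫w`. -/
theorem integral_l2Proj_sub_sq_le (E : Polygon) (k : ℕ) {w : Plane → ℝ}
    (hw : MemLp w 2 (volume.restrict E.carrier)) {r : MvPolynomial (Fin 2) ℝ} (hr : r ∈ polyLE k) :
    ∫ x in E.carrier, (polyFun (l2Proj E k w) x - w x) ^ 2 ≤
      ∫ x in E.carrier, (polyFun r x - w x) ^ 2 := by
  obtain ⟨hp, hpq⟩ := isL2Proj_l2Proj E k hw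
  set p := l2Proj E k w
  have hs : r - p ∈ polyLE k := sub_mem hr hp
  have hps := memLp_polyFun E p
  have hss := memLp_polyFun E (r - p)
  have h0 : ∫ x in E.carrier, 2 * ((polyFun p x - w x) * polyFun (r - p) x) = 0 := by
    simp_rw [integral_const_mul, sub_mul]
    rw [integral_sub (integrable_mul_of_memLp hps hss) (integrable_mul_of_memLp hw hss),
      hpq _ hs, sub_self, mul_zero]
  have h1 : ∀ x, (polyFun r x - w x) ^ 2 = (polyFun p x - w x) ^ 2 +
      2 * ((polyFun p x - w x) * polyFun (r - p) x) + polyFun (r - p) x ^ 2 := fun x => by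
    simp only [polyFun, map_sub]
    ring
  have i1 : Integrable (fun x => (polyFun p x - w x) ^ 2) (volume.restrict E.carrier) :=
    (hps.sub hw).integrable_sq
  have i2 : Integrable (fun x => 2 * ((polyFun p x - w x) * polyFun (r - p) x))
      (volume.restrict E.carrier) := (integrable_mul_of_memLp (hps.sub hw) hss).const_mul 2
  have i3 : Integrable (fun x => polyFun (r - p) x ^ 2) (volume.restrict E.carrier) :=
    hss.integrable_sq
  simp_rw [h1]
  have i4 := integral_add (i1.add i2) i3
  simp only [Pi.add_apply] at i4
  rw [i4, integral_add i1 i2, h0]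
  have i5 : 0 ≤ ∫ x in E.carrier, polyFun (r - p) x ^ 2 := integral_nonneg fun x => sq_nonneg _
  linarith

/-- Used with two competitors: the gradient of `𝒫_ℓ u_h` when projecting `∇u_h`, and the projected
flux of `∇u` when projecting the discrete flux. -/
theorem normSq_l2ProjV_sub_le (E : Polygon) (k : ℕ) {F : Plane → Plane}
    (hF : MemLp F 2 (volume.restrict E.carrier)) {r : Fin 2 → MvPolynomial (Fin 2) ℝ}
    (hr : ∀ i, r i ∈ polyLE k) :
    normSq E.carrier (fun x => vpolyFun (l2ProjV E k F) x - F x) ≤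
      normSq E.carrier fun x => vpolyFun r x - F x := by
  have hFi := memLp_apply hF
  have hsum : ∀ s : Fin 2 → MvPolynomial (Fin 2) ℝ,
      normSq E.carrier (fun x => vpolyFun s x - F x) =
        ∑ i, ∫ x in E.carrier, (polyFun (s i) x - F x i) ^ 2 := fun s => by
    have hi : ∀ i, Integrable (fun x => (polyFun (s i) x - F x i) ^ 2) (volume.restrict E.carrier) :=
      fun i => ((memLp_polyFun E (s i)).sub (hFi i)).integrable_sq
    rw [← integral_finsetSum _ fun i _ => hi i]
    refine integral_congr_ae (ae_of_all _ fun x => ?_)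
    simp only [EuclideanSpace.norm_sq_eq, Real.norm_eq_abs, sq_abs]
    rfl
  rw [hsum, hsum]
  exact Finset.sum_le_sum fun i _ => integral_l2Proj_sub_sq_le E k (hFi i) (hr i)

/-! ### Traces -/

theorem continuousOn_edge {E : Polygon} {γ : Plane → ℝ} (hγ : ContinuousOn γ (frontier E.carrier))
    (i : E.Idx) : ContinuousOn (fun t => γ (E.edgePt i t)) (Icc 0 1) :=
  hγ.comp (Polygon.continuous_edgePt i).continuousOn fun _ ht => Polygon.edgePt_mem_frontier i ht

theorem memLp_of_continuousOn_Icc {a b : ℝ} {g : ℝ → ℝ} (hg : ContinuousOn g (Icc a b)) :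
    MemLp g 2 (volume.restrict (Icc a b)) := by
  obtain ⟨C, hC⟩ := isCompact_Icc.exists_bound_of_continuousOn hg
  refine MemLp.of_bound (hg.aestronglyMeasurable measurableSet_Icc) C ?_
  filter_upwards [ae_restrict_mem measurableSet_Icc] with x hx
  exact hC x hx

theorem tendsto_integral_edge_sq {E : Polygon} {γ : Plane → ℝ}
    (hγ : ContinuousOn γ (frontier E.carrier)) {φ : ℕ → Plane → ℝ} (hφ : ∀ n, ContDiff ℝ ∞ (φ n))
    {i : E.Idx} (h : Tendsto (fun n => eLpNorm (fun t => φ n (E.edgePt i t) - γ (E.edgePt i t)) 2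
      (volume.restrict (Icc (0 : ℝ) 1))) atTop (𝓝 0)) :
    Tendsto (fun n => ∫ t in Icc (0 : ℝ) 1, (φ n (E.edgePt i t) - γ (E.edgePt i t)) ^ 2) atTop
      (𝓝 0) := by
  have := tendsto_integral_norm_sq (fun n => memLp_of_continuousOn_Icc
    (((hφ n).continuous.comp (Polygon.continuous_edgePt i)).continuousOn.sub
      (continuousOn_edge hγ i))) h
  simpa only [Real.norm_eq_abs, sq_abs, Pi.sub_apply, Function.comp_apply] using this

theorem TendstoH1.tendsto_integral_sq {E : Polygon} {φ : ℕ → Plane → ℝ} {v : Plane → ℝ}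
    (h : TendstoH1 E.carrier φ v) (hφ : ∀ n, ContDiff ℝ ∞ (φ n)) (hv : MemH1 E.carrier v) :
    Tendsto (fun n => ∫ x in E.carrier, (φ n x - v x) ^ 2) atTop (𝓝 0) := by
  have := tendsto_integral_norm_sq (fun n => (E.memLp_of_continuous (hφ n).continuous).sub hv.1) h.1
  simpa only [Real.norm_eq_abs, sq_abs, Pi.sub_apply] using this

theorem TendstoH1.tendsto_normSq {E : Polygon} {φ : ℕ → Plane → ℝ} {v : Plane → ℝ}
    (h : TendstoH1 E.carrier φ v) (hφ : ∀ n, ContDiff ℝ ∞ (φ n)) (hv : MemH1 E.carrier v) :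
    Tendsto (fun n => normSq E.carrier fun x => gradient (φ n) x - weakGrad E.carrier v x) atTop
      (𝓝 0) :=
  tendsto_integral_norm_sq (fun n => (E.memLp_of_continuous (continuous_gradient (hφ n))).sub
    (weakGrad_spec hv).1) h.2

theorem gradient_sub {f g : Plane → ℝ} (hf : ContDiff ℝ ∞ f) (hg : ContDiff ℝ ∞ g) (x : Plane) :
    gradient (fun y => f y - g y) x = gradient f x - gradient g x := by
  refine ext_inner_right ℝ fun e => ?_
  rw [inner_sub_left, inner_gradient_left, inner_gradient_left, inner_gradient_left,
    fderiv_fun_sub (hf.differentiable (by simp) x) (hg.differentiable (by simp) x)]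
  rfl

theorem norm_sub_sub_sq_le {V : Type*} [NormedAddCommGroup V] (a b c : V) :
    ‖a - b‖ ^ 2 ≤ 2 * ‖a - c‖ ^ 2 + 2 * ‖b - c‖ ^ 2 := by
  have h1 : ‖a - b‖ ≤ ‖a - c‖ + ‖b - c‖ := by
    simpa [norm_sub_rev c b] using norm_sub_le_norm_sub_add_norm_sub a c b
  nlinarith [norm_nonneg (a - b), sq_nonneg (‖a - c‖ - ‖b - c‖)]

theorem integral_norm_sub_sq_le {α V : Type*} {_ : MeasurableSpace α} [NormedAddCommGroup V]
    {ν : Measure α} {f g h : α → V} (hf : MemLp f 2 ν) (hg : MemLp g 2 ν) (hh : MemLp h 2 ν) :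
    ∫ x, ‖f x - g x‖ ^ 2 ∂ν ≤ 2 * ∫ x, ‖f x - h x‖ ^ 2 ∂ν + 2 * ∫ x, ‖g x - h x‖ ^ 2 ∂ν := by
  have i1 : Integrable (fun x => ‖f x - h x‖ ^ 2) ν := (hf.sub hh).integrable_norm_pow two_ne_zero
  have i2 : Integrable (fun x => ‖g x - h x‖ ^ 2) ν := (hg.sub hh).integrable_norm_pow two_ne_zero
  rw [← integral_const_mul, ← integral_const_mul, ← integral_add (i1.const_mul _) (i2.const_mul _)]
  exact integral_mono_of_nonneg (ae_of_all _ fun x => by positivity)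
    ((i1.const_mul _).add (i2.const_mul _)) (ae_of_all _ fun x => norm_sub_sub_sq_le _ _ _)

/-- Traces are unique on the edges. -/
theorem HasTrace.eq_edgePt {E : Polygon} {c : Plane} {r : ℝ} (hE : E.IsStar c r) {v : Plane → ℝ}
    (hv : MemH1 E.carrier v) {γ γ' : Plane → ℝ} (hγ : ContinuousOn γ (frontier E.carrier))
    (hγ' : ContinuousOn γ' (frontier E.carrier)) (h : HasTrace E v γ) (h' : HasTrace E v γ')
    (i : E.Idx) {t : ℝ} (ht : t ∈ Icc (0 : ℝ) 1) : γ (E.edgePt i t) = γ' (E.edgePt i t) := by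
  obtain ⟨φ, hφ, hφv, hφγ⟩ := h
  obtain ⟨ψ, hψ, hψv, hψγ⟩ := h'
  have hc := continuousOn_edge hγ i
  have hc' := continuousOn_edge hγ' i
  have hedge : ∀ {f : Plane → ℝ}, ContDiff ℝ ∞ f →
      ContinuousOn (fun t => f (E.edgePt i t)) (Icc 0 1) := fun hf =>
    (hf.continuous.comp (Polygon.continuous_edgePt i)).continuousOn
  set A : ℕ → ℝ := fun n => ∫ t in Icc (0 : ℝ) 1, (φ n (E.edgePt i t) - γ (E.edgePt i t)) ^ 2
  set B : ℕ → ℝ := fun n => ∫ t in Icc (0 : ℝ) 1, (ψ n (E.edgePt i t) - γ' (E.edgePt i t)) ^ 2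
  set X : ℕ → ℝ := fun n => ∫ x in E.carrier, (φ n x - v x) ^ 2
  set Y : ℕ → ℝ := fun n => ∫ x in E.carrier, (ψ n x - v x) ^ 2
  set X' : ℕ → ℝ := fun n => normSq E.carrier fun x => gradient (φ n) x - weakGrad E.carrier v x
  set Y' : ℕ → ℝ := fun n => normSq E.carrier fun x => gradient (ψ n) x - weakGrad E.carrier v x
  have hA : Tendsto A atTop (𝓝 0) := tendsto_integral_edge_sq hγ hφ (hφγ i)
  have hB : Tendsto B atTop (𝓝 0) := tendsto_integral_edge_sq hγ' hψ (hψγ i)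
  have hX : Tendsto X atTop (𝓝 0) := hφv.tendsto_integral_sq hφ hv
  have hY : Tendsto Y atTop (𝓝 0) := hψv.tendsto_integral_sq hψ hv
  have hX' : Tendsto X' atTop (𝓝 0) := hφv.tendsto_normSq hφ hv
  have hY' : Tendsto Y' atTop (𝓝 0) := hψv.tendsto_normSq hψ hv
  -- `γ` is compared with `φ n`, `φ n` with `ψ n` and `ψ n` with `γ'`. The middle difference is
  -- handled by the trace inequality, as both sequences converge to the same `v` in `H¹(E)`.
  have hbd : ∀ n, ∫ t in Icc (0 : ℝ) 1, (γ (E.edgePt i t) - γ' (E.edgePt i t)) ^ 2 ≤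
      2 * A n + 2 * (2 * B n + 2 * (|E.edgeDet c i|⁻¹ *
        (3 * (2 * X n + 2 * Y n) + E.diam ^ 2 * (2 * X' n + 2 * Y' n)))) := by
    intro n
    have h1 := integral_norm_sub_sq_le (memLp_of_continuousOn_Icc hc) (memLp_of_continuousOn_Icc hc')
      (memLp_of_continuousOn_Icc (hedge (hφ n)))
    have h2 := integral_norm_sub_sq_le (memLp_of_continuousOn_Icc hc')
      (memLp_of_continuousOn_Icc (hedge (hφ n))) (memLp_of_continuousOn_Icc (hedge (hψ n)))
    have h3 := hE.integral_edge_sq_le ((hφ n).sub (hψ n)) i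
    have h4 := integral_norm_sub_sq_le (E.memLp_of_continuous (hφ n).continuous)
      (E.memLp_of_continuous (hψ n).continuous) hv.1
    have h5 := integral_norm_sub_sq_le (E.memLp_of_continuous (continuous_gradient (hφ n)))
      (E.memLp_of_continuous (continuous_gradient (hψ n))) (weakGrad_spec hv).1
    simp only [Real.norm_eq_abs, sq_abs] at h1 h2 h4
    have e1 : normSq E.carrier (gradient fun x => φ n x - ψ n x) =
        ∫ x in E.carrier, ‖gradient (φ n) x - gradient (ψ n) x‖ ^ 2 := by
      simp only [normSq, gradient_sub (hφ n) (hψ n)]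
    have e2 : ∫ t in Icc (0 : ℝ) 1, (γ (E.edgePt i t) - φ n (E.edgePt i t)) ^ 2 = A n := by
      simp only [A]; congr 1; ext t; ring
    have e3 : ∫ t in Icc (0 : ℝ) 1, (γ' (E.edgePt i t) - ψ n (E.edgePt i t)) ^ 2 = B n := by
      simp only [B]; congr 1; ext t; ring
    have e4 : ∫ t in Icc (0 : ℝ) 1, (γ' (E.edgePt i t) - φ n (E.edgePt i t)) ^ 2 =
        ∫ t in Icc (0 : ℝ) 1, (φ n (E.edgePt i t) - γ' (E.edgePt i t)) ^ 2 := by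
      congr 1; ext t; ring
    simp only [e1] at h3
    rw [e3] at h2
    rw [e2] at h1
    have h6 : |E.edgeDet c i|⁻¹ * (3 * (∫ x in E.carrier, (φ n x - ψ n x) ^ 2) +
          E.diam ^ 2 * ∫ x in E.carrier, ‖gradient (φ n) x - gradient (ψ n) x‖ ^ 2) ≤
        |E.edgeDet c i|⁻¹ * (3 * (2 * X n + 2 * Y n) + E.diam ^ 2 * (2 * X' n + 2 * Y' n)) := by
      gcongr
      exact h5
    linarith
  have hlim := (hA.const_mul 2).add (((hB.const_mul 2).add ((((((hX.const_mul 2).add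
    (hY.const_mul 2)).const_mul 3).add (((hX'.const_mul 2).add (hY'.const_mul 2)).const_mul
      (E.diam ^ 2))).const_mul |E.edgeDet c i|⁻¹).const_mul 2)).const_mul 2)
  have hle : ∫ t in Icc (0 : ℝ) 1, (γ (E.edgePt i t) - γ' (E.edgePt i t)) ^ 2 ≤ 0 := by
    simpa using ge_of_tendsto' hlim hbd
  have hae := (integral_eq_zero_iff_of_nonneg (fun t => sq_nonneg _)
    ((memLp_of_continuousOn_Icc (hc.sub hc')).integrable_sq)).1
      (le_antisymm hle (integral_nonneg fun t => sq_nonneg _))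
  refine Measure.eqOn_Icc_of_ae_eq volume zero_ne_one ?_ hc hc' ht
  filter_upwards [hae] with s hs
  exact sub_eq_zero.1 (pow_eq_zero_iff two_ne_zero |>.1 hs)

/-- `trace` is an arbitrary choice, of which only these two properties are known;
`HasTrace.eq_edgePt` then identifies it on the edges with any explicit continuous trace. -/
theorem trace_spec {E : Polygon} {v γ : Plane → ℝ} (hγ : ContinuousOn γ (frontier E.carrier))
    (h : HasTrace E v γ) :
    ContinuousOn (trace E v) (frontier E.carrier) ∧ HasTrace E v (trace E v) := by
  have h' : ∃ γ, ContinuousOn γ (frontier E.carrier) ∧ HasTrace E v γ := ⟨γ, hγ, h⟩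
  rw [trace, dif_pos h']
  exact h'.choose_spec

/-! ### The degrees of freedom control the gradient -/

theorem abs_dof_le (E : Polygon) (ℓ : ℕ) (v : Plane → ℝ) (a : DofIdx E ℓ) :
    |dof E ℓ v a| ≤ √(∑ a, dof E ℓ v a ^ 2) :=
  Real.abs_le_sqrt (Finset.single_le_sum (f := fun a => dof E ℓ v a ^ 2)
    (fun _ _ => sq_nonneg _) (Finset.mem_univ a))

/-- Boundary values which are polynomials on the edges are controlled by the degrees of freedom. -/
theorem exists_abs_trace_le (ℓ : ℕ) : ∃ C, 0 ≤ C ∧ ∀ (E : Polygon) (v γ : Plane → ℝ),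
    (∀ i, ∀ t ∈ Icc (0 : ℝ) 1, trace E v (E.edgePt i t) = γ (E.edgePt i t)) →
    (∀ i, ∃ p : Polynomial ℝ, p.natDegree ≤ ℓ ∧ ∀ t ∈ Icc (0 : ℝ) 1, γ (E.edgePt i t) = p.eval t) →
    (∀ i, ∀ t ∈ Icc (0 : ℝ) 1, |γ (E.edgePt i t)| ≤ C * √(∑ a, dof E ℓ v a ^ 2)) ∧
    ∀ i, ∀ t ∈ Icc (0 : ℝ) 1, ∀ t' ∈ Icc (0 : ℝ) 1,
      |γ (E.edgePt i t) - γ (E.edgePt i t')| ≤ C * √(∑ a, dof E ℓ v a ^ 2) * |t - t'| := by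
  obtain ⟨C, hC0, hC⟩ := exists_abs_eval_le ℓ
  refine ⟨C, hC0, fun E v γ hvγ hp => ?_⟩
  choose p hpℓ hp using hp
  -- Only vertex values and edge moments determine the boundary values; the interior moments merely
  -- enlarge `S`.
  set S := √(∑ a, dof E ℓ v a ^ 2)
  have key := fun i => hC (p i) S (hpℓ i) (Real.sqrt_nonneg _)
    (by
      have h := abs_dof_le E ℓ v (.inl i)
      rwa [← hp i 0 (by simp), ← hvγ i 0 (by simp), Polygon.edgePt, AffineMap.lineMap_apply_zero])
    (by
      have h := abs_dof_le E ℓ v (.inl (i + 1))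
      rwa [← hp i 1 (by simp), ← hvγ i 1 (by simp), Polygon.edgePt, AffineMap.lineMap_apply_one])
    (fun j => by
      have h := abs_dof_le E ℓ v (.inr (.inl (i, j)))
      rw [dof] at h
      rwa [intervalIntegral.integral_congr fun t ht => ?_]
      rw [uIcc_of_le zero_le_one] at ht
      simp only [← hp i t ht, hvγ i t ht])
  refine ⟨fun i t ht => ?_, fun i t ht t' ht' => ?_⟩
  · rw [hp i t ht]; exact (key i).1 t ht
  · rw [hp i t ht, hp i t' ht']; exact (key i).2 t ht t' ht'

theorem stab_self (E : Polygon) (ℓ : ℕ) (m M : ℝ) (v : Plane → ℝ) :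
    stab E ℓ m M v v = M * m * ∑ a, dof E ℓ v a ^ 2 := by
  simp only [stab, sq]

/-- The stabilisation controls the distance of the gradient of a virtual element function to the
gradients of polynomials. -/
theorem exists_normSq_weakGrad_sub_le (ℓ : ℕ) {ρ m M : ℝ} (hρ : 0 < ρ) (hm : 0 < m) (hM : 0 < M) :
    ∃ C, 0 ≤ C ∧ ∀ (E : Polygon) (c : Plane), E.IsStar c (ρ * E.diam) →
      (∀ i, ρ * E.diam ≤ E.edgeLength i) → ∀ uh, MemEnlarged E ℓ uh →
      normSq E.carrier (fun x => weakGrad E.carrier uh x - vpolyFun (gradPoly (l2Proj E ℓ uh)) x) ≤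
        C * stabSq E ℓ m M uh := by
  obtain ⟨C₁, hC₁, h₁⟩ := exists_abs_trace_le ℓ
  obtain ⟨C₂, hC₂, h₂⟩ := exists_sqrt_normSq_le ℓ hρ
  refine ⟨(C₂ * C₁) ^ 2 / (M * m), by positivity, fun E c hE hedge uh hu => ?_⟩
  obtain ⟨hu1, ⟨γ, hγc, ⟨φ, hφ, hφu, hφγ⟩, hγp⟩, q, hq, hΔ⟩ := hu
  obtain ⟨hpℓ, hpq⟩ := isL2Proj_l2Proj E ℓ hu1.1
  rw [stabSq, stab_self]
  set p := l2Proj E ℓ uh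
  set G := weakGrad E.carrier uh with hGdef
  have hG : IsWeakGradient E.carrier uh G := weakGrad_spec hu1
  have hpW := isWeakGradient_polyFun E p
  have hps := contDiff_polyFun p
  set v : Plane → ℝ := fun x => uh x - polyFun p x with hv
  have hv2 : MemLp v 2 (volume.restrict E.carrier) := hu1.1.sub (memLp_polyFun E p)
  have hvW : IsWeakGradient E.carrier v fun x => G x - vpolyFun (gradPoly p) x :=
    hG.sub hu1.1 (memLp_polyFun E p) hpW
  have hv1 : MemH1 E.carrier v := ⟨hv2, _, hvW⟩
  have hae := (weakGrad_spec hv1).ae_eq E.isOpen hvW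
  set ψ : ℕ → Plane → ℝ := fun n x => φ n x - polyFun p x with hψdef
  set γ' : Plane → ℝ := fun x => γ x - polyFun p x with hγ'
  have hψ : ∀ n, ContDiff ℝ ∞ (ψ n) := fun n => (hφ n).sub hps
  have hψg : ∀ n x, gradient (ψ n) x = gradient (φ n) x - vpolyFun (gradPoly p) x := fun n x => by
    rw [hψdef, gradient_sub (hφ n) hps, gradient_polyFun]
  have hγ'c : ContinuousOn γ' (frontier E.carrier) := hγc.sub (continuous_polyFun p).continuousOn
  have hψγ : ∀ i, Tendsto (fun n => eLpNorm (fun t => ψ n (E.edgePt i t) - γ' (E.edgePt i t)) 2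
      (volume.restrict (Icc (0 : ℝ) 1))) atTop (𝓝 0) := fun i => by
    simpa only [hψdef, hγ', sub_sub_sub_cancel_right] using hφγ i
  have hψv : TendstoH1 E.carrier ψ v := by
    refine ⟨by simpa only [hψdef, hv, sub_sub_sub_cancel_right] using hφu.1, ?_⟩
    refine hφu.2.congr fun n => eLpNorm_congr_ae ?_
    filter_upwards [hae] with x hx
    rw [hψg, hx, sub_sub_sub_cancel_right]
  have htr : HasTrace E v γ' := ⟨ψ, hψ, hψv, hψγ⟩
  obtain ⟨htc, htt⟩ := trace_spec hγ'c htr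
  -- The degrees of freedom are defined through `trace E v`, which has to be identified with the
  -- explicit trace `γ'` of `u_h - 𝒫_ℓ u_h`.
  obtain ⟨hb1, hb2⟩ := h₁ E v γ' (fun i t ht => htt.eq_edgePt hE hv1 htc hγ'c htr i ht) fun i => by
    obtain ⟨a, ha, ha'⟩ := hγp i
    obtain ⟨b, hb, hb'⟩ := exists_polyFun_edgePt hpℓ E i
    refine ⟨a - b, (Polynomial.natDegree_sub_le _ _).trans (max_le ha hb), fun t ht => ?_⟩
    rw [Polynomial.eval_sub, ← ha' t ht, ← hb' t]
  -- This is the Laplacian of `v`. It lies in `ℙ_ℓ`, so the defining property of the projection,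
  -- tested with `q'` itself, gives `∫ q' v = 0`.
  set q' := q - divPoly (gradPoly p) with hq'
  have hq'ℓ : q' ∈ polyLE ℓ := sub_mem hq (divPoly_gradPoly_mem hpℓ)
  have hmain := h₂ E c hE hedge v hv2 _ hvW.1 ψ hψ (hψv.tendsto_integral_sq hψ hv1)
    (by
      refine (hφu.tendsto_normSq hφ hu1).congr fun n => ?_
      simp only [hψg, sub_sub_sub_cancel_right, hGdef])
    γ' (fun i => tendsto_integral_edge_sq hγ'c hψ (hψγ i)) q' hq'ℓ
    (fun χ hχ => by
      have hχg := E.memLp_of_continuous (continuous_gradient hχ.1)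
      simp_rw [inner_sub_left]
      rw [integral_sub (integrable_inner_of_memLp hG.1 hχg) (integrable_inner_of_memLp hpW.1 hχg),
        integral_inner_of_laplacian hu1.1 hG hΔ hχ, integral_inner_gradPoly E p hχ]
      have e : ∀ x, polyFun q' x * χ x =
          polyFun q x * χ x - polyFun (divPoly (gradPoly p)) x * χ x := fun x => by
        simp only [hq', polyFun, map_sub]; ring
      simp_rw [e]
      rw [integral_sub (integrable_mul_of_memLp (memLp_polyFun E _) hχ.memLp)
        (integrable_mul_of_memLp (memLp_polyFun E _) hχ.memLp)]
      ring)
    (by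
      simp_rw [hv, mul_sub]
      rw [integral_sub (integrable_mul_of_memLp (memLp_polyFun E _) hu1.1)
        (integrable_mul_of_memLp (memLp_polyFun E _) (memLp_polyFun E _))]
      simp_rw [mul_comm (polyFun q' _)]
      rw [hpq q' hq'ℓ, sub_self])
    _ hb1 hb2
  have hD : 0 ≤ ∑ a, dof E ℓ v a ^ 2 := Finset.sum_nonneg fun a _ => sq_nonneg _
  rw [Real.sqrt_le_left (by positivity), ← mul_assoc, mul_pow, Real.sq_sqrt hD] at hmain
  refine hmain.trans_eq ?_
  field_simp

/-! ### The inconsistency term -/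

/-- The mesh only gives `E ⊆ closure Ω`; since `E` is open and `Ω` is the interior of its closure,
`E` lies in `Ω`. -/
theorem Mesh.carrier_subset {Ω : Set Plane} (hΩ : IsPolygonalDomain Ω) (T : Mesh Ω) {E : Polygon}
    (hE : E ∈ T.elements) : E.carrier ⊆ Ω := by
  rw [← hΩ.interior_closure]
  refine interior_maximal ?_ E.isOpen
  rw [T.closure_eq]
  exact subset_closure.trans (subset_biUnion_of_mem (u := fun E : Polygon => closure E.carrier) hE)

/-- The inconsistency term is bounded by the oscillation of the flux of any field. -/
theorem inconsistency_le {Ω : Set Plane} {m M : ℝ} {μ : Plane → ℝ → ℝ}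
    (h : IsNonlinearity Ω m M μ) (hm : 0 < m) (hM : 0 < M) {E : Polygon} (hE : E.carrier ⊆ closure Ω)
    {G H K : Plane → Plane} (hG : MemLp G 2 (volume.restrict E.carrier))
    (hH : MemLp H 2 (volume.restrict E.carrier)) (hK : MemLp K 2 (volume.restrict E.carrier))
    (ℓ : ℕ) :
    oscSq E ℓ (flux μ K) ≤ 2 * oscSq E ℓ (flux μ G) +
      36 * M ^ 2 * (normSq E.carrier (fun x => G x - H x) + normSq E.carrier fun x => K x - H x) := by
  have hmE := E.isOpen.measurableSet
  have hFG := h.memLp_flux hm hmE hE hG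
  have hFK := h.memLp_flux hm hmE hE hK
  -- The projected flux of `G` is an admissible polynomial competitor for the flux of `K`.
  have h1 : oscSq E ℓ (flux μ K) ≤
      normSq E.carrier fun x => vpolyFun (l2ProjV E (ℓ - 1) (flux μ G)) x - flux μ K x :=
    normSq_l2ProjV_sub_le E (ℓ - 1) hFK fun i =>
      (isL2Proj_l2Proj E (ℓ - 1) (memLp_apply hFG i)).1
  have h2 := integral_norm_sub_sq_le (E.memLp_of_continuous
    (continuous_vpolyFun (l2ProjV E (ℓ - 1) (flux μ G)))) hFK hFG
  have h3 : ∫ x in E.carrier, ‖flux μ K x - flux μ G x‖ ^ 2 ≤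
      9 * M ^ 2 * ∫ x in E.carrier, ‖G x - K x‖ ^ 2 := by
    rw [← integral_const_mul]
    refine integral_mono_of_nonneg (ae_of_all _ fun x => by positivity)
      (((hG.sub hK).integrable_norm_pow two_ne_zero).const_mul _) ?_
    filter_upwards [ae_restrict_mem hmE] with x hx
    have h4 := pow_le_pow_left₀ (norm_nonneg _)
      (h.norm_smul_sub_smul_le hm hM (hE hx) (K x) (G x)) 2
    rw [norm_sub_rev (K x)] at h4
    exact h4.trans_eq (by ring)
  -- The constant `36M²` is `2·(3M)²·2`: two squared triangle inequalities around the squared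
  -- Lipschitz constant.
  have h5 := mul_le_mul_of_nonneg_left (integral_norm_sub_sq_le hG hK hH)
    (show 0 ≤ 18 * M ^ 2 by positivity)
  simp only [normSq, oscSq] at *
  linarith

end VEM

end

/-! ### Proof of the lower bound -/

theorem mainTheorem4 (ℓ : ℕ) (hℓ : 1 ≤ ℓ) (ρ m M : ℝ) (hρ : 0 < ρ) (hm : 0 < m) (hM : 0 < M) :
    ∃ C : ℝ, 0 < C ∧
      ∀ (Ω : Set VEM.Plane) (_ : VEM.IsPolygonalDomain Ω)
        (μ : VEM.Plane → ℝ → ℝ) (_ : VEM.IsNonlinearity Ω m M μ)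
        (f : VEM.Plane → ℝ) (_ : MemLp f 2 (volume.restrict Ω))
        (u : VEM.Plane → ℝ) (_ : VEM.IsWeakSolution Ω μ f u)
        (T : VEM.Mesh Ω) (_ : T.Regular ρ)
        (P : ∀ E : VEM.Polygon, VEM.Projections E ℓ) (_ : ∀ E ∈ T.elements, (P E).Admissible)
        (uh : VEM.Plane → ℝ) (_ : VEM.IsVEMSolution m M μ f T P uh),
        ∀ E ∈ T.elements,
          VEM.inconsistencySq Ω μ E ℓ uh ≤
            C * (VEM.normSq E.carrier (fun x => VEM.weakGrad Ω u x - VEM.weakGrad Ω uh x) +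
              VEM.stabSq E ℓ m M uh +
              VEM.oscSq E ℓ (VEM.flux μ (VEM.weakGrad Ω u))) := by
  obtain ⟨C, hC, hCE⟩ := VEM.exists_normSq_weakGrad_sub_le ℓ hρ hm hM
  refine ⟨2 + 36 * M ^ 2 * (1 + C), by positivity, ?_⟩
  intro Ω hΩ μ hμ f _ u hu T hT P _ uh huh E hE
  have hEΩ := T.carrier_subset hΩ hE
  obtain ⟨⟨c, hc⟩, hedge⟩ := hT E hE
  have hmem : VEM.MemEnlarged E ℓ uh := (huh.1.2 E hE).1
  have hG : MemLp (VEM.weakGrad Ω u) 2 (volume.restrict E.carrier) :=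
    ((VEM.weakGrad_spec hu.1.1).mono hΩ.isOpen.measurableSet hEΩ).1
  have hHw := (VEM.weakGrad_spec huh.1.1.1).mono hΩ.isOpen.measurableSet hEΩ
  -- The weak gradients of `u_h` on `Ω` and on `E` are separate choices, equal almost everywhere on
  -- `E`.
  have hae := hHw.ae_eq E.isOpen (VEM.weakGrad_spec hmem.1)
  have hmain := VEM.inconsistency_le hμ hm hM (hEΩ.trans subset_closure) hG hHw.1
    (E.memLp_of_continuous
      (VEM.continuous_vpolyFun (VEM.l2ProjV E (ℓ - 1) (VEM.weakGrad Ω uh)))) ℓ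
  -- The gradient of `𝒫_ℓ u_h` has degree at most `ℓ - 1`, so it competes with the projection of
  -- `∇u_h`; this brings in the function `u_h - 𝒫_ℓ u_h` measured by the stabilisation.
  have h1 := VEM.normSq_l2ProjV_sub_le E (ℓ - 1) hHw.1
    (VEM.gradPoly_mem (VEM.isL2Proj_l2Proj E ℓ hmem.1.1).1)
  have h2 : VEM.normSq E.carrier (fun x => VEM.vpolyFun (VEM.gradPoly (VEM.l2Proj E ℓ uh)) x -
      VEM.weakGrad Ω uh x) ≤ C * VEM.stabSq E ℓ m M uh := by
    refine le_trans (le_of_eq ?_) (hCE E c ⟨mul_pos hρ E.diam_pos, hc⟩ hedge uh hmem)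
    refine integral_congr_ae ?_
    filter_upwards [hae] with x hx
    rw [hx, norm_sub_rev]
  have hS : 0 ≤ VEM.stabSq E ℓ m M uh := by
    rw [VEM.stabSq, VEM.stab_self]
    exact mul_nonneg (by positivity) (Finset.sum_nonneg fun a _ => sq_nonneg _)
  have hD := VEM.normSq_nonneg E.carrier fun x => VEM.weakGrad Ω u x - VEM.weakGrad Ω uh x
  have hO : 0 ≤ VEM.oscSq E ℓ (VEM.flux μ (VEM.weakGrad Ω u)) := VEM.normSq_nonneg _ _
  rw [VEM.inconsistencySq]
  refine hmain.trans ?_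
  have h3 := mul_le_mul_of_nonneg_left (h1.trans h2) (show 0 ≤ 36 * M ^ 2 by positivity)
  have h4 : 0 ≤ 36 * M ^ 2 * C := by positivity
  have h5 : 0 ≤ 36 * M ^ 2 := by positivity
  nlinarith [mul_nonneg h4 hD, mul_nonneg h4 hO, mul_nonneg h5 hS, mul_nonneg h5 hO]
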